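/- Let $b>a>0$. Let $X_1,X_2,\dots$ and $Y_1,Y_2,\dots$ be two independent sequences of i.i.d. non-negative random variables, with moments $a_k=\mathbf{E}X_1^k$ and $b_k=\mathbf{E}Y_1^k$, such that $\mathbf{E}X_1^4<\infty$, $\mathbf{E}Y_1^3<\infty$, $\mathbf{P}(X_1>0)>0$ and $\mathbf{P}(Y_1>0)>0$. Given these weights, let $H_{X,Y}$ be the random bipartite graph with parts $\{w_1,w_2,\dots\}$ and $\{v_1,v_2,\dots\}$ in which the edges $\{w_i,v_j\}$ are inserted independently with probabilities $$p_{ij}=\min\Bigl\{1,\frac{X_iY_j}{\sqrt{ij}}\Bigr\}\,\mathbb{I}_{\{aj\le i\le bj\}}$$ (that is, $\tau(t)=t$). Let $G_{X,Y}$ be the random intersection graph on $\{v_1,v_2,\dots\}$ in which two distinct vertices $u,v$ are adjacent ($u\sim v$) whenever they have a common neighbour in $H_{X,Y}$, and let $d(v_t)$ be the degree of $v_t$ in $G_{X,Y}$. Let $\mathbf{E}_{st}$ denote the conditional expectation given the event $v_s\sim v_t$, let $\mathbf{Var}_{st}Z=\mathbf{E}_{st}Z^2-(\mathbf{E}_{st}Z)^2$,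 and let $$r_{st}=\frac{\mathbf{E}_{st}d(v_s)d(v_t)-\mathbf{E}_{st}d(v_s)\,\mathbf{E}_{st}d(v_t)}{\sqrt{\mathbf{Var}_{st}d(v_s)\,\mathbf{Var}_{st}d(v_t)}}$$ be the assortativity coefficient. Put $\tilde\gamma=2(a^{-1/2}-b^{-1/2})$ and $$h_1=a_2b_1^2,\quad h_2=a_3b_1^3\tilde\gamma,\quad h_3=a_2^2b_1^2b_2\tilde\gamma(\sqrt b-\sqrt a),\quad h_4=a_4b_1^4\tilde\gamma^2,$$ $$h_5=a_2a_3b_1^3b_2\tilde\gamma^2(\sqrt b-\sqrt a),\quad h_6=a_2^3b_1^3b_3\tilde\gamma^2(\sqrt b-\sqrt a)^2,\quad h_7=a_2^3b_1^2b_2^2\tilde\gamma^2(\sqrt b-\sqrt a)^2,$$ $$\delta_1=1+h_1^{-1}(h_2+2h_3),\quad \delta_2=1+h_1^{-1}(3h_2+6h_3+h_4+6h_5+4h_6),\quad \Delta=h_1^{-1}\bigl(2h_3+2h_5+4(h_6-h_7)\bigr).$$ Let $s,t\to\infty$ with $s<t$ and $bs-at\to+\infty$. Then, eventually, $\mathbf{P}(v_s\sim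 v_t)>0$ and $d(v_s),d(v_t)$ have finite second moments conditionally on $v_s\sim v_t$, and $$\mathbf{E}_{st}d(v_s)=\mathbf{E}_{st}d(v_t)+o(1)=\delta_1+o(1),\qquad \mathbf{E}_{st}d^2(v_s)=\mathbf{E}_{st}d^2(v_t)+o(1)=\delta_2+o(1),$$ $$\mathbf{E}_{st}d(v_s)d(v_t)=\delta_2-\Delta+o(1).$$ Moreover $\delta_2-\delta_1^2>0$, and $$r_{st}=1-\frac{\Delta}{\delta_2-\delta_1^2}+o(1).$$ -/

import Mathlib

open MeasureTheory ProbabilityTheory Filter Topology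
open scoped NNReal

noncomputable section

namespace RandomIntersection

/-- The weights: `w.1 i` is the weight `x_i` of the item `w_i`, `w.2 j` is the weight `y_j` of the
actor `v_j`. Items and actors of the model are numbered `1, 2, …`; the additional index `0` plays
no role, because `edgeProb` vanishes as soon as one of the two indices is `0`. -/
abbrev Weights : Type := (ℕ → ℝ≥0) × (ℕ → ℝ≥0)

/-- A bipartite graph with parts `W = {w_i}` and `V = {v_j}`: `H (i, j) = true` means that
`{w_i, v_j}` is an edge. -/
abbrev BipartiteGraph : Type := ℕ × ℕ → Bool

/-- The probability `p_{ij} = min {1, x_i y_j / √(i j)} 𝟙{a τ(j) ≤ i ≤ b τ(j)}` of the edge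
`{w_i, v_j}`. -/
def edgeProb (a b : ℝ) (τ : ℕ → ℝ) (w : Weights) (i j : ℕ) : ℝ :=
  if a * τ j ≤ i ∧ (i : ℝ) ≤ b * τ j then
    min 1 ((w.1 i : ℝ) * (w.2 j : ℝ) / √((i : ℝ) * (j : ℝ)))
  else 0

lemma edgeProb_mem_unitInterval (a b : ℝ) (τ : ℕ → ℝ) (w : Weights) (i j : ℕ) :
    edgeProb a b τ w i j ∈ unitInterval := by
  unfold edgeProb
  split_ifs
  · exact ⟨le_min zero_le_one (by positivity), min_le_left _ _⟩
  · exact ⟨le_rfl, zero_le_one⟩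

lemma edgeProb_zero_left (a b : ℝ) (τ : ℕ → ℝ) (w : Weights) (j : ℕ) :
    edgeProb a b τ w 0 j = 0 := by
  simp [edgeProb]

lemma edgeProb_zero_right (a b : ℝ) (τ : ℕ → ℝ) (w : Weights) (i : ℕ) :
    edgeProb a b τ w i 0 = 0 := by
  simp [edgeProb]

lemma measurable_edgeProb (a b : ℝ) (τ : ℕ → ℝ) (i j : ℕ) :
    Measurable fun w : Weights => edgeProb a b τ w i j := by
  unfold edgeProb
  split_ifs
  · fun_prop
  · exact measurable_const

/-- The law of the random bipartite graph `H_{x,y}` with given weights: the edges `{w_i, v_j}` are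
inserted independently, with probabilities `p_{ij}`. -/
def bipartiteLaw (a b : ℝ) (τ : ℕ → ℝ) (w : Weights) : Measure BipartiteGraph :=
  Measure.infinitePi fun e : ℕ × ℕ =>
    bernoulliMeasure true false ⟨edgeProb a b τ w e.1 e.2, edgeProb_mem_unitInterval a b τ w e.1 e.2⟩

instance (a b : ℝ) (τ : ℕ → ℝ) (w : Weights) : IsProbabilityMeasure (bipartiteLaw a b τ w) := by
  unfold bipartiteLaw
  infer_instance

lemma measurable_bipartiteLaw (a b : ℝ) (τ : ℕ → ℝ) : Measurable (bipartiteLaw a b τ) := by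
  refine Measurable.measure_of_isPiSystem_of_isProbabilityMeasure
    (generateFrom_squareCylinders (α := fun _ : ℕ × ℕ => Bool)).symm
    (isPiSystem_squareCylinders (fun _ => MeasurableSpace.isPiSystem_measurableSet)
      (fun _ => (MeasurableSet.univ : MeasurableSet (Set.univ : Set Bool)))) ?_
  rintro _ ⟨s, t, ht, rfl⟩
  have h : ∀ w, bipartiteLaw a b τ w ((s : Set (ℕ × ℕ)).pi t) = ∏ e ∈ s,
      bernoulliMeasure true false
        ⟨edgeProb a b τ w e.1 e.2, edgeProb_mem_unitInterval a b τ w e.1 e.2⟩ (t e) := by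
    intro w
    exact Measure.infinitePi_pi _ fun i _ => ht i (Set.mem_univ i)
  simp_rw [h]
  refine Finset.measurable_prod _ fun e _ => ?_
  have hm := measurable_edgeProb a b τ e.1 e.2
  have hp : Measurable fun w : Weights => (⟨edgeProb a b τ w e.1 e.2,
      edgeProb_mem_unitInterval a b τ w e.1 e.2⟩ : unitInterval) := hm.subtype_mk
  have hq : Measurable fun w : Weights => unitInterval.symm (⟨edgeProb a b τ w e.1 e.2,
      edgeProb_mem_unitInterval a b τ w e.1 e.2⟩ : unitInterval) :=
    unitInterval.continuous_symm.measurable.comp hp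
  have hn : Measurable unitInterval.toNNReal := unitInterval.toNNReal_continuous.measurable
  have hte : MeasurableSet (t e) := ht e (Set.mem_univ e)
  classical
  simp_rw [bernoulliMeasure_apply _ hte]
  split_ifs
  · exact measurable_const
  · exact (hn.comp hp).coe_nnreal_ennreal
  · exact (hn.comp hq).coe_nnreal_ennreal
  · exact measurable_const

/-- The weights `X_i` and `Y_j` being random, `bipartiteKernel` is the conditional law of the
bipartite graph `H_{X,Y}` given the weights. -/
def bipartiteKernel (a b : ℝ) (τ : ℕ → ℝ) : Kernel Weights BipartiteGraph where
  toFun := bipartiteLaw a b τ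
  measurable' := measurable_bipartiteLaw a b τ

instance (a b : ℝ) (τ : ℕ → ℝ) : IsMarkovKernel (bipartiteKernel a b τ) :=
  ⟨fun w => inferInstanceAs (IsProbabilityMeasure (bipartiteLaw a b τ w))⟩

/-- The sample space: the weights together with the bipartite graph. -/
abbrev Sample : Type := Weights × BipartiteGraph

/-- The joint law of the weights and of the bipartite graph `H_{X,Y}`: the `X_i` are i.i.d. with law
`μX`, the `Y_j` are i.i.d. with law `μY`, both sequences are independent, and given the weights
the bipartite graph has the law `bipartiteLaw`. -/
def law (a b : ℝ) (τ : ℕ → ℝ) (μX μY : Measure ℝ≥0) [IsProbabilityMeasure μX]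
    [IsProbabilityMeasure μY] : Measure Sample :=
  ((Measure.infinitePi fun _ : ℕ => μX).prod (Measure.infinitePi fun _ : ℕ => μY)) ⊗ₘ
    bipartiteKernel a b τ

/-- The random intersection graph `G_{X,Y}`: two distinct vertices `v_s`, `v_t` are adjacent when
they have a common neighbour in the bipartite graph. -/
def graph (ω : Sample) : SimpleGraph ℕ where
  Adj s t := s ≠ t ∧ ∃ i, ω.2 (i, s) = true ∧ ω.2 (i, t) = true
  symm := ⟨fun _ _ h => ⟨h.1.symm, h.2.imp fun _ hi => hi.symm⟩⟩
  loopless := ⟨fun _ h => h.1 rfl⟩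

/-- The degree `d(v_t)` of `v_t` in `G_{X,Y}`. -/
def deg (t : ℕ) (ω : Sample) : ℝ := ((graph ω).neighborSet t).ncard

/-- The event `v_s ∼ v_t`. -/
def adjEvent (s t : ℕ) : Set Sample := {ω | (graph ω).Adj s t}

/-- The conditional probability given the event `v_s ∼ v_t`. -/
def condLaw (P : Measure Sample) (s t : ℕ) : Measure Sample := P[|adjEvent s t]

/-- The conditional expectation `E_{st}` given the event `v_s ∼ v_t`. -/
def condE (P : Measure Sample) (s t : ℕ) (Z : Sample → ℝ) : ℝ := ∫ ω, Z ω ∂(condLaw P s t)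

/-- The conditional variance `Var_{st} Z = E_{st} Z² - (E_{st} Z)²`. -/
def condVariance (P : Measure Sample) (s t : ℕ) (Z : Sample → ℝ) : ℝ :=
  condE P s t (fun ω => Z ω ^ 2) - condE P s t Z ^ 2

/-- The assortativity coefficient `r_{st}`. -/
def assortativity (P : Measure Sample) (s t : ℕ) : ℝ :=
  (condE P s t (fun ω => deg s ω * deg t ω) - condE P s t (deg s) * condE P s t (deg t)) /
    √(condVariance P s t (deg s) * condVariance P s t (deg t))

/-- The filter on pairs `(s, t)` expressing: `s < t`, `s, t → ∞` and `b s - a t → ∞`. -/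
def pairLimit (a b : ℝ) : Filter (ℕ × ℕ) :=
  comap Prod.fst atTop ⊓ comap Prod.snd atTop ⊓
    comap (fun p : ℕ × ℕ => b * (p.1 : ℝ) - a * (p.2 : ℝ)) atTop ⊓ 𝓟 {p | p.1 < p.2}

/-- The `k`-th moment of a law on `[0, ∞)`. -/
def wmoment (μ : Measure ℝ≥0) (k : ℕ) : ℝ := ∫ x, (x : ℝ) ^ k ∂μ

/-- `γ̃ = 2 (a^{-1/2} - b^{-1/2})`. -/
def gam (a b : ℝ) : ℝ := 2 * ((√a)⁻¹ - (√b)⁻¹)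

section Constants

variable (a b : ℝ) (μX μY : Measure ℝ≥0)

/-- `h₁ = a₂ b₁²`, where `a_k` and `b_k` are the moments of `X_1` and of `Y_1`. -/
def h₁ : ℝ := wmoment μX 2 * wmoment μY 1 ^ 2

/-- `h₂ = a₃ b₁³ γ̃`. -/
def h₂ : ℝ := wmoment μX 3 * wmoment μY 1 ^ 3 * gam a b

/-- `h₃ = a₂² b₁² b₂ γ̃ (√b - √a)`. -/
def h₃ : ℝ := wmoment μX 2 ^ 2 * wmoment μY 1 ^ 2 * wmoment μY 2 * gam a b * (√b - √a)

/-- `h₄ = a₄ b₁⁴ γ̃²`. -/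
def h₄ : ℝ := wmoment μX 4 * wmoment μY 1 ^ 4 * gam a b ^ 2

/-- `h₅ = a₂ a₃ b₁³ b₂ γ̃² (√b - √a)`. -/
def h₅ : ℝ :=
  wmoment μX 2 * wmoment μX 3 * wmoment μY 1 ^ 3 * wmoment μY 2 * gam a b ^ 2 * (√b - √a)

/-- `h₆ = a₂³ b₁³ b₃ γ̃² (√b - √a)²`. -/
def h₆ : ℝ :=
  wmoment μX 2 ^ 3 * wmoment μY 1 ^ 3 * wmoment μY 3 * gam a b ^ 2 * (√b - √a) ^ 2

/-- `h₇ = a₂³ b₁² b₂² γ̃² (√b - √a)²`. -/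
def h₇ : ℝ :=
  wmoment μX 2 ^ 3 * wmoment μY 1 ^ 2 * wmoment μY 2 ^ 2 * gam a b ^ 2 * (√b - √a) ^ 2

/-- `δ₁ = 1 + h₁⁻¹ (h₂ + 2 h₃)`. -/
def δ₁ : ℝ := 1 + (h₁ μX μY)⁻¹ * (h₂ a b μX μY + 2 * h₃ a b μX μY)

/-- `δ₂ = 1 + h₁⁻¹ (3 h₂ + 6 h₃ + h₄ + 6 h₅ + 4 h₆)`. -/
def δ₂ : ℝ :=
  1 + (h₁ μX μY)⁻¹ * (3 * h₂ a b μX μY + 6 * h₃ a b μX μY + h₄ a b μX μY + 6 * h₅ a b μX μY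
    + 4 * h₆ a b μX μY)

/-- `Δ = h₁⁻¹ (2 h₃ + 2 h₅ + 4 (h₆ - h₇))`. -/
def bigDelta : ℝ :=
  (h₁ μX μY)⁻¹ * (2 * h₃ a b μX μY + 2 * h₅ a b μX μY + 4 * (h₆ a b μX μY - h₇ a b μX μY))

end Constants

end RandomIntersection

end

open RandomIntersection

/-!
Conditionally on the weights, the probability that all edges of a finite set are present is the
product of the edge probabilities, each at most `X_i Y_j / √(i j)`. Hence the expected number of
configurations of a given shape (a path `v_s - w_i - v_t`, or several such paths glued together) is
at most a product of moments of the weights times a deterministic sum of products of the kernel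
`1 / √(i j)` over `a j ≤ i ≤ b j`. When the weights are truncated at a level `M`, equality holds for
large indices, as then `X_i Y_j ≤ √(i j)`. All expectations are compared with the probability of
`v_s ∼ v_t`, which is of the order of the sum of `1 / (i √(s t))` over the common items `w_i`.

Products of the indicator of `v_s ∼ v_t` with degrees count such configurations up to those in
which a cycle of length four occurs, and a cycle costs a factor which tends to `0`. The remaining
sums are classified by the coincidences between their items; the sums over free actors and free
items become the integrals of `1 / √x` over `[1 / b, 1 / a]` and over `[a, b]`, which are `γ̃` and
`2 (√b - √a)`. Letting `M → ∞` gives the conditional moments. Positivity of `δ₂ - δ₁²` is the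
Cauchy-Schwarz inequality for the moments, in the form `h₂² ≤ h₁ h₄` and `h₃² ≤ h₁ h₆`, together
with `h₁ h₅ = h₂ h₃`.
-/

noncomputable section

namespace RandomIntersection

section EdgeConfigurations

open scoped ENNReal Finset

/-- The event that all edges of `F` are present and that the weights of their ends lie in `T`. -/
def cylinder (T : Set ℝ≥0) (F : Finset (ℕ × ℕ)) : Set Sample :=
  {ω | ∀ e ∈ F, ω.2 e = true ∧ ω.1.1 e.1 ∈ T ∧ ω.1.2 e.2 ∈ T}

/-- The moments of a law restricted to the set `T`; for `k = 0` the restriction is ignored, because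
`0 ^ 0 = 1`. -/
def truncMoment (T : Set ℝ≥0) (μ : Measure ℝ≥0) (k : ℕ) : ℝ :=
  ∫ x, ((T.indicator id x : ℝ≥0) : ℝ) ^ k ∂μ

/-- The kernel `𝟙{a τ(j) ≤ i ≤ b τ(j)} / √(i j)`: the edge probability for unit weights, before it
is capped by `1`. -/
def edgeKernel (a b : ℝ) (τ : ℕ → ℝ) (i j : ℕ) : ℝ :=
  if a * τ j ≤ i ∧ (i : ℝ) ≤ b * τ j then 1 / √((i : ℝ) * j) else 0

/-- The number of edges of `F` at the item `i`. -/
def itemDeg (F : Finset (ℕ × ℕ)) (i : ℕ) : ℕ := #{e ∈ F | e.1 = i}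

/-- The number of edges of `F` at the actor `j`. -/
def actorDeg (F : Finset (ℕ × ℕ)) (j : ℕ) : ℕ := #{e ∈ F | e.2 = j}

/-- The weight of a finite set of edges: the product of the kernel over the edges, times the moments
of the item weights and of the actor weights of the orders given by the degrees. It is the
probability that all these edges are present, were the edge probabilities not capped by `1`. -/
def edgeWeight (κ : ℕ → ℕ → ℝ) (mX mY : ℕ → ℝ) (F : Finset (ℕ × ℕ)) : ℝ :=
  (∏ e ∈ F, κ e.1 e.2) * (∏ i ∈ F.image Prod.fst, mX (itemDeg F i)) *
    ∏ j ∈ F.image Prod.snd, mY (actorDeg F j)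

lemma edgeKernel_nonneg (a b : ℝ) (τ : ℕ → ℝ) (i j : ℕ) : 0 ≤ edgeKernel a b τ i j := by
  unfold edgeKernel
  split_ifs <;> positivity

lemma truncMoment_nonneg (T : Set ℝ≥0) (μ : Measure ℝ≥0) (k : ℕ) : 0 ≤ truncMoment T μ k :=
  integral_nonneg fun x => by positivity

lemma truncMoment_univ (μ : Measure ℝ≥0) (k : ℕ) : truncMoment Set.univ μ k = wmoment μ k := by
  simp [truncMoment, wmoment]

lemma edgeWeight_nonneg {κ : ℕ → ℕ → ℝ} {mX mY : ℕ → ℝ} (hκ : ∀ i j, 0 ≤ κ i j)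
    (hX : ∀ k, 0 ≤ mX k) (hY : ∀ k, 0 ≤ mY k) (F : Finset (ℕ × ℕ)) :
    0 ≤ edgeWeight κ mX mY F :=
  mul_nonneg (mul_nonneg (Finset.prod_nonneg fun _ _ => hκ _ _)
    (Finset.prod_nonneg fun _ _ => hX _)) (Finset.prod_nonneg fun _ _ => hY _)

lemma prod_pow_itemDeg (F : Finset (ℕ × ℕ)) (B : ℝ) :
    ∏ i ∈ F.image Prod.fst, B ^ itemDeg F i = B ^ #F := by
  rw [← Finset.prod_const, Finset.prod_comp (fun _ => B) Prod.fst]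
  rfl

lemma prod_pow_actorDeg (F : Finset (ℕ × ℕ)) (B : ℝ) :
    ∏ j ∈ F.image Prod.snd, B ^ actorDeg F j = B ^ #F := by
  rw [← Finset.prod_const, Finset.prod_comp (fun _ => B) Prod.snd]
  rfl

lemma edgeWeight_le_prod {κ : ℕ → ℕ → ℝ} {mX mY : ℕ → ℝ} (hκ : ∀ i j, 0 ≤ κ i j)
    (hX : ∀ k, 0 ≤ mX k) (hY : ∀ k, 0 ≤ mY k) {B : ℝ} (F : Finset (ℕ × ℕ))
    (hXB : ∀ i, mX (itemDeg F i) ≤ B ^ itemDeg F i)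
    (hYB : ∀ j, mY (actorDeg F j) ≤ B ^ actorDeg F j) :
    edgeWeight κ mX mY F ≤ ∏ e ∈ F, B ^ 2 * κ e.1 e.2 := by
  have hκF : 0 ≤ ∏ e ∈ F, κ e.1 e.2 := Finset.prod_nonneg fun _ _ => hκ _ _
  calc edgeWeight κ mX mY F
      ≤ (∏ e ∈ F, κ e.1 e.2) * (∏ i ∈ F.image Prod.fst, B ^ itemDeg F i) *
          ∏ j ∈ F.image Prod.snd, B ^ actorDeg F j := by
        refine mul_le_mul (mul_le_mul_of_nonneg_left ?_ hκF) ?_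
          (Finset.prod_nonneg fun _ _ => hY _) (mul_nonneg hκF ?_)
        · exact Finset.prod_le_prod (fun _ _ => hX _) fun i _ => hXB i
        · exact Finset.prod_le_prod (fun _ _ => hY _) fun j _ => hYB j
        · exact Finset.prod_nonneg fun i _ => (hX _).trans (hXB i)
    _ = ∏ e ∈ F, B ^ 2 * κ e.1 e.2 := by
        rw [prod_pow_itemDeg, prod_pow_actorDeg, Finset.prod_mul_distrib, Finset.prod_const]
        ring

lemma measurableSet_cylinder {T : Set ℝ≥0} (hT : MeasurableSet T) (F : Finset (ℕ × ℕ)) :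
    MeasurableSet (cylinder T F) := by
  have h : cylinder T F = ⋂ e ∈ F, ({ω : Sample | ω.2 e = true} ∩
      ((fun ω : Sample => ω.1.1 e.1) ⁻¹' T ∩ (fun ω : Sample => ω.1.2 e.2) ⁻¹' T)) := by
    ext ω
    simp [cylinder]
  rw [h]
  refine Finset.measurableSet_biInter _ fun e _ => MeasurableSet.inter ?_
    ((hT.preimage (by fun_prop)).inter (hT.preimage (by fun_prop)))
  exact (measurableSet_singleton true).preimage
    (show Measurable fun ω : Sample => ω.2 e by fun_prop)

lemma cylinder_union (T : Set ℝ≥0) (F F' : Finset (ℕ × ℕ)) :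
    cylinder T (F ∪ F') = cylinder T F ∩ cylinder T F' := by
  ext ω
  exact Finset.forall_mem_union

lemma bipartiteLaw_forall_edge (a b : ℝ) (τ : ℕ → ℝ) (w : Weights) (F : Finset (ℕ × ℕ)) :
    bipartiteLaw a b τ w {H | ∀ e ∈ F, H e = true} =
      ∏ e ∈ F, ENNReal.ofReal (edgeProb a b τ w e.1 e.2) := by
  have h : {H : BipartiteGraph | ∀ e ∈ F, H e = true} =
      (F : Set (ℕ × ℕ)).pi fun _ => {true} := by
    ext H
    simp
  rw [h, bipartiteLaw, Measure.infinitePi_pi _ fun _ _ => measurableSet_singleton _]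
  refine Finset.prod_congr rfl fun e _ => ?_
  rw [bernoulliMeasure_apply_of_mem_of_notMem _ (measurableSet_singleton _) (by simp) (by simp),
    ENNReal.ofReal, Real.toNNReal_of_nonneg (edgeProb_mem_unitInterval a b τ w e.1 e.2).1]
  rfl

lemma bipartiteLaw_section_cylinder (a b : ℝ) (τ : ℕ → ℝ) (w : Weights) (T : Set ℝ≥0)
    (F : Finset (ℕ × ℕ)) :
    bipartiteLaw a b τ w (Prod.mk w ⁻¹' cylinder T F) =
      ∏ e ∈ F, (ENNReal.ofReal (edgeProb a b τ w e.1 e.2) *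
        (T.indicator 1 (w.1 e.1) * T.indicator 1 (w.2 e.2))) := by
  by_cases h : ∀ e ∈ F, w.1 e.1 ∈ T ∧ w.2 e.2 ∈ T
  · have hsec : Prod.mk w ⁻¹' cylinder T F = {H | ∀ e ∈ F, H e = true} := by
      ext H
      exact ⟨fun hH e he => (hH e he).1, fun hH e he => ⟨hH e he, h e he⟩⟩
    rw [hsec, bipartiteLaw_forall_edge]
    refine Finset.prod_congr rfl fun e he => ?_
    rw [Set.indicator_of_mem (h e he).1, Set.indicator_of_mem (h e he).2]
    simp
  · push Not at h
    obtain ⟨e, he, h⟩ := h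
    have hsec : Prod.mk w ⁻¹' cylinder T F = ∅ :=
      Set.eq_empty_of_forall_notMem fun H hH => h (hH e he).2.1 (hH e he).2.2
    rw [hsec, measure_empty, eq_comm]
    refine Finset.prod_eq_zero he ?_
    by_cases hX : w.1 e.1 ∈ T
    · simp [h hX]
    · simp [hX]

lemma lintegral_infinitePi_prod_comp {α ι β : Type*} [MeasurableSpace α] [DecidableEq ι]
    (μ : Measure α) [IsProbabilityMeasure μ] {f : α → ℝ≥0∞} (hf : Measurable f) (F : Finset β)
    (g : β → ι) :
    ∫⁻ x, ∏ e ∈ F, f (x (g e)) ∂(Measure.infinitePi fun _ : ι => μ) =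
      ∏ i ∈ F.image g, ∫⁻ x, f x ^ #{e ∈ F | g e = i} ∂μ := by
  simp_rw [fun x : ι → α => Finset.prod_comp (s := F) (fun i => f (x i)) g]
  rw [lintegral_prod_eq_prod_lintegral_of_indepFun (F.image g)
    (fun i (x : ι → α) => f (x i) ^ #{e ∈ F | g e = i})
    (iIndepFun_infinitePi (P := fun _ : ι => μ) fun i => hf.pow_const _)
    fun i => (hf.comp (measurable_pi_apply i)).pow_const _]
  exact Finset.prod_congr rfl fun i _ =>
    (measurePreserving_eval_infinitePi (fun _ : ι => μ) i).lintegral_comp (hf.pow_const _)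

lemma lintegral_indicator_pow_eq_ofReal_truncMoment {μ : Measure ℝ≥0} {T : Set ℝ≥0} {k : ℕ}
    (h : Integrable (fun x : ℝ≥0 => ((T.indicator id x : ℝ≥0) : ℝ) ^ k) μ) :
    ∫⁻ x, ((T.indicator id x : ℝ≥0) : ℝ≥0∞) ^ k ∂μ = ENNReal.ofReal (truncMoment T μ k) := by
  rw [truncMoment, ofReal_integral_eq_lintegral_ofReal h (ae_of_all _ fun x => by positivity)]
  refine lintegral_congr fun x => ?_
  rw [ENNReal.ofReal_pow (by positivity), ENNReal.ofReal_coe_nnreal]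

variable {a b : ℝ} {τ : ℕ → ℝ} {μX μY : Measure ℝ≥0} [IsProbabilityMeasure μX]
  [IsProbabilityMeasure μY]

instance : IsProbabilityMeasure (law a b τ μX μY) := by
  unfold law
  infer_instance

lemma law_cylinder {T : Set ℝ≥0} (hT : MeasurableSet T) (F : Finset (ℕ × ℕ)) :
    law a b τ μX μY (cylinder T F) =
      ∫⁻ w, ∏ e ∈ F, (ENNReal.ofReal (edgeProb a b τ w e.1 e.2) *
        (T.indicator 1 (w.1 e.1) * T.indicator 1 (w.2 e.2)))
        ∂((Measure.infinitePi fun _ : ℕ => μX).prod (Measure.infinitePi fun _ : ℕ => μY)) := by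
  rw [law, Measure.compProd_apply (measurableSet_cylinder hT F)]
  exact lintegral_congr fun w => bipartiteLaw_section_cylinder a b τ w T F

lemma ofReal_edgeWeight_eq_lintegral {κ : ℕ → ℕ → ℝ} (hκ : ∀ i j, 0 ≤ κ i j) {T : Set ℝ≥0}
    (hT : MeasurableSet T) (F : Finset (ℕ × ℕ))
    (hX : ∀ i, Integrable (fun x : ℝ≥0 => ((T.indicator id x : ℝ≥0) : ℝ) ^ itemDeg F i) μX)
    (hY : ∀ j, Integrable (fun x : ℝ≥0 => ((T.indicator id x : ℝ≥0) : ℝ) ^ actorDeg F j) μY) :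
    ENNReal.ofReal (edgeWeight κ (truncMoment T μX) (truncMoment T μY) F) =
      ∫⁻ w, ∏ e ∈ F, (ENNReal.ofReal (κ e.1 e.2) *
        (((T.indicator id (w.1 e.1) : ℝ≥0) : ℝ≥0∞) * ((T.indicator id (w.2 e.2) : ℝ≥0) : ℝ≥0∞)))
        ∂((Measure.infinitePi fun _ : ℕ => μX).prod (Measure.infinitePi fun _ : ℕ => μY)) := by
  have hf : Measurable fun x : ℝ≥0 => ((T.indicator id x : ℝ≥0) : ℝ≥0∞) :=
    (measurable_id.indicator hT).coe_nnreal_ennreal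
  have hm (g : ℕ × ℕ → ℕ) : Measurable fun x : ℕ → ℝ≥0 =>
      ∏ e ∈ F, ((T.indicator id (x (g e)) : ℝ≥0) : ℝ≥0∞) :=
    Finset.measurable_prod _ fun e _ => hf.comp (measurable_pi_apply (g e))
  have hm' : Measurable fun w : Weights => (∏ e ∈ F, ((T.indicator id (w.1 e.1) : ℝ≥0) : ℝ≥0∞)) *
      ∏ e ∈ F, ((T.indicator id (w.2 e.2) : ℝ≥0) : ℝ≥0∞) :=
    ((hm Prod.fst).comp measurable_fst).mul ((hm Prod.snd).comp measurable_snd)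
  simp_rw [Finset.prod_mul_distrib]
  rw [lintegral_const_mul _ hm',
    lintegral_prod_mul (hm Prod.fst).aemeasurable (hm Prod.snd).aemeasurable,
    lintegral_infinitePi_prod_comp μX hf, lintegral_infinitePi_prod_comp μY hf, edgeWeight,
    ENNReal.ofReal_mul (mul_nonneg (Finset.prod_nonneg fun _ _ => hκ _ _)
      (Finset.prod_nonneg fun _ _ => truncMoment_nonneg _ _ _)),
    ENNReal.ofReal_mul (Finset.prod_nonneg fun _ _ => hκ _ _),
    ENNReal.ofReal_prod_of_nonneg fun _ _ => hκ _ _,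
    ENNReal.ofReal_prod_of_nonneg fun _ _ => truncMoment_nonneg _ _ _,
    ENNReal.ofReal_prod_of_nonneg fun _ _ => truncMoment_nonneg _ _ _, mul_assoc]
  congr 2
  · exact Finset.prod_congr rfl fun i _ =>
      (lintegral_indicator_pow_eq_ofReal_truncMoment (hX i)).symm
  · exact Finset.prod_congr rfl fun j _ =>
      (lintegral_indicator_pow_eq_ofReal_truncMoment (hY j)).symm

lemma edgeProb_le_edgeKernel (w : Weights) (i j : ℕ) :
    edgeProb a b τ w i j ≤ edgeKernel a b τ i j * (w.1 i * w.2 j) := by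
  unfold edgeProb edgeKernel
  split_ifs
  · exact (min_le_right _ _).trans (le_of_eq (by ring))
  · simp

lemma edgeProb_eq_edgeKernel {M : ℝ≥0} {w : Weights} {i j : ℕ} (hi : w.1 i ≤ M) (hj : w.2 j ≤ M)
    (hM : (M : ℝ) ^ 4 ≤ (i : ℝ) * j) :
    edgeProb a b τ w i j = edgeKernel a b τ i j * (w.1 i * w.2 j) := by
  unfold edgeProb edgeKernel
  split_ifs
  · rw [min_eq_right, div_eq_inv_mul, one_div]
    refine div_le_one_of_le₀ (Real.le_sqrt_of_sq_le ?_) (Real.sqrt_nonneg _)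
    calc ((w.1 i : ℝ) * w.2 j) ^ 2 ≤ ((M : ℝ) * M) ^ 2 := by gcongr
      _ = (M : ℝ) ^ 4 := by ring
      _ ≤ (i : ℝ) * j := hM
  · simp

lemma ofReal_edgeKernel_mul (i j : ℕ) (x y : ℝ≥0) :
    ENNReal.ofReal (edgeKernel a b τ i j * (x * y)) =
      ENNReal.ofReal (edgeKernel a b τ i j) * ((x : ℝ≥0∞) * y) := by
  rw [ENNReal.ofReal_mul (edgeKernel_nonneg _ _ _ _ _), ENNReal.ofReal_mul x.coe_nonneg,
    ENNReal.ofReal_coe_nnreal, ENNReal.ofReal_coe_nnreal]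

lemma ofReal_edgeProb_mul_indicator_le (T : Set ℝ≥0) (w : Weights) (i j : ℕ) :
    ENNReal.ofReal (edgeProb a b τ w i j) * (T.indicator 1 (w.1 i) * T.indicator 1 (w.2 j)) ≤
      ENNReal.ofReal (edgeKernel a b τ i j) *
        (((T.indicator id (w.1 i) : ℝ≥0) : ℝ≥0∞) * ((T.indicator id (w.2 j) : ℝ≥0) : ℝ≥0∞)) := by
  by_cases hX : w.1 i ∈ T <;> by_cases hY : w.2 j ∈ T <;>
    simp only [hX, hY, Set.indicator_of_mem, Set.indicator_of_notMem, not_false_eq_true,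
      Pi.one_apply, mul_one, mul_zero, zero_le, id]
  rw [← ofReal_edgeKernel_mul]
  exact ENNReal.ofReal_le_ofReal (edgeProb_le_edgeKernel _ _ _)

lemma law_real_cylinder_le {T : Set ℝ≥0} (hT : MeasurableSet T) (F : Finset (ℕ × ℕ))
    (hX : ∀ i, Integrable (fun x : ℝ≥0 => ((T.indicator id x : ℝ≥0) : ℝ) ^ itemDeg F i) μX)
    (hY : ∀ j, Integrable (fun x : ℝ≥0 => ((T.indicator id x : ℝ≥0) : ℝ) ^ actorDeg F j) μY) :
    (law a b τ μX μY).real (cylinder T F) ≤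
      edgeWeight (edgeKernel a b τ) (truncMoment T μX) (truncMoment T μY) F := by
  refine ENNReal.toReal_le_of_le_ofReal (edgeWeight_nonneg (edgeKernel_nonneg a b τ)
    (truncMoment_nonneg T μX) (truncMoment_nonneg T μY) F) ?_
  rw [ofReal_edgeWeight_eq_lintegral (edgeKernel_nonneg a b τ) hT F hX hY, law_cylinder hT]
  exact lintegral_mono fun w => Finset.prod_le_prod' fun e _ =>
    ofReal_edgeProb_mul_indicator_le T w e.1 e.2

lemma indicator_Iic_pow_le (M x : ℝ≥0) (k : ℕ) :
    (((Set.Iic M).indicator id x : ℝ≥0) : ℝ) ^ k ≤ (M : ℝ) ^ k := by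
  refine pow_le_pow_left₀ (by positivity) (NNReal.coe_le_coe.2 ?_) k
  exact Set.indicator_le' (fun x hx => hx) (fun _ _ => zero_le) x

lemma integrable_indicator_Iic_pow (μ : Measure ℝ≥0) [IsFiniteMeasure μ] (M : ℝ≥0) (k : ℕ) :
    Integrable (fun x : ℝ≥0 => (((Set.Iic M).indicator id x : ℝ≥0) : ℝ) ^ k) μ := by
  refine Integrable.of_bound (C := (M : ℝ) ^ k) ?_ (ae_of_all _ fun x => ?_)
  · exact ((measurable_id.indicator
      measurableSet_Iic).coe_nnreal_real.pow_const k).aestronglyMeasurable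
  · rw [Real.norm_of_nonneg (by positivity)]
    exact indicator_Iic_pow_le M x k

lemma truncMoment_Iic_le (μ : Measure ℝ≥0) [IsProbabilityMeasure μ] (M : ℝ≥0) (k : ℕ) :
    truncMoment (Set.Iic M) μ k ≤ (M : ℝ) ^ k := by
  refine (integral_mono (integrable_indicator_Iic_pow μ M k) (integrable_const _)
    fun x => indicator_Iic_pow_le M x k).trans ?_
  simp

lemma edgeWeight_le_law_real_cylinder_Iic {M : ℝ≥0} (F : Finset (ℕ × ℕ))
    (hM : ∀ e ∈ F, (M : ℝ) ^ 4 ≤ (e.1 : ℝ) * e.2) :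
    edgeWeight (edgeKernel a b τ) (truncMoment (Set.Iic M) μX) (truncMoment (Set.Iic M) μY) F ≤
      (law a b τ μX μY).real (cylinder (Set.Iic M) F) := by
  refine (ENNReal.ofReal_le_iff_le_toReal (measure_ne_top _ _)).1 ?_
  rw [ofReal_edgeWeight_eq_lintegral (edgeKernel_nonneg a b τ) measurableSet_Iic F
    (fun _ => integrable_indicator_Iic_pow _ _ _) (fun _ => integrable_indicator_Iic_pow _ _ _),
    law_cylinder measurableSet_Iic]
  refine lintegral_mono fun w => Finset.prod_le_prod' fun e he => ?_
  by_cases hX : w.1 e.1 ∈ Set.Iic M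
  · by_cases hY : w.2 e.2 ∈ Set.Iic M
    · simp only [hX, hY, Set.indicator_of_mem, Pi.one_apply, mul_one, id]
      rw [edgeProb_eq_edgeKernel hX hY (hM e he), ofReal_edgeKernel_mul]
    · simp [hY]
  · simp [hX]

lemma law_real_cylinder_Iic_le (M : ℝ≥0) (F : Finset (ℕ × ℕ)) :
    (law a b τ μX μY).real (cylinder (Set.Iic M) F) ≤
      ∏ e ∈ F, (M : ℝ) ^ 2 * edgeKernel a b τ e.1 e.2 :=
  (law_real_cylinder_le measurableSet_Iic F (fun _ => integrable_indicator_Iic_pow _ _ _)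
    fun _ => integrable_indicator_Iic_pow _ _ _).trans
    (edgeWeight_le_prod (edgeKernel_nonneg a b τ) (truncMoment_nonneg _ μX)
      (truncMoment_nonneg _ μY) F (fun _ => truncMoment_Iic_le μX M _)
      fun _ => truncMoment_Iic_le μY M _)

lemma ae_edgeKernel_ne_zero :
    ∀ᵐ ω ∂(law a b τ μX μY), ∀ e : ℕ × ℕ, ω.2 e = true → edgeKernel a b τ e.1 e.2 ≠ 0 := by
  rw [ae_all_iff]
  intro e
  by_cases h : edgeKernel a b τ e.1 e.2 = 0
  · have hp (w : Weights) : edgeProb a b τ w e.1 e.2 ≤ 0 :=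
      (edgeProb_le_edgeKernel w e.1 e.2).trans (by simp [h])
    have hnull : law a b τ μX μY (cylinder Set.univ {e}) = 0 := by
      rw [law_cylinder MeasurableSet.univ]
      simp [ENNReal.ofReal_eq_zero.2 (hp _)]
    filter_upwards [measure_eq_zero_iff_ae_notMem.1 hnull] with ω hω he
    exact (hω (by simpa [cylinder] using he)).elim
  · exact ae_of_all _ fun _ _ => h

end EdgeConfigurations

/-- The kernel `𝟙{a j ≤ i ≤ b j} / √(i j)`, that is, `edgeKernel` for `τ(t) = t`. -/
abbrev kern (a b : ℝ) : ℕ → ℕ → ℝ := edgeKernel a b fun t : ℕ => (t : ℝ)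

/-- A bound for all row sums and all column sums of the kernel. -/
def kernBound (a b : ℝ) : ℝ := max ((√a)⁻¹ * (b + 1)) (√b * (a⁻¹ + 1))

section Kernel

variable {a b : ℝ}

lemma kern_nonneg (a b : ℝ) (i j : ℕ) : 0 ≤ kern a b i j := edgeKernel_nonneg _ _ _ i j

lemma bounds_of_kern_ne_zero {i j : ℕ} (h : kern a b i j ≠ 0) :
    a * j ≤ i ∧ (i : ℝ) ≤ b * j ∧ 0 < i ∧ 0 < j := by
  unfold kern edgeKernel at h
  split_ifs at h with hij
  · refine ⟨hij.1, hij.2, Nat.pos_of_ne_zero ?_, Nat.pos_of_ne_zero ?_⟩ <;> rintro rfl <;>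
      simp at h
  · exact absurd rfl h

-- Items and actors play dual roles: `a j ≤ i ≤ b j` means `b⁻¹ i ≤ j ≤ a⁻¹ i`.
lemma kern_inv_swap (ha : 0 < a) (hb : 0 < b) (i j : ℕ) :
    kern b⁻¹ a⁻¹ j i = kern a b i j := by
  simp only [kern, edgeKernel, inv_mul_le_iff₀ hb, le_inv_mul_iff₀ ha, and_comm, mul_comm]

lemma kern_le_div_actor (ha : 0 < a) (i j : ℕ) : kern a b i j ≤ (√a)⁻¹ / j := by
  by_cases h : kern a b i j = 0
  · rw [h]
    positivity
  obtain ⟨hlo, hhi, -, hpos⟩ := bounds_of_kern_ne_zero h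
  have : (0 : ℝ) < j := by exact_mod_cast hpos
  rw [kern, edgeKernel, if_pos ⟨hlo, hhi⟩, inv_eq_one_div, div_div]
  refine one_div_le_one_div_of_le (by positivity) (Real.le_sqrt_of_sq_le ?_)
  rw [mul_pow, Real.sq_sqrt ha.le, sq, ← mul_assoc]
  gcongr

lemma kern_le_div_item (ha : 0 < a) (hb : 0 < b) (i j : ℕ) : kern a b i j ≤ √b / i := by
  simpa [kern_inv_swap ha hb] using kern_le_div_actor (b := a⁻¹) (inv_pos.2 hb) j i

lemma sum_kern_item_le (ha : 0 < a) (hb : 0 ≤ b) (j : ℕ) (R : Finset ℕ) :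
    ∑ i ∈ R, kern a b i j ≤ (√a)⁻¹ * (b + 1) := by
  rcases Nat.eq_zero_or_pos j with rfl | hj
  · have hzero (i : ℕ) : kern a b i 0 = 0 := by simp [kern, edgeKernel]
    simp only [hzero, Finset.sum_const_zero]
    positivity
  have hj' : (1 : ℝ) ≤ j := by exact_mod_cast hj
  have hsupp : {i ∈ R | kern a b i j ≠ 0} ⊆ Finset.range (⌊b * j⌋₊ + 1) := fun _ hi =>
    Finset.mem_range.2 (Nat.lt_succ_of_le (Nat.le_floor
      (bounds_of_kern_ne_zero (Finset.mem_filter.1 hi).2).2.1))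
  calc ∑ i ∈ R, kern a b i j = ∑ i ∈ R with kern a b i j ≠ 0, kern a b i j :=
        (Finset.sum_filter_ne_zero _).symm
    _ ≤ ∑ i ∈ Finset.range (⌊b * j⌋₊ + 1), kern a b i j :=
        Finset.sum_le_sum_of_subset_of_nonneg hsupp fun _ _ _ => kern_nonneg _ _ _ _
    _ ≤ ∑ _ ∈ Finset.range (⌊b * j⌋₊ + 1), (√a)⁻¹ / j :=
        Finset.sum_le_sum fun i _ => kern_le_div_actor ha i j
    _ = (⌊b * j⌋₊ + 1) * ((√a)⁻¹ / j) := by simp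
    _ ≤ (b * j + j) * ((√a)⁻¹ / j) := by
        gcongr
        exact Nat.floor_le (by positivity)
    _ = (√a)⁻¹ * (b + 1) := by field_simp

lemma sum_kern_item_le_kernBound (ha : 0 < a) (hb : 0 ≤ b) (j : ℕ) (R : Finset ℕ) :
    ∑ i ∈ R, kern a b i j ≤ kernBound a b :=
  (sum_kern_item_le ha hb j R).trans (le_max_left _ _)

lemma sum_kern_actor_le_kernBound (ha : 0 < a) (hb : 0 < b) (i : ℕ) (R : Finset ℕ) :
    ∑ u ∈ R, kern a b i u ≤ kernBound a b := by
  have h := sum_kern_item_le (inv_pos.2 hb) (inv_pos.2 ha).le i R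
  rw [Real.sqrt_inv, inv_inv] at h
  simp only [kern_inv_swap ha hb] at h
  exact h.trans (le_max_right _ _)

end Kernel

section KernelSums

lemma two_mul_sqrt_sub_sqrt_le_sum_inv_sqrt {p q : ℕ} (hp : 0 < p) (hpq : p ≤ q) :
    2 * (√(q : ℝ) - √(p : ℝ)) ≤ ∑ u ∈ Finset.Ico p q, 1 / √(u : ℝ) := by
  induction q, hpq using Nat.le_induction with
  | base => simp
  | succ q hq ih =>
    rw [Finset.sum_Ico_succ_top hq]
    have hpos : (0 : ℝ) < √(q : ℝ) := Real.sqrt_pos.2 (by exact_mod_cast hp.trans_le hq)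
    have hsq : √((q + 1 : ℕ) : ℝ) ^ 2 = √(q : ℝ) ^ 2 + 1 := by
      rw [Real.sq_sqrt (by positivity), Real.sq_sqrt (by positivity), Nat.cast_succ]
    have hstep : 2 * (√((q + 1 : ℕ) : ℝ) - √(q : ℝ)) ≤ 1 / √(q : ℝ) := by
      rw [le_div_iff₀ hpos]
      nlinarith [sq_nonneg (√((q + 1 : ℕ) : ℝ) - √(q : ℝ))]
    linarith

lemma sum_inv_sqrt_le_two_mul_sqrt_sub_sqrt {p q : ℕ} (hp : 0 < p) (hpq : p ≤ q) :
    ∑ u ∈ Finset.Ico p q, 1 / √(u : ℝ) ≤ 2 * (√((q : ℝ) - 1) - √((p : ℝ) - 1)) := by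
  induction q, hpq using Nat.le_induction with
  | base => simp
  | succ q hq ih =>
    rw [Finset.sum_Ico_succ_top hq]
    have hq1 : (1 : ℝ) ≤ q := by exact_mod_cast hp.trans_le hq
    have hpos : (0 : ℝ) < √(q : ℝ) := Real.sqrt_pos.2 (by linarith)
    have hsq : √(q : ℝ) ^ 2 = √((q : ℝ) - 1) ^ 2 + 1 := by
      rw [Real.sq_sqrt (by linarith), Real.sq_sqrt (by linarith), sub_add_cancel]
    have hstep : 1 / √(q : ℝ) ≤ 2 * (√(q : ℝ) - √((q : ℝ) - 1)) := by
      rw [div_le_iff₀ hpos]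
      nlinarith [sq_nonneg (√(q : ℝ) - √((q : ℝ) - 1))]
    rw [Nat.cast_succ, add_sub_cancel_right]
    linarith

variable {a b : ℝ}

lemma sum_Icc_inv_sqrt_mul (p q n : ℕ) :
    ∑ u ∈ Finset.Icc p q, 1 / √((u : ℝ) * n) =
      (∑ u ∈ Finset.Ico p (q + 1), 1 / √(u : ℝ)) / √(n : ℝ) := by
  rw [Finset.sum_div]
  refine Finset.sum_congr (by ext; simp) fun u _ => ?_
  rw [Real.sqrt_mul (by positivity), div_div]

lemma ceil_le_floor_add_one (hab : a < b) (n : ℕ) : ⌈a * n⌉₊ ≤ ⌊b * n⌋₊ + 1 := by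
  refine Nat.ceil_le.2 ?_
  push_cast
  exact (by gcongr : a * n ≤ b * n).trans (Nat.lt_floor_add_one _).le

lemma le_sum_Icc_inv_sqrt_mul (ha : 0 < a) (hab : a < b) {n : ℕ} (hn : 0 < n) :
    2 * (√b - √(a + 1 / (n : ℝ))) ≤ ∑ u ∈ Finset.Icc ⌈a * n⌉₊ ⌊b * n⌋₊, 1 / √((u : ℝ) * n) := by
  have hn' : (0 : ℝ) < n := by exact_mod_cast hn
  have hfloor : √(b * n) ≤ √((⌊b * n⌋₊ + 1 : ℕ) : ℝ) :=
    Real.sqrt_le_sqrt (by exact_mod_cast (Nat.lt_floor_add_one _).le)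
  have hceil : √(⌈a * n⌉₊ : ℝ) ≤ √((a + 1 / n) * n) :=
    Real.sqrt_le_sqrt ((Nat.ceil_lt_add_one (by positivity)).le.trans
      (le_of_eq (by field_simp)))
  rw [sum_Icc_inv_sqrt_mul, le_div_iff₀ (Real.sqrt_pos.2 hn'), mul_assoc, sub_mul,
    ← Real.sqrt_mul (ha.trans hab).le, ← Real.sqrt_mul (by positivity)]
  linarith [two_mul_sqrt_sub_sqrt_le_sum_inv_sqrt (Nat.ceil_pos.2 (by positivity : 0 < a * n))
    (ceil_le_floor_add_one hab n)]

lemma sum_Icc_inv_sqrt_mul_le (ha : 0 < a) (hab : a < b) {n : ℕ} (hn : 0 < n) :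
    ∑ u ∈ Finset.Icc ⌈a * n⌉₊ ⌊b * n⌋₊, 1 / √((u : ℝ) * n) ≤ 2 * (√b - √(a - 1 / (n : ℝ))) := by
  have hb := ha.trans hab
  have hn' : (0 : ℝ) < n := by exact_mod_cast hn
  have hfloor : √(((⌊b * n⌋₊ + 1 : ℕ) : ℝ) - 1) ≤ √(b * n) := by
    rw [Nat.cast_succ, add_sub_cancel_right]
    exact Real.sqrt_le_sqrt (Nat.floor_le (by positivity))
  have hceil : √((a - 1 / n) * n) ≤ √((⌈a * n⌉₊ : ℝ) - 1) := by
    refine Real.sqrt_le_sqrt ?_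
    rw [sub_mul, one_div, inv_mul_cancel₀ hn'.ne']
    linarith [Nat.le_ceil (a * n)]
  rw [sum_Icc_inv_sqrt_mul, div_le_iff₀ (Real.sqrt_pos.2 hn'), mul_assoc, sub_mul,
    ← Real.sqrt_mul hb.le, ← Real.sqrt_mul' _ hn'.le]
  linarith [sum_inv_sqrt_le_two_mul_sqrt_sub_sqrt
    (Nat.ceil_pos.2 (by positivity : 0 < a * n)) (ceil_le_floor_add_one hab n)]

lemma tendsto_sum_Icc_inv_sqrt_mul (ha : 0 < a) (hab : a < b) :
    Tendsto (fun n : ℕ => ∑ u ∈ Finset.Icc ⌈a * n⌉₊ ⌊b * n⌋₊, 1 / √((u : ℝ) * n)) atTop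
      (𝓝 (2 * (√b - √a))) := by
  have hinv := tendsto_one_div_atTop_nhds_zero_nat (𝕜 := ℝ)
  have hlo : Tendsto (fun n : ℕ => 2 * (√b - √(a + 1 / (n : ℝ)))) atTop (𝓝 (2 * (√b - √a))) := by
    simpa using ((hinv.const_add a).sqrt.const_sub (√b)).const_mul 2
  have hhi : Tendsto (fun n : ℕ => 2 * (√b - √(a - 1 / (n : ℝ)))) atTop (𝓝 (2 * (√b - √a))) := by
    simpa using ((hinv.const_sub a).sqrt.const_sub (√b)).const_mul 2
  refine tendsto_of_tendsto_of_tendsto_of_le_of_le' hlo hhi ?_ ?_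
  · filter_upwards [eventually_gt_atTop 0] with n hn using le_sum_Icc_inv_sqrt_mul ha hab hn
  · filter_upwards [eventually_gt_atTop 0] with n hn using sum_Icc_inv_sqrt_mul_le ha hab hn

lemma sum_kern_item_eq_sum_Icc (hb : 0 ≤ b) {j : ℕ} {S : Finset ℕ}
    (hS : ∀ i, kern a b i j ≠ 0 → i ∈ S) :
    ∑ i ∈ S, kern a b i j = ∑ i ∈ Finset.Icc ⌈a * j⌉₊ ⌊b * j⌋₊, 1 / √((i : ℝ) * j) := by
  have hmem (i : ℕ) : i ∈ Finset.Icc ⌈a * j⌉₊ ⌊b * j⌋₊ ↔ a * j ≤ i ∧ (i : ℝ) ≤ b * j := by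
    rw [Finset.mem_Icc, Nat.ceil_le, Nat.le_floor_iff (by positivity)]
  calc ∑ i ∈ S, kern a b i j
      = ∑ i ∈ Finset.Icc ⌈a * j⌉₊ ⌊b * j⌋₊, kern a b i j := by
        refine Finset.sum_congr_of_eq_on_inter (fun i _ hi => ?_) (fun i _ hi => ?_)
          fun _ _ _ => rfl
        · exact if_neg fun h => hi ((hmem i).2 h)
        · exact not_not.1 (mt (hS i) hi)
    _ = _ := Finset.sum_congr rfl fun i hi => if_pos ((hmem i).1 hi)

variable {Y : Type*} {l : Filter Y}

lemma tendsto_sum_kern_item (ha : 0 < a) (hab : a < b) {j : Y → ℕ} (hj : Tendsto j l atTop)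
    {S A : Y → Finset ℕ} {m : ℕ} (hA : ∀ y, (A y).card ≤ m)
    (hS : ∀ᶠ y in l, ∀ i, kern a b i (j y) ≠ 0 → i ∈ S y) :
    Tendsto (fun y => ∑ i ∈ S y \ A y, kern a b i (j y)) l (𝓝 (2 * (√b - √a))) := by
  have hfull : Tendsto (fun y => ∑ i ∈ S y, kern a b i (j y)) l (𝓝 (2 * (√b - √a))) := by
    refine ((tendsto_sum_Icc_inv_sqrt_mul ha hab).comp hj).congr' ?_
    filter_upwards [hS] with y hy using (sum_kern_item_eq_sum_Icc (ha.trans hab).le hy).symm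
  have hexc : Tendsto (fun y => ∑ i ∈ S y ∩ A y, kern a b i (j y)) l (𝓝 0) := by
    have hdiv : Tendsto (fun y => (m : ℝ) * ((√a)⁻¹ / j y)) l (𝓝 0) := by
      simpa using ((tendsto_natCast_atTop_atTop.comp hj).const_div_atTop (√a)⁻¹).const_mul (m : ℝ)
    refine squeeze_zero (fun y => Finset.sum_nonneg fun i _ => kern_nonneg _ _ _ _)
      (fun y => ?_) hdiv
    calc ∑ i ∈ S y ∩ A y, kern a b i (j y) ≤ (S y ∩ A y).card • ((√a)⁻¹ / (j y : ℝ)) :=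
          Finset.sum_le_card_nsmul _ _ _ fun i _ => kern_le_div_actor ha i (j y)
      _ ≤ m * ((√a)⁻¹ / j y) := by
          rw [nsmul_eq_mul]
          gcongr
          exact (Finset.card_le_card Finset.inter_subset_right).trans (hA y)
  have hsub := hfull.sub hexc
  rw [sub_zero] at hsub
  exact hsub.congr fun y => by
    rw [← Finset.sum_inter_add_sum_sdiff (S y) (A y), add_sub_cancel_left]

lemma tendsto_sum_kern_actor (ha : 0 < a) (hab : a < b) {i : Y → ℕ} (hi : Tendsto i l atTop)
    {S A : Y → Finset ℕ} {m : ℕ} (hA : ∀ y, (A y).card ≤ m)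
    (hS : ∀ᶠ y in l, ∀ u, kern a b (i y) u ≠ 0 → u ∈ S y) :
    Tendsto (fun y => ∑ u ∈ S y \ A y, kern a b (i y) u) l (𝓝 (gam a b)) := by
  have hb := ha.trans hab
  have h := tendsto_sum_kern_item (inv_pos.2 hb) (inv_strictAnti₀ ha hab) hi (S := S) hA
    (by simpa only [kern_inv_swap ha hb] using hS)
  simpa only [kern_inv_swap ha hb, Real.sqrt_inv, gam] using h

end KernelSums

section WeightedSums

variable {X : Type*}

/-- The filter of pairs `(x, i)` with `x` along `l` and `i ∈ S x` of nonzero weight `w x i`. Limits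
along it are limits in `x` which are uniform in `i`, whence they pass to weighted sums over `i`. -/
def weightedFilter (l : Filter X) (S : X → Finset ℕ) (w : X → ℕ → ℝ) : Filter (X × ℕ) :=
  comap Prod.fst l ⊓ 𝓟 {z | z.2 ∈ S z.1 ∧ w z.1 z.2 ≠ 0}

lemma tendsto_fst_weightedFilter (l : Filter X) (S : X → Finset ℕ) (w : X → ℕ → ℝ) :
    Tendsto Prod.fst (weightedFilter l S w) l := tendsto_comap.mono_left inf_le_left

lemma eventually_weightedFilter (l : Filter X) (S : X → Finset ℕ) (w : X → ℕ → ℝ) :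
    ∀ᶠ z in weightedFilter l S w, w z.1 z.2 ≠ 0 :=
  (eventually_principal.2 fun _ h => h.2).filter_mono inf_le_right

lemma eventually_forall_of_weightedFilter {l : Filter X} {S : X → Finset ℕ} {w : X → ℕ → ℝ}
    {q : X × ℕ → Prop} (h : ∀ᶠ z in weightedFilter l S w, q z) :
    ∀ᶠ x in l, ∀ i ∈ S x, w x i ≠ 0 → q (x, i) := by
  rw [weightedFilter, eventually_inf_principal, eventually_comap] at h
  exact h.mono fun x hx i hi h0 => hx (x, i) rfl ⟨hi, h0⟩

lemma tendsto_sum_weight_mul_zero {l : Filter X} {S : X → Finset ℕ} {w : X → ℕ → ℝ}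
    {h : X × ℕ → ℝ} {φ : ℝ} (hw : ∀ x i, 0 ≤ w x i)
    (hφ : Tendsto (fun x => ∑ i ∈ S x, w x i) l (𝓝 φ))
    (hh : Tendsto h (weightedFilter l S w) (𝓝 0)) :
    Tendsto (fun x => ∑ i ∈ S x, w x i * h (x, i)) l (𝓝 0) := by
  rw [Metric.tendsto_nhds]
  intro ε hε
  have hφ' : ∀ᶠ x in l, ∑ i ∈ S x, w x i < |φ| + 1 :=
    hφ.eventually_lt_const (by linarith [le_abs_self φ])
  have hsmall := Metric.tendsto_nhds.1 hh (ε / (2 * (|φ| + 1))) (by positivity)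
  filter_upwards [eventually_forall_of_weightedFilter hsmall, hφ'] with x hx hxφ
  rw [dist_zero_right, Real.norm_eq_abs]
  calc |∑ i ∈ S x, w x i * h (x, i)|
      ≤ ∑ i ∈ S x, |w x i * h (x, i)| := Finset.abs_sum_le_sum_abs _ _
    _ ≤ ∑ i ∈ S x, w x i * (ε / (2 * (|φ| + 1))) := by
        refine Finset.sum_le_sum fun i hi => ?_
        rw [abs_mul, abs_of_nonneg (hw x i)]
        rcases eq_or_ne (w x i) 0 with h0 | h0
        · simp [h0]
        · exact mul_le_mul_of_nonneg_left (by simpa using (hx i hi h0).le) (hw x i)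
    _ = (∑ i ∈ S x, w x i) * (ε / (2 * (|φ| + 1))) := by rw [Finset.sum_mul]
    _ ≤ (|φ| + 1) * (ε / (2 * (|φ| + 1))) := by gcongr
    _ = ε / 2 := by field_simp
    _ < ε := half_lt_self hε

lemma tendsto_sum_weight_mul {l : Filter X} {S : X → Finset ℕ} {w : X → ℕ → ℝ} {h : X × ℕ → ℝ}
    {φ c : ℝ} (hw : ∀ x i, 0 ≤ w x i) (hφ : Tendsto (fun x => ∑ i ∈ S x, w x i) l (𝓝 φ))
    (hh : Tendsto h (weightedFilter l S w) (𝓝 c)) :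
    Tendsto (fun x => ∑ i ∈ S x, w x i * h (x, i)) l (𝓝 (φ * c)) := by
  have hzero := tendsto_sum_weight_mul_zero hw hφ (h := fun z => h z - c)
    (by simpa using hh.sub_const c)
  have hsum := hzero.add (hφ.mul_const c)
  rw [zero_add] at hsum
  refine hsum.congr fun x => ?_
  rw [Finset.sum_mul, ← Finset.sum_add_distrib]
  exact Finset.sum_congr rfl fun i _ => by ring

end WeightedSums

/-- The edges of the path from actor `s` to actor `t` through the item `i`. -/
def path (i s t : ℕ) : Finset (ℕ × ℕ) := {(i, s), (i, t)}

section EdgeWeights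

variable {κ : ℕ → ℕ → ℝ} {mX mY : ℕ → ℝ} {i j k s t u v α β : ℕ}

attribute [local simp] edgeWeight path itemDeg actorDeg Finset.filter_insert
  Finset.filter_singleton Finset.insert_union Finset.image_insert Finset.card_insert_of_notMem
  Finset.prod_insert

lemma edgeWeight_path (hst : s ≠ t) :
    edgeWeight κ mX mY (path i s t) = κ i s * κ i t * (mX 2 * mY 1 ^ 2) := by
  simp [hst, hst.symm]
  ring

lemma edgeWeight_path_union_path_same (hst : s ≠ t) (hus : u ≠ s) (hut : u ≠ t) :
    edgeWeight κ mX mY (path i s t ∪ path i s u) =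
      κ i s * κ i t * (mX 3 * mY 1 ^ 3 * κ i u) := by
  simp [hst, hus, hut, hst.symm, hus.symm, hut.symm]
  ring

lemma edgeWeight_path_union_path_ne (hji : j ≠ i) (hst : s ≠ t) (hus : u ≠ s) (hut : u ≠ t) :
    edgeWeight κ mX mY (path i s t ∪ path j s u) =
      κ i s * κ i t * κ j s * (mX 2 ^ 2 * mY 1 ^ 2 * mY 2 * κ j u) := by
  simp [hji, hst, hus, hut, hji.symm, hst.symm, hus.symm, hut.symm]
  ring

lemma edgeWeight_three_paths_same (hα : α = s ∨ α = t) (hβ : β = s ∨ β = t) (hst : s ≠ t)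
    (hus : u ≠ s) (hut : u ≠ t) (hvs : v ≠ s) (hvt : v ≠ t) (hvu : v ≠ u) :
    edgeWeight κ mX mY (path i s t ∪ (path i α u ∪ path i β v)) =
      κ i s * κ i t * (mX 4 * mY 1 ^ 4 * (κ i u * κ i v)) := by
  rcases hα with rfl | rfl <;> rcases hβ with rfl | rfl <;>
  · simp [hst, hus, hut, hvs, hvt, hvu, hst.symm, hus.symm, hut.symm, hvs.symm, hvt.symm, hvu.symm]
    ring

lemma edgeWeight_three_paths_same_same_ne (hα : α = s ∨ α = t) (hβ : β = s ∨ β = t) (hki : k ≠ i)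
    (hst : s ≠ t) (hus : u ≠ s) (hut : u ≠ t) (hvs : v ≠ s) (hvt : v ≠ t) (hvu : v ≠ u) :
    edgeWeight κ mX mY (path i s t ∪ (path i α u ∪ path k β v)) =
      κ i s * κ i t * κ k β * (mX 2 * mX 3 * mY 1 ^ 3 * mY 2 * (κ i u * κ k v)) := by
  rcases hα with rfl | rfl <;> rcases hβ with rfl | rfl <;>
  · simp [hki, hst, hus, hut, hvs, hvt, hvu, hki.symm, hst.symm, hus.symm, hut.symm, hvs.symm,
      hvt.symm, hvu.symm]
    ring

lemma edgeWeight_three_paths_ne_same (hji : j ≠ i) (hst : s ≠ t) (hus : u ≠ s) (hut : u ≠ t)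
    (hvs : v ≠ s) (hvt : v ≠ t) (hvu : v ≠ u) :
    edgeWeight κ mX mY (path i s t ∪ (path j s u ∪ path j s v)) =
      κ i s * κ i t * κ j s * (mX 2 * mX 3 * mY 1 ^ 3 * mY 2 * (κ j u * κ j v)) := by
  simp [hji, hst, hus, hut, hvs, hvt, hvu, hji.symm, hst.symm, hus.symm, hut.symm, hvs.symm,
    hvt.symm, hvu.symm]
  ring

lemma edgeWeight_three_paths_ne_ne (hji : j ≠ i) (hki : k ≠ i) (hkj : k ≠ j) (hst : s ≠ t)
    (hus : u ≠ s) (hut : u ≠ t) (hvs : v ≠ s) (hvt : v ≠ t) (hvu : v ≠ u) :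
    edgeWeight κ mX mY (path i s t ∪ (path j s u ∪ path k s v)) =
      κ i s * κ i t * κ j s * κ k s * (mX 2 ^ 3 * mY 1 ^ 3 * mY 3 * (κ j u * κ k v)) := by
  simp [hji, hki, hkj, hst, hus, hut, hvs, hvt, hvu, hji.symm, hki.symm, hkj.symm, hst.symm,
    hus.symm, hut.symm, hvs.symm, hvt.symm, hvu.symm]
  ring

lemma edgeWeight_three_paths_ends_ne_same (hji : j ≠ i) (hst : s ≠ t) (hus : u ≠ s) (hut : u ≠ t)
    (hvs : v ≠ s) (hvt : v ≠ t) (hvu : v ≠ u) :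
    edgeWeight κ mX mY (path i s t ∪ (path j s u ∪ path j t v)) =
      κ i s * κ i t * κ j s * (mX 2 * mX 4 * mY 1 ^ 2 * mY 2 ^ 2 * κ j t * (κ j u * κ j v)) := by
  simp [hji, hst, hus, hut, hvs, hvt, hvu, hji.symm, hst.symm, hus.symm, hut.symm, hvs.symm,
    hvt.symm, hvu.symm]
  ring

lemma edgeWeight_three_paths_ends_ne_ne (hji : j ≠ i) (hki : k ≠ i) (hkj : k ≠ j) (hst : s ≠ t)
    (hus : u ≠ s) (hut : u ≠ t) (hvs : v ≠ s) (hvt : v ≠ t) (hvu : v ≠ u) :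
    edgeWeight κ mX mY (path i s t ∪ (path j s u ∪ path k t v)) =
      κ i s * κ i t * κ j s * κ k t * (mX 2 ^ 3 * mY 1 ^ 2 * mY 2 ^ 2 * (κ j u * κ k v)) := by
  simp [hji, hki, hkj, hst, hus, hut, hvs, hvt, hvu, hji.symm, hki.symm, hkj.symm, hst.symm,
    hus.symm, hut.symm, hvs.symm, hvt.symm, hvu.symm]
  ring

end EdgeWeights

/-- A range of indices containing all items of the actors `p.1`, `p.2` and all actors of these
items. -/
def reach (a b : ℝ) (p : ℕ × ℕ) : Finset ℕ := Finset.range (⌈(b + b / a) * (p.1 + p.2)⌉₊ + 1)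

/-- The actors within reach of `p.1`, `p.2` and different from these two. -/
def others (a b : ℝ) (p : ℕ × ℕ) : Finset ℕ := reach a b p \ {p.1, p.2}

/-- The normalization `∑ 1 / (i √(s t))` over the common items `i` of two actors `s`, `t`. -/
def pairNorm (a b : ℝ) (p : ℕ × ℕ) : ℝ := ∑ i ∈ reach a b p, kern a b i p.1 * kern a b i p.2

/-- Filters of pairs of distinct actors with indices tending to infinity and having a common
item. -/
structure IsPairFilter (a b : ℝ) (l : Filter (ℕ × ℕ)) : Prop where
  fst : Tendsto Prod.fst l atTop
  snd : Tendsto Prod.snd l atTop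
  ne : ∀ᶠ p in l, p.1 ≠ p.2
  pos : ∀ᶠ p in l, 0 < pairNorm a b p

section Reach

variable {a b : ℝ}

lemma reach_swap (a b : ℝ) (p : ℕ × ℕ) : reach a b p.swap = reach a b p := by
  simp [reach, add_comm]

lemma others_swap (a b : ℝ) (p : ℕ × ℕ) : others a b p.swap = others a b p := by
  simp [others, reach_swap, Finset.pair_comm]

lemma mem_others {p : ℕ × ℕ} {u : ℕ} :
    u ∈ others a b p ↔ u ∈ reach a b p ∧ u ≠ p.1 ∧ u ≠ p.2 := by
  simp [others]

lemma pairNorm_swap (a b : ℝ) (p : ℕ × ℕ) : pairNorm a b p.swap = pairNorm a b p := by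
  simp [pairNorm, reach_swap, mul_comm]

lemma pairNorm_nonneg (a b : ℝ) (p : ℕ × ℕ) : 0 ≤ pairNorm a b p :=
  Finset.sum_nonneg fun _ _ => mul_nonneg (kern_nonneg _ _ _ _) (kern_nonneg _ _ _ _)

lemma IsPairFilter.swap {l : Filter (ℕ × ℕ)} (h : IsPairFilter a b l) :
    IsPairFilter a b (l.map Prod.swap) where
  fst := tendsto_map'_iff.2 h.snd
  snd := tendsto_map'_iff.2 h.fst
  ne := eventually_map.2 (h.ne.mono fun _ hp => hp.symm)
  pos := eventually_map.2 (h.pos.mono fun p hp => by rwa [pairNorm_swap])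

lemma mem_reach_of_le {p : ℕ × ℕ} {n : ℕ} (h : (n : ℝ) ≤ (b + b / a) * (p.1 + p.2)) :
    n ∈ reach a b p :=
  Finset.mem_range.2 (Nat.lt_succ_of_le (Nat.cast_le.1 (h.trans (Nat.le_ceil _))))

lemma cast_le_add_of_eq_or_eq {p : ℕ × ℕ} {s : ℕ} (hs : s = p.1 ∨ s = p.2) :
    (s : ℝ) ≤ p.1 + p.2 := by
  rcases hs with rfl | rfl <;> simp

lemma item_mem_reach (ha : 0 < a) (hab : a < b) {p : ℕ × ℕ} {s i : ℕ} (hs : s = p.1 ∨ s = p.2)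
    (hi : kern a b i s ≠ 0) : i ∈ reach a b p := by
  have hb := ha.trans hab
  refine mem_reach_of_le ((bounds_of_kern_ne_zero hi).2.1.trans ?_)
  gcongr
  · exact le_add_of_nonneg_right (by positivity)
  · exact cast_le_add_of_eq_or_eq hs

lemma actor_mem_reach (ha : 0 < a) (hab : a < b) {p : ℕ × ℕ} {s i u : ℕ}
    (hs : s = p.1 ∨ s = p.2) (hi : kern a b i s ≠ 0) (hu : kern a b i u ≠ 0) :
    u ∈ reach a b p := by
  have hb := ha.trans hab
  refine mem_reach_of_le ?_
  calc (u : ℝ) ≤ i / a := (le_div_iff₀' ha).2 (bounds_of_kern_ne_zero hu).1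
    _ ≤ b * s / a := by
        gcongr
        exact (bounds_of_kern_ne_zero hi).2.1
    _ = b / a * s := by ring
    _ ≤ (b + b / a) * (p.1 + p.2) := by
        gcongr
        · exact le_add_of_nonneg_left hb.le
        · exact cast_le_add_of_eq_or_eq hs

end Reach

section SumsOverActors

variable {a b : ℝ} {Y : Type*} {l : Filter Y} {p : Y → ℕ × ℕ} {i j : Y → ℕ}

/-- Items `i y` tending to infinity all of whose actors are within reach of `p y`. -/
structure IsReachedItem (a b : ℝ) (l : Filter Y) (p : Y → ℕ × ℕ) (i : Y → ℕ) : Prop where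
  tendsto : Tendsto i l atTop
  mem_reach : ∀ᶠ y in l, ∀ u, kern a b (i y) u ≠ 0 → u ∈ reach a b (p y)

lemma IsReachedItem.comp {Z : Type*} {m : Filter Z} {f : Z → Y} (hi : IsReachedItem a b l p i)
    (hf : Tendsto f m l) : IsReachedItem a b m (p ∘ f) (i ∘ f) :=
  ⟨hi.tendsto.comp hf, hf.eventually hi.mem_reach⟩

lemma isReachedItem_of_kern_ne_zero (ha : 0 < a) (hab : a < b) {s : Y → ℕ}
    (hs : ∀ y, s y = (p y).1 ∨ s y = (p y).2) (ht : Tendsto s l atTop)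
    (hi : ∀ᶠ y in l, kern a b (i y) (s y) ≠ 0) : IsReachedItem a b l p i where
  tendsto := by
    refine tendsto_natCast_atTop_iff (R := ℝ) |>.1 (tendsto_atTop_mono' _ ?_
      ((tendsto_natCast_atTop_atTop.comp ht).const_mul_atTop ha))
    filter_upwards [hi] with y hy using (bounds_of_kern_ne_zero hy).1
  mem_reach := by
    filter_upwards [hi] with y hy u hu using actor_mem_reach ha hab (hs y) hy hu

/-- The sum of the kernel over the actors other than `p.1` and `p.2`. -/
def actorSum (a b : ℝ) (p : ℕ × ℕ) (i : ℕ) : ℝ := ∑ u ∈ others a b p, kern a b i u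

/-- The sum of products of the kernel over pairs of distinct actors other than `p.1`, `p.2`. -/
def actorPairSum (a b : ℝ) (p : ℕ × ℕ) (i j : ℕ) : ℝ :=
  ∑ r ∈ (others a b p).offDiag, kern a b i r.1 * kern a b j r.2

lemma sum_offDiag_eq_sum_sdiff (U : Finset ℕ) (f : ℕ × ℕ → ℝ) :
    ∑ r ∈ U.offDiag, f r = ∑ u ∈ U, ∑ v ∈ U \ {u}, f (u, v) := by
  rw [Finset.sum_sigma']
  refine Finset.sum_nbij' (fun r => ⟨r.1, r.2⟩) (fun r => (r.1, r.2)) ?_ ?_ ?_ ?_ ?_ <;>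
    simp +contextual [eq_comm]

lemma tendsto_actorSum (ha : 0 < a) (hab : a < b) (hi : IsReachedItem a b l p i) :
    Tendsto (fun y => actorSum a b (p y) (i y)) l (𝓝 (gam a b)) :=
  tendsto_sum_kern_actor ha hab hi.tendsto (fun _ => Finset.card_le_two) hi.mem_reach

lemma tendsto_actorPairSum (ha : 0 < a) (hab : a < b) (hi : IsReachedItem a b l p i)
    (hj : IsReachedItem a b l p j) :
    Tendsto (fun y => actorPairSum a b (p y) (i y) (j y)) l (𝓝 (gam a b ^ 2)) := by
  have hinner : Tendsto (fun z : Y × ℕ => ∑ v ∈ others a b (p z.1) \ {z.2}, kern a b (j z.1) v)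
      (weightedFilter l (fun y => others a b (p y)) fun y u => kern a b (i y) u)
      (𝓝 (gam a b)) := by
    have h := hj.comp (tendsto_fst_weightedFilter l (fun y => others a b (p y)) fun y u =>
      kern a b (i y) u)
    refine (tendsto_sum_kern_actor ha hab (A := fun z => {(p z.1).1, (p z.1).2, z.2}) h.tendsto
      (fun _ => Finset.card_le_three) h.mem_reach).congr fun z => ?_
    refine Finset.sum_congr ?_ fun _ _ => rfl
    ext
    simp [others, and_assoc]
  rw [sq]
  refine (tendsto_sum_weight_mul (fun y u => kern_nonneg a b (i y) u)
    (tendsto_actorSum ha hab hi) hinner).congr fun y => ?_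
  simp only [actorPairSum, sum_offDiag_eq_sum_sdiff, Finset.mul_sum]

end SumsOverActors

section SumsOverItems

variable {a b : ℝ} {l : Filter (ℕ × ℕ)} {α β : ℕ × ℕ → ℕ}

/-- The filter of pairs `(p, i)`, where `i` is a common item of the actors `p.1`, `p.2`. -/
abbrev commonFilter (a b : ℝ) (l : Filter (ℕ × ℕ)) : Filter ((ℕ × ℕ) × ℕ) :=
  weightedFilter l (reach a b) fun p i => kern a b i p.1 * kern a b i p.2 / pairNorm a b p

/-- The filter of triples `(p, i, j)`, where `i` is a common item of `p.1`, `p.2`, and `j ≠ i` is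
an item of `α p`. -/
abbrev secondFilter (a b : ℝ) (l : Filter (ℕ × ℕ)) (α : ℕ × ℕ → ℕ) :
    Filter (((ℕ × ℕ) × ℕ) × ℕ) :=
  weightedFilter (commonFilter a b l) (fun z => reach a b z.1 \ {z.2}) fun z j =>
    kern a b j (α z.1)

/-- The filter of tuples `(p, i, j, k)`, where `i` is a common item of `p.1`, `p.2`, moreover
`j ≠ i` is an item of `α p`, and `k ≠ i, j` is an item of `β p`. -/
abbrev thirdFilter (a b : ℝ) (l : Filter (ℕ × ℕ)) (α β : ℕ × ℕ → ℕ) :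
    Filter ((((ℕ × ℕ) × ℕ) × ℕ) × ℕ) :=
  weightedFilter (secondFilter a b l α) (fun z => reach a b z.1.1 \ {z.1.2, z.2}) fun z k =>
    kern a b k (β z.1.1)

lemma tendsto_sum_common (hl : IsPairFilter a b l) {f : ℕ × ℕ → ℕ → ℝ}
    {h : (ℕ × ℕ) × ℕ → ℝ} {c : ℝ} (hf : ∀ p i, p.1 ≠ p.2 → i ∈ reach a b p →
      f p i = kern a b i p.1 * kern a b i p.2 * h (p, i))
    (hh : Tendsto h (commonFilter a b l) (𝓝 c)) :
    Tendsto (fun p => (∑ i ∈ reach a b p, f p i) / pairNorm a b p) l (𝓝 c) := by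
  have hweights : Tendsto (fun p => ∑ i ∈ reach a b p,
      kern a b i p.1 * kern a b i p.2 / pairNorm a b p) l (𝓝 1) := by
    refine tendsto_const_nhds.congr' ?_
    filter_upwards [hl.pos] with p hp
    rw [← Finset.sum_div]
    exact (div_self hp.ne').symm
  have hnonneg (p : ℕ × ℕ) (i : ℕ) : 0 ≤ kern a b i p.1 * kern a b i p.2 / pairNorm a b p :=
    div_nonneg (mul_nonneg (kern_nonneg _ _ _ _) (kern_nonneg _ _ _ _)) (pairNorm_nonneg a b p)
  have hsum := tendsto_sum_weight_mul hnonneg hweights hh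
  rw [one_mul] at hsum
  refine hsum.congr' ?_
  filter_upwards [hl.ne] with p hp
  rw [Finset.sum_div]
  refine Finset.sum_congr rfl fun i hi => ?_
  rw [hf p i hp hi]
  ring

lemma IsPairFilter.tendsto_end (hl : IsPairFilter a b l)
    (hα : α = Prod.fst ∨ α = Prod.snd) : Tendsto α l atTop := by
  rcases hα with rfl | rfl
  exacts [hl.fst, hl.snd]

lemma end_eq_or_eq (hα : α = Prod.fst ∨ α = Prod.snd) (p : ℕ × ℕ) : α p = p.1 ∨ α p = p.2 := by
  rcases hα with rfl | rfl <;> simp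

lemma tendsto_sum_common_ne (ha : 0 < a) (hab : a < b) (hl : IsPairFilter a b l)
    (hα : α = Prod.fst ∨ α = Prod.snd) {f : ℕ × ℕ → ℕ → ℕ → ℝ} {h : ((ℕ × ℕ) × ℕ) × ℕ → ℝ} {c : ℝ}
    (hf : ∀ p i j, p.1 ≠ p.2 → j ≠ i →
      f p i j = kern a b i p.1 * kern a b i p.2 * kern a b j (α p) * h ((p, i), j))
    (hh : Tendsto h (secondFilter a b l α) (𝓝 c)) :
    Tendsto (fun p => (∑ i ∈ reach a b p, ∑ j ∈ reach a b p \ {i}, f p i j) / pairNorm a b p) l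
      (𝓝 (2 * (√b - √a) * c)) := by
  have hitems : Tendsto (fun z : (ℕ × ℕ) × ℕ => ∑ j ∈ reach a b z.1 \ {z.2}, kern a b j (α z.1))
      (commonFilter a b l) (𝓝 (2 * (√b - √a))) :=
    tendsto_sum_kern_item ha hab ((hl.tendsto_end hα).comp (tendsto_fst_weightedFilter _ _ _))
      (fun _ => (Finset.card_singleton _).le)
      (.of_forall fun z j => item_mem_reach ha hab (end_eq_or_eq hα z.1))
  refine tendsto_sum_common hl (fun p i hp _ => ?_)
    (tendsto_sum_weight_mul (fun z j => kern_nonneg a b j _) hitems hh)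
  simp only [Finset.mul_sum, ← mul_assoc]
  exact Finset.sum_congr rfl fun j hj => hf p i j hp (by simpa using (Finset.mem_sdiff.1 hj).2)

lemma tendsto_sum_common_ne_ne (ha : 0 < a) (hab : a < b) (hl : IsPairFilter a b l)
    (hα : α = Prod.fst ∨ α = Prod.snd) (hβ : β = Prod.fst ∨ β = Prod.snd)
    {f : ℕ × ℕ → ℕ → ℕ → ℕ → ℝ} {h : (((ℕ × ℕ) × ℕ) × ℕ) × ℕ → ℝ} {c : ℝ}
    (hf : ∀ p i j k, p.1 ≠ p.2 → j ≠ i → k ≠ i → k ≠ j →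
      f p i j k = kern a b i p.1 * kern a b i p.2 * kern a b j (α p) *
        kern a b k (β p) * h (((p, i), j), k))
    (hh : Tendsto h (thirdFilter a b l α β) (𝓝 c)) :
    Tendsto (fun p => (∑ i ∈ reach a b p, ∑ j ∈ reach a b p \ {i},
      ∑ k ∈ reach a b p \ {i, j}, f p i j k) / pairNorm a b p) l
      (𝓝 (2 * (√b - √a) * (2 * (√b - √a) * c))) := by
  have hitems : Tendsto (fun z : ((ℕ × ℕ) × ℕ) × ℕ =>
      ∑ k ∈ reach a b z.1.1 \ {z.1.2, z.2}, kern a b k (β z.1.1))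
      (secondFilter a b l α) (𝓝 (2 * (√b - √a))) :=
    tendsto_sum_kern_item ha hab ((hl.tendsto_end hβ).comp
      ((tendsto_fst_weightedFilter _ _ _).comp (tendsto_fst_weightedFilter _ _ _)))
      (fun _ => Finset.card_le_two)
      (.of_forall fun z k => item_mem_reach ha hab (end_eq_or_eq hβ z.1.1))
  refine tendsto_sum_common_ne ha hab hl hα (fun p i j hp hji => ?_)
    (tendsto_sum_weight_mul (fun z k => kern_nonneg a b k _) hitems hh)
  simp only [Finset.mul_sum, ← mul_assoc]
  refine Finset.sum_congr rfl fun k hk => ?_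
  simp only [Finset.mem_sdiff, Finset.mem_insert, Finset.mem_singleton, not_or] at hk
  exact hf p i j k hp hji hk.2.1 hk.2.2

lemma isReachedItem_commonFilter (ha : 0 < a) (hab : a < b) (hl : IsPairFilter a b l) :
    IsReachedItem a b (commonFilter a b l) (fun z => z.1) fun z => z.2 :=
  isReachedItem_of_kern_ne_zero ha hab (fun _ => Or.inl rfl)
    (hl.fst.comp (tendsto_fst_weightedFilter _ _ _))
    ((eventually_weightedFilter _ _ _).mono fun z hz hk => by simp [hk] at hz)

lemma isReachedItem_secondFilter (ha : 0 < a) (hab : a < b) (hl : IsPairFilter a b l)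
    (hα : α = Prod.fst ∨ α = Prod.snd) :
    IsReachedItem a b (secondFilter a b l α) (fun z => z.1.1) fun z => z.2 :=
  isReachedItem_of_kern_ne_zero ha hab (fun z => end_eq_or_eq hα z.1.1)
    ((hl.tendsto_end hα).comp
      ((tendsto_fst_weightedFilter _ _ _).comp (tendsto_fst_weightedFilter _ _ _)))
    (eventually_weightedFilter _ _ _)

lemma isReachedItem_thirdFilter (ha : 0 < a) (hab : a < b) (hl : IsPairFilter a b l)
    (hβ : β = Prod.fst ∨ β = Prod.snd) :
    IsReachedItem a b (thirdFilter a b l α β) (fun z => z.1.1.1) fun z => z.2 :=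
  isReachedItem_of_kern_ne_zero ha hab (fun z => end_eq_or_eq hβ z.1.1.1)
    ((hl.tendsto_end hβ).comp ((tendsto_fst_weightedFilter _ _ _).comp
      ((tendsto_fst_weightedFilter _ _ _).comp (tendsto_fst_weightedFilter _ _ _))))
    (eventually_weightedFilter _ _ _)

end SumsOverItems

section PathSums

/-- The total weight of the paths between `p.1` and `p.2`. -/
def pathSum (a b : ℝ) (mX mY : ℕ → ℝ) (p : ℕ × ℕ) : ℝ :=
  ∑ i ∈ reach a b p, edgeWeight (kern a b) mX mY (path i p.1 p.2)

/-- The total weight of pairs of paths, between `p.1` and `p.2` and between `p.1` and another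
actor. -/
def twoPathSum (a b : ℝ) (mX mY : ℕ → ℝ) (p : ℕ × ℕ) : ℝ :=
  ∑ i ∈ reach a b p, ∑ j ∈ reach a b p, ∑ u ∈ others a b p,
    edgeWeight (kern a b) mX mY (path i p.1 p.2 ∪ path j p.1 u)

/-- The total weight of triples of paths through given items `i`, `j`, `k`, between `p.1` and `p.2`,
between `s` and another actor, and between `t` and a further actor. -/
def threePathWeight (a b : ℝ) (mX mY : ℕ → ℝ) (p : ℕ × ℕ) (s t i j k : ℕ) : ℝ :=
  ∑ r ∈ (others a b p).offDiag,
    edgeWeight (kern a b) mX mY (path i p.1 p.2 ∪ (path j s r.1 ∪ path k t r.2))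

/-- The total weight of triples of paths, between `p.1` and `p.2`, between `s` and another actor,
and between `t` and a further actor. -/
def threePathSum (a b : ℝ) (mX mY : ℕ → ℝ) (p : ℕ × ℕ) (s t : ℕ) : ℝ :=
  ∑ i ∈ reach a b p, ∑ j ∈ reach a b p, ∑ k ∈ reach a b p, threePathWeight a b mX mY p s t i j k

/-- The total weight of the stars which join `p.1`, `p.2` and another actor to a common item. -/
def starSum (a b : ℝ) (mX mY : ℕ → ℝ) (p : ℕ × ℕ) : ℝ :=
  ∑ i ∈ reach a b p, ∑ u ∈ others a b p,
    edgeWeight (kern a b) mX mY (path i p.1 p.2 ∪ path i p.1 u)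

variable {a b : ℝ} (mX mY : ℕ → ℝ)

lemma sum_eq_add_sum_sdiff {R : Finset ℕ} {i : ℕ} (hi : i ∈ R) (f : ℕ → ℝ) :
    ∑ j ∈ R, f j = f i + ∑ j ∈ R \ {i}, f j := by
  rw [Finset.sdiff_singleton_eq_erase, Finset.add_sum_erase _ _ hi]

lemma sum_sum_eq_add_sum_sdiff {R : Finset ℕ} {i : ℕ} (hi : i ∈ R) (f : ℕ → ℕ → ℝ) :
    ∑ j ∈ R, ∑ k ∈ R, f j k = f i i + ∑ k ∈ R \ {i}, f i k + ∑ j ∈ R \ {i}, f j i +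
      ∑ j ∈ R \ {i}, f j j + ∑ j ∈ R \ {i}, ∑ k ∈ R \ {i, j}, f j k := by
  have hrow (j : ℕ) (hj : j ∈ R \ {i}) :
      ∑ k ∈ R, f j k = f j i + f j j + ∑ k ∈ R \ {i, j}, f j k := by
    rw [sum_eq_add_sum_sdiff hi, sum_eq_add_sum_sdiff hj, sdiff_sdiff_left, add_assoc]
    rfl
  rw [sum_eq_add_sum_sdiff hi fun j => ∑ k ∈ R, f j k, sum_eq_add_sum_sdiff hi (f i),
    Finset.sum_congr rfl hrow, Finset.sum_add_distrib, Finset.sum_add_distrib]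
  ring

lemma sum_others_eq_mul_actorSum {p : ℕ × ℕ} {f : ℕ → ℝ} {i : ℕ} {w C : ℝ}
    (h : ∀ u, u ≠ p.1 → u ≠ p.2 → f u = w * (C * kern a b i u)) :
    ∑ u ∈ others a b p, f u = w * (C * actorSum a b p i) := by
  rw [actorSum, Finset.mul_sum, Finset.mul_sum]
  exact Finset.sum_congr rfl fun u hu => h u (mem_others.1 hu).2.1 (mem_others.1 hu).2.2

lemma threePathWeight_eq_mul_actorPairSum {p : ℕ × ℕ} {s t i j k n m : ℕ} {w C : ℝ}
    (h : ∀ u v, u ≠ p.1 → u ≠ p.2 → v ≠ p.1 → v ≠ p.2 → v ≠ u →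
      edgeWeight (kern a b) mX mY (path i p.1 p.2 ∪ (path j s u ∪ path k t v)) =
        w * (C * (kern a b n u * kern a b m v))) :
    threePathWeight a b mX mY p s t i j k = w * (C * actorPairSum a b p n m) := by
  rw [threePathWeight, actorPairSum, Finset.mul_sum, Finset.mul_sum]
  refine Finset.sum_congr rfl fun r hr => ?_
  rw [Finset.mem_offDiag, mem_others, mem_others] at hr
  exact h _ _ hr.1.2.1 hr.1.2.2 hr.2.1.2.1 hr.2.1.2.2 hr.2.2.symm

variable {l : Filter (ℕ × ℕ)}

lemma tendsto_pathSum (hl : IsPairFilter a b l) :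
    Tendsto (fun p => pathSum a b mX mY p / pairNorm a b p) l (𝓝 (mX 2 * mY 1 ^ 2)) :=
  tendsto_sum_common hl (h := fun _ => mX 2 * mY 1 ^ 2) (fun _ _ hp _ => edgeWeight_path hp)
    tendsto_const_nhds

lemma tendsto_starSum (ha : 0 < a) (hab : a < b) (hl : IsPairFilter a b l) :
    Tendsto (fun p => starSum a b mX mY p / pairNorm a b p) l
      (𝓝 (mX 3 * mY 1 ^ 3 * gam a b)) :=
  tendsto_sum_common hl
    (fun _ _ hp _ => sum_others_eq_mul_actorSum fun _ => edgeWeight_path_union_path_same hp)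
    ((tendsto_actorSum ha hab (isReachedItem_commonFilter ha hab hl)).const_mul _)

lemma tendsto_twoPathSum (ha : 0 < a) (hab : a < b) (hl : IsPairFilter a b l) :
    Tendsto (fun p => twoPathSum a b mX mY p / pairNorm a b p) l
      (𝓝 (mX 3 * mY 1 ^ 3 * gam a b + 2 * (√b - √a) * (mX 2 ^ 2 * mY 1 ^ 2 * mY 2 * gam a b))) := by
  have hne := tendsto_sum_common_ne ha hab hl (Or.inl rfl) (f := fun p i j => ∑ u ∈ others a b p,
      edgeWeight (kern a b) mX mY (path i p.1 p.2 ∪ path j p.1 u))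
    (fun _ _ _ hp hji => sum_others_eq_mul_actorSum fun _ => edgeWeight_path_union_path_ne hji hp)
    ((tendsto_actorSum ha hab (isReachedItem_secondFilter ha hab hl (Or.inl rfl))).const_mul _)
  refine ((tendsto_starSum mX mY ha hab hl).add hne).congr fun p => ?_
  rw [twoPathSum, starSum, ← add_div, ← Finset.sum_add_distrib]
  refine congrArg (· / pairNorm a b p) (Finset.sum_congr rfl fun i hi => ?_)
  rw [sum_eq_add_sum_sdiff hi]

end PathSums

section ThreePathSums

variable {a b : ℝ} (mX mY : ℕ → ℝ) {l : Filter (ℕ × ℕ)} {α β : ℕ × ℕ → ℕ}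

lemma tendsto_sum_threePathWeight_same (ha : 0 < a) (hab : a < b) (hl : IsPairFilter a b l)
    (hα : α = Prod.fst ∨ α = Prod.snd) (hβ : β = Prod.fst ∨ β = Prod.snd) :
    Tendsto (fun p => (∑ i ∈ reach a b p, threePathWeight a b mX mY p (α p) (β p) i i i) /
      pairNorm a b p) l (𝓝 (mX 4 * mY 1 ^ 4 * gam a b ^ 2)) := by
  have hi := isReachedItem_commonFilter ha hab hl
  exact tendsto_sum_common hl (fun p i hp _ => threePathWeight_eq_mul_actorPairSum _ _ fun u v =>
    edgeWeight_three_paths_same (end_eq_or_eq hα p) (end_eq_or_eq hβ p) hp)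
    ((tendsto_actorPairSum ha hab hi hi).const_mul _)

lemma tendsto_sum_threePathWeight_same_same_ne (ha : 0 < a) (hab : a < b)
    (hl : IsPairFilter a b l) (hα : α = Prod.fst ∨ α = Prod.snd)
    (hβ : β = Prod.fst ∨ β = Prod.snd) :
    Tendsto (fun p => (∑ i ∈ reach a b p, ∑ k ∈ reach a b p \ {i},
      threePathWeight a b mX mY p (α p) (β p) i i k) / pairNorm a b p) l
      (𝓝 (2 * (√b - √a) * (mX 2 * mX 3 * mY 1 ^ 3 * mY 2 * gam a b ^ 2))) := by
  have hi := (isReachedItem_commonFilter ha hab hl).comp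
    (tendsto_fst_weightedFilter _ (fun z => reach a b z.1 \ {z.2}) fun z j => kern a b j (β z.1))
  exact tendsto_sum_common_ne ha hab hl hβ
    (fun p i k hp hki => threePathWeight_eq_mul_actorPairSum _ _ fun u v =>
      edgeWeight_three_paths_same_same_ne (end_eq_or_eq hα p) (end_eq_or_eq hβ p) hki hp)
    ((tendsto_actorPairSum ha hab hi (isReachedItem_secondFilter ha hab hl hβ)).const_mul _)

lemma threePathWeight_swap (p : ℕ × ℕ) (s t i j k : ℕ) :
    threePathWeight a b mX mY p s t i j k = threePathWeight a b mX mY p t s i k j := by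
  refine Finset.sum_nbij' Prod.swap Prod.swap ?_ ?_ ?_ ?_ ?_
  case refine_5 => simp [Finset.union_comm (path j s _)]
  all_goals simp +contextual [Ne.symm, eq_comm]

lemma tendsto_sum_threePathWeight_same_ne_same (ha : 0 < a) (hab : a < b)
    (hl : IsPairFilter a b l) (hα : α = Prod.fst ∨ α = Prod.snd)
    (hβ : β = Prod.fst ∨ β = Prod.snd) :
    Tendsto (fun p => (∑ i ∈ reach a b p, ∑ j ∈ reach a b p \ {i},
      threePathWeight a b mX mY p (α p) (β p) i j i) / pairNorm a b p) l
      (𝓝 (2 * (√b - √a) * (mX 2 * mX 3 * mY 1 ^ 3 * mY 2 * gam a b ^ 2))) := by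
  refine (tendsto_sum_threePathWeight_same_same_ne mX mY ha hab hl hβ hα).congr fun p => ?_
  exact congrArg (· / pairNorm a b p) (Finset.sum_congr rfl fun i _ => Finset.sum_congr rfl
    fun j _ => threePathWeight_swap mX mY p (β p) (α p) i i j)

lemma tendsto_sum_threePathWeight_ne_same (ha : 0 < a) (hab : a < b) (hl : IsPairFilter a b l) :
    Tendsto (fun p => (∑ i ∈ reach a b p, ∑ j ∈ reach a b p \ {i},
      threePathWeight a b mX mY p p.1 p.1 i j j) / pairNorm a b p) l
      (𝓝 (2 * (√b - √a) * (mX 2 * mX 3 * mY 1 ^ 3 * mY 2 * gam a b ^ 2))) := by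
  have hj := isReachedItem_secondFilter ha hab hl (Or.inl rfl)
  exact tendsto_sum_common_ne ha hab hl (Or.inl rfl)
    (fun p i j hp hji => threePathWeight_eq_mul_actorPairSum _ _ fun u v =>
      edgeWeight_three_paths_ne_same hji hp)
    ((tendsto_actorPairSum ha hab hj hj).const_mul _)

-- The additional factor `κ j t ≤ (√a)⁻¹ / t` makes this pattern negligible.
lemma tendsto_sum_threePathWeight_ends_ne_same (ha : 0 < a) (hab : a < b)
    (hl : IsPairFilter a b l) :
    Tendsto (fun p => (∑ i ∈ reach a b p, ∑ j ∈ reach a b p \ {i},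
      threePathWeight a b mX mY p p.1 p.2 i j j) / pairNorm a b p) l (𝓝 0) := by
  have hj := isReachedItem_secondFilter ha hab hl (Or.inl rfl)
  have hkern : Tendsto (fun z : ((ℕ × ℕ) × ℕ) × ℕ => kern a b z.2 z.1.1.2)
      (secondFilter a b l Prod.fst) (𝓝 0) :=
    squeeze_zero (fun _ => kern_nonneg _ _ _ _) (fun _ => kern_le_div_actor ha _ _)
      ((tendsto_natCast_atTop_atTop.comp (hl.snd.comp ((tendsto_fst_weightedFilter _ _ _).comp
        (tendsto_fst_weightedFilter _ _ _)))).const_div_atTop _)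
  simpa using tendsto_sum_common_ne ha hab hl (Or.inl rfl)
    (fun p i j hp hji => threePathWeight_eq_mul_actorPairSum _ _ fun u v =>
      edgeWeight_three_paths_ends_ne_same hji hp)
    ((hkern.const_mul (mX 2 * mX 4 * mY 1 ^ 2 * mY 2 ^ 2)).mul (tendsto_actorPairSum ha hab hj hj))

/-- The contribution to the limit of `threePathSum` of the patterns in which the first item occurs
again. -/
def repeatedItemLimit (a b : ℝ) (mX mY : ℕ → ℝ) : ℝ :=
  mX 4 * mY 1 ^ 4 * gam a b ^ 2 +
    4 * (√b - √a) * (mX 2 * mX 3 * mY 1 ^ 3 * mY 2 * gam a b ^ 2)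

lemma tendsto_threePathSum_of_ne (ha : 0 < a) (hab : a < b) (hl : IsPairFilter a b l)
    (hα : α = Prod.fst ∨ α = Prod.snd) (hβ : β = Prod.fst ∨ β = Prod.snd) {c C : ℝ}
    (hsame : Tendsto (fun p => (∑ i ∈ reach a b p, ∑ j ∈ reach a b p \ {i},
      threePathWeight a b mX mY p (α p) (β p) i j j) / pairNorm a b p) l (𝓝 c))
    (hne : ∀ p : ℕ × ℕ, p.1 ≠ p.2 → ∀ i j k, j ≠ i → k ≠ i → k ≠ j → ∀ u v, u ≠ p.1 → u ≠ p.2 →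
      v ≠ p.1 → v ≠ p.2 → v ≠ u →
      edgeWeight (kern a b) mX mY (path i p.1 p.2 ∪ (path j (α p) u ∪ path k (β p) v)) =
        kern a b i p.1 * kern a b i p.2 * kern a b j (α p) * kern a b k (β p) *
          (C * (kern a b j u * kern a b k v))) :
    Tendsto (fun p => threePathSum a b mX mY p (α p) (β p) / pairNorm a b p) l
      (𝓝 (repeatedItemLimit a b mX mY + c +
        2 * (√b - √a) * (2 * (√b - √a) * (C * gam a b ^ 2)))) := by
  have hj := (isReachedItem_secondFilter ha hab hl hα).comp (tendsto_fst_weightedFilter _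
    (fun z => reach a b z.1.1 \ {z.1.2, z.2}) fun z k => kern a b k (β z.1.1))
  have hdistinct := tendsto_sum_common_ne_ne ha hab hl hα hβ
    (fun p i j k hp hji hki hkj => threePathWeight_eq_mul_actorPairSum _ _
      (hne p hp i j k hji hki hkj))
    ((tendsto_actorPairSum ha hab hj (isReachedItem_thirdFilter ha hab hl hβ)).const_mul C)
  have hsum := ((((tendsto_sum_threePathWeight_same mX mY ha hab hl hα hβ).add
    (tendsto_sum_threePathWeight_same_same_ne mX mY ha hab hl hα hβ)).add
    (tendsto_sum_threePathWeight_same_ne_same mX mY ha hab hl hα hβ)).add hsame).add hdistinct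
  convert hsum using 2 with p
  · simp only [← add_div, ← Finset.sum_add_distrib]
    exact congrArg (· / pairNorm a b p)
      (Finset.sum_congr rfl fun i hi => sum_sum_eq_add_sum_sdiff hi _)
  · rw [repeatedItemLimit]
    ring

lemma tendsto_threePathSum_fst_fst (ha : 0 < a) (hab : a < b) (hl : IsPairFilter a b l) :
    Tendsto (fun p => threePathSum a b mX mY p p.1 p.1 / pairNorm a b p) l
      (𝓝 (mX 4 * mY 1 ^ 4 * gam a b ^ 2 +
        6 * (mX 2 * mX 3 * mY 1 ^ 3 * mY 2 * gam a b ^ 2 * (√b - √a)) +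
        4 * (mX 2 ^ 3 * mY 1 ^ 3 * mY 3 * gam a b ^ 2 * (√b - √a) ^ 2))) := by
  convert tendsto_threePathSum_of_ne mX mY ha hab hl (Or.inl rfl) (Or.inl rfl)
    (tendsto_sum_threePathWeight_ne_same mX mY ha hab hl) fun p hp i j k hji hki hkj u v =>
      edgeWeight_three_paths_ne_ne hji hki hkj hp using 2
  rw [repeatedItemLimit]
  ring

lemma tendsto_threePathSum_fst_snd (ha : 0 < a) (hab : a < b) (hl : IsPairFilter a b l) :
    Tendsto (fun p => threePathSum a b mX mY p p.1 p.2 / pairNorm a b p) l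
      (𝓝 (mX 4 * mY 1 ^ 4 * gam a b ^ 2 +
        4 * (mX 2 * mX 3 * mY 1 ^ 3 * mY 2 * gam a b ^ 2 * (√b - √a)) +
        4 * (mX 2 ^ 3 * mY 1 ^ 2 * mY 2 ^ 2 * gam a b ^ 2 * (√b - √a) ^ 2))) := by
  convert tendsto_threePathSum_of_ne mX mY ha hab hl (Or.inl rfl) (Or.inr rfl)
    (tendsto_sum_threePathWeight_ends_ne_same mX mY ha hab hl) fun p hp i j k hji hki hkj u v =>
      edgeWeight_three_paths_ends_ne_ne hji hki hkj hp using 2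
  rw [repeatedItemLimit]
  ring

end ThreePathSums

section KernelProducts

open scoped Finset

/-- The product of the kernel, multiplied by a constant `c`, over a finite set of edges. If `c` is
large, it dominates the probability that all these edges are present. -/
def kernProd (a b c : ℝ) (F : Finset (ℕ × ℕ)) : ℝ := ∏ e ∈ F, c * kern a b e.1 e.2

variable {a b c : ℝ}

lemma kernProd_nonneg (hc : 0 ≤ c) (F : Finset (ℕ × ℕ)) : 0 ≤ kernProd a b c F :=
  Finset.prod_nonneg fun _ _ => mul_nonneg hc (kern_nonneg _ _ _ _)

lemma kernProd_insert_of_notMem {e : ℕ × ℕ} {F : Finset (ℕ × ℕ)} (he : e ∉ F) :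
    kernProd a b c (insert e F) = c * kern a b e.1 e.2 * kernProd a b c F :=
  Finset.prod_insert he

lemma kernProd_path {i s t : ℕ} (hst : s ≠ t) :
    kernProd a b c (path i s t) = c ^ 2 * (kern a b i s * kern a b i t) := by
  simp [kernProd, path, hst]
  ring

lemma union_path (F : Finset (ℕ × ℕ)) (i s t : ℕ) :
    F ∪ path i s t = insert (i, t) (insert (i, s) F) := by
  ext e
  simp [path]
  tauto

lemma card_path_le (i s t : ℕ) : #(path i s t) ≤ 2 := Finset.card_le_two

lemma kernBound_nonneg (ha : 0 < a) (hb : 0 ≤ b) : 0 ≤ kernBound a b := by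
  simpa using sum_kern_item_le_kernBound ha hb 0 ∅

lemma sum_kernProd_insert_le (hc : 0 ≤ c) {g : ℕ → ℕ × ℕ} (hg : Function.Injective g) {K : ℝ}
    (S : Finset ℕ) (hK : ∑ x ∈ S, kern a b (g x).1 (g x).2 ≤ K) (F : Finset (ℕ × ℕ)) :
    ∑ x ∈ S, kernProd a b c (insert (g x) F) ≤ (#F + c * K) * kernProd a b c F := by
  have hF := kernProd_nonneg (a := a) (b := b) hc F
  have hinsert (x : ℕ) : kernProd a b c (insert (g x) F) ≤
      ((if g x ∈ F then 1 else 0) + c * kern a b (g x).1 (g x).2) * kernProd a b c F := by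
    split_ifs with hx
    · rw [Finset.insert_eq_of_mem hx]
      exact le_mul_of_one_le_left hF
        (le_add_of_nonneg_right (mul_nonneg hc (kern_nonneg _ _ _ _)))
    · rw [kernProd_insert_of_notMem hx, zero_add]
  have hcard : ∑ x ∈ S, (if g x ∈ F then (1 : ℝ) else 0) ≤ #F := by
    rw [Finset.sum_boole, Nat.cast_le]
    exact Finset.card_le_card_of_injOn g (fun x hx => (Finset.mem_filter.1 hx).2) hg.injOn
  refine (Finset.sum_le_sum fun x _ => hinsert x).trans ?_
  rw [← Finset.sum_mul, Finset.sum_add_distrib, ← Finset.mul_sum]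
  gcongr

lemma sum_kernProd_insert_item_le (ha : 0 < a) (hb : 0 ≤ b) (hc : 0 ≤ c) (α : ℕ) (R : Finset ℕ)
    (F : Finset (ℕ × ℕ)) :
    ∑ i ∈ R, kernProd a b c (insert (i, α) F) ≤ (#F + c * kernBound a b) * kernProd a b c F :=
  sum_kernProd_insert_le hc (Prod.mk_left_injective α) R (sum_kern_item_le_kernBound ha hb α R) F

lemma sum_kernProd_insert_actor_le (ha : 0 < a) (hb : 0 < b) (hc : 0 ≤ c) (i : ℕ) (U : Finset ℕ)
    (F : Finset (ℕ × ℕ)) :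
    ∑ u ∈ U, kernProd a b c (insert (i, u) F) ≤ (#F + c * kernBound a b) * kernProd a b c F :=
  sum_kernProd_insert_le hc (Prod.mk_right_injective i) U
    (sum_kern_actor_le_kernBound ha hb i U) F

lemma sum_sum_kernProd_insert_le (ha : 0 < a) (hb : 0 ≤ b) (hc : 0 ≤ c) {m : ℕ}
    {F : Finset (ℕ × ℕ)} (hF : #F ≤ m) (α β : ℕ) (R : Finset ℕ) :
    ∑ j ∈ R, ∑ k ∈ R, kernProd a b c (insert (j, α) (insert (k, β) F)) ≤
      (m + 1 + c * kernBound a b) ^ 2 * kernProd a b c F := by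
  have hK := kernBound_nonneg ha hb
  have hm : (#F : ℝ) ≤ m + 1 := by exact_mod_cast hF.trans m.le_succ
  have hcard (k : ℕ) : (#(insert (k, β) F) : ℝ) ≤ m + 1 := by
    exact_mod_cast (Finset.card_insert_le _ _).trans (Nat.succ_le_succ hF)
  have hprod := kernProd_nonneg (a := a) (b := b) hc
  rw [Finset.sum_comm]
  calc _ ≤ ∑ k ∈ R, (m + 1 + c * kernBound a b) * kernProd a b c (insert (k, β) F) := by
        refine Finset.sum_le_sum fun k _ =>
          (sum_kernProd_insert_item_le ha hb hc α R _).trans ?_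
        gcongr
        exacts [hprod _, hcard k]
    _ ≤ (m + 1 + c * kernBound a b) * ((m + 1 + c * kernBound a b) * kernProd a b c F) := by
        rw [← Finset.mul_sum]
        gcongr
        refine (sum_kernProd_insert_item_le ha hb hc β R F).trans ?_
        gcongr
        exact hprod F
    _ = _ := by ring

lemma sum_kernProd_union_path_le (ha : 0 < a) (hb : 0 < b) (hc : 0 ≤ c) {m : ℕ}
    {F : Finset (ℕ × ℕ)} (hF : #F ≤ m) (α : ℕ) (R U : Finset ℕ) :
    ∑ j ∈ R, ∑ u ∈ U, kernProd a b c (F ∪ path j α u) ≤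
      (m + 1 + c * kernBound a b) ^ 2 * kernProd a b c F := by
  have hK := kernBound_nonneg ha hb.le
  have hm : (#F : ℝ) ≤ m + 1 := by exact_mod_cast hF.trans m.le_succ
  have hcard (j : ℕ) : (#(insert (j, α) F) : ℝ) ≤ m + 1 := by
    exact_mod_cast (Finset.card_insert_le _ _).trans (Nat.succ_le_succ hF)
  have hprod := kernProd_nonneg (a := a) (b := b) hc
  simp only [union_path]
  calc _ ≤ ∑ j ∈ R, (m + 1 + c * kernBound a b) * kernProd a b c (insert (j, α) F) := by
        refine Finset.sum_le_sum fun j _ =>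
          (sum_kernProd_insert_actor_le ha hb hc j U _).trans ?_
        gcongr
        exacts [hprod _, hcard j]
    _ ≤ (m + 1 + c * kernBound a b) * ((m + 1 + c * kernBound a b) * kernProd a b c F) := by
        rw [← Finset.mul_sum]
        gcongr
        refine (sum_kernProd_insert_item_le ha hb.le hc α R F).trans ?_
        gcongr
        exact hprod F
    _ = _ := by ring

lemma kern_mul_kernProd_le (ha : 0 < a) (hb : 0 < b) (hc : 0 ≤ c) {F : Finset (ℕ × ℕ)} {k β : ℕ}
    (hk : (k, β) ∈ F) (u : ℕ) :
    kern a b k u * kernProd a b c F ≤ √b / (a * β) * kernProd a b c F := by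
  by_cases hkern : kern a b k β = 0
  · simp [show kernProd a b c F = 0 from Finset.prod_eq_zero hk (by simp [hkern])]
  · obtain ⟨hβk, -, -, hβ⟩ := bounds_of_kern_ne_zero hkern
    have hF := kernProd_nonneg (a := a) (b := b) hc F
    gcongr
    exact (kern_le_div_item ha hb k u).trans (by gcongr)

-- Adding a cycle instead of a path saves a factor `κ k u ≤ √b / k ≤ √b / (a β)`.
lemma sum_kernProd_union_cycle_le (ha : 0 < a) (hb : 0 < b) (hc : 0 ≤ c) {m : ℕ}
    {F : Finset (ℕ × ℕ)} (hF : #F ≤ m) {α β : ℕ} (R : Finset ℕ) {U : Finset ℕ}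
    (hU : ∀ u ∈ U, u ≠ α ∧ u ≠ β ∧ ∀ e ∈ F, e.2 ≠ u) :
    ∑ r ∈ R.offDiag, ∑ u ∈ U, kernProd a b c (F ∪ (path r.1 α u ∪ path r.2 β u)) ≤
      c ^ 2 * kernBound a b * (√b / (a * β)) * ((m + 1 + c * kernBound a b) ^ 2 *
        kernProd a b c F) := by
  have hK := kernBound_nonneg ha hb.le
  have hprod := kernProd_nonneg (a := a) (b := b) hc
  have hcycle (r : ℕ × ℕ) (hr : r.1 ≠ r.2) (u : ℕ) (hu : u ∈ U) :
      kernProd a b c (F ∪ (path r.1 α u ∪ path r.2 β u)) ≤ c ^ 2 * (√b / (a * β)) *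
        kernProd a b c (insert (r.1, α) (insert (r.2, β) F)) * kern a b r.1 u := by
    obtain ⟨huα, huβ, huF⟩ := hU u hu
    have hnotMem (j : ℕ) : (j, u) ∉ F := fun he => huF _ he rfl
    have hunion : F ∪ (path r.1 α u ∪ path r.2 β u) =
        insert (r.1, u) (insert (r.2, u) (insert (r.1, α) (insert (r.2, β) F))) := by
      ext e
      simp [path]
      tauto
    have hkern := kern_mul_kernProd_le ha hb hc (F := insert (r.1, α) (insert (r.2, β) F))
      (k := r.2) (β := β) (by simp) u
    rw [hunion, kernProd_insert_of_notMem (by simp [hr, huα, huβ, hnotMem]),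
      kernProd_insert_of_notMem (by simp [huα, huβ, hnotMem])]
    nlinarith [mul_le_mul_of_nonneg_left hkern
      (mul_nonneg (sq_nonneg c) (kern_nonneg a b r.1 u))]
  calc _ ≤ ∑ r ∈ R.offDiag, c ^ 2 * kernBound a b * (√b / (a * β)) *
        kernProd a b c (insert (r.1, α) (insert (r.2, β) F)) := by
        refine Finset.sum_le_sum fun r hr => (Finset.sum_le_sum
          (hcycle r (Finset.mem_offDiag.1 hr).2.2)).trans ?_
        rw [← Finset.mul_sum]
        exact (mul_le_mul_of_nonneg_left (sum_kern_actor_le_kernBound ha hb r.1 U)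
          (mul_nonneg (by positivity) (hprod _))).trans_eq (by ring)
    _ ≤ _ := by
        rw [← Finset.mul_sum]
        gcongr
        rw [sum_offDiag_eq_sum_sdiff]
        refine (Finset.sum_le_sum fun j _ => Finset.sum_le_sum_of_subset_of_nonneg
          Finset.sdiff_subset fun _ _ _ => hprod _).trans
          (sum_sum_kernProd_insert_le ha hb.le hc hF α β R)

lemma sum_kernProd_path_union_path_le (ha : 0 < a) (hb : 0 ≤ b) (hc : 0 ≤ c) {s t : ℕ}
    (hst : s ≠ t) (R : Finset ℕ) :
    ∑ r ∈ R.offDiag, kernProd a b c (path r.1 s t ∪ path r.2 s t) ≤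
      c ^ 2 * kernBound a b * ((√a)⁻¹ / t) * ∑ i ∈ R, kernProd a b c (path i s t) := by
  have hterm (i k : ℕ) (hk : k ∈ R \ {i}) : kernProd a b c (path i s t ∪ path k s t) ≤
      c ^ 2 * ((√a)⁻¹ / t) * kernProd a b c (path i s t) * kern a b k s := by
    have hki : k ≠ i := by simpa using (Finset.mem_sdiff.1 hk).2
    rw [union_path, kernProd_insert_of_notMem (by simp [path, hki, hst.symm]),
      kernProd_insert_of_notMem (by simp [path, hki])]
    nlinarith [mul_le_mul_of_nonneg_left (kern_le_div_actor (b := b) ha k t)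
      (mul_nonneg (mul_nonneg (sq_nonneg c) (kern_nonneg a b k s))
        (kernProd_nonneg (a := a) (b := b) hc (path i s t)))]
  rw [sum_offDiag_eq_sum_sdiff, Finset.mul_sum]
  refine Finset.sum_le_sum fun i _ => (Finset.sum_le_sum (hterm i)).trans ?_
  rw [← Finset.mul_sum]
  exact (mul_le_mul_of_nonneg_left (sum_kern_item_le_kernBound ha hb s _)
    (mul_nonneg (by positivity) (kernProd_nonneg hc _))).trans_eq (by ring)

end KernelProducts

section Counts

open scoped Finset

/-- The indicator of the event `v_s ∼ v_t`. -/
def adjInd (s t : ℕ) (ω : Sample) : ℝ := (adjEvent s t).indicator 1 ω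

/-- The indicator of the event `cylinder T F`. -/
def edgeInd (T : Set ℝ≥0) (F : Finset (ℕ × ℕ)) (ω : Sample) : ℝ := (cylinder T F).indicator 1 ω

/-- The number of configurations of a finite family all of whose edges are present, the weights of
the ends of these edges lying in `T`. -/
def edgeCount {ι : Type*} (T : Set ℝ≥0) (Q : Finset ι) (F : ι → Finset (ℕ × ℕ)) (ω : Sample) : ℝ :=
  ∑ q ∈ Q, edgeInd T (F q) ω

variable {ι κ : Type*} {T : Set ℝ≥0}

lemma adjEvent_comm (s t : ℕ) : adjEvent s t = adjEvent t s := by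
  ext ω
  exact (graph ω).adj_comm s t

lemma adjInd_comm (s t : ℕ) : adjInd s t = adjInd t s := by
  funext ω
  rw [adjInd, adjInd, adjEvent_comm]

lemma adjInd_nonneg (s t : ℕ) (ω : Sample) : 0 ≤ adjInd s t ω :=
  Set.indicator_nonneg (fun _ _ => zero_le_one) _

lemma adjInd_le_one (s t : ℕ) (ω : Sample) : adjInd s t ω ≤ 1 :=
  Set.indicator_apply_le' (fun _ => le_rfl) fun _ => zero_le_one

lemma adjInd_mul_self (s t : ℕ) (ω : Sample) : adjInd s t ω * adjInd s t ω = adjInd s t ω := by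
  by_cases h : ω ∈ adjEvent s t <;> simp [adjInd, h]

lemma measurableSet_adjEvent (s t : ℕ) : MeasurableSet (adjEvent s t) := by
  by_cases hst : s = t
  · simp [adjEvent, graph, hst]
  · have h : adjEvent s t = ⋃ i, cylinder Set.univ (path i s t) := by
      ext ω
      simp [adjEvent, graph, hst, cylinder, path]
    rw [h]
    exact MeasurableSet.iUnion fun i => measurableSet_cylinder MeasurableSet.univ _

lemma edgeInd_nonneg (T : Set ℝ≥0) (F : Finset (ℕ × ℕ)) (ω : Sample) : 0 ≤ edgeInd T F ω :=
  Set.indicator_nonneg (fun _ _ => zero_le_one) _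

lemma edgeInd_eq_zero_or_one (T : Set ℝ≥0) (F : Finset (ℕ × ℕ)) (ω : Sample) :
    edgeInd T F ω = 0 ∨ edgeInd T F ω = 1 := by
  by_cases h : ω ∈ cylinder T F <;> simp [edgeInd, h]

lemma edgeInd_eq_one_iff {F : Finset (ℕ × ℕ)} {ω : Sample} :
    edgeInd T F ω = 1 ↔ ω ∈ cylinder T F := by
  by_cases h : ω ∈ cylinder T F <;> simp [edgeInd, h]

lemma edgeInd_mul (T : Set ℝ≥0) (F F' : Finset (ℕ × ℕ)) (ω : Sample) :
    edgeInd T F ω * edgeInd T F' ω = edgeInd T (F ∪ F') ω := by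
  rw [edgeInd, edgeInd, edgeInd, cylinder_union, Set.inter_indicator_one, Pi.mul_apply]

lemma edgeInd_anti {F F' : Finset (ℕ × ℕ)} (h : F ⊆ F') (ω : Sample) :
    edgeInd T F' ω ≤ edgeInd T F ω :=
  Set.indicator_le_indicator_of_subset
    (show cylinder T F' ⊆ cylinder T F from fun _ hω e he => hω e (h he)) (fun _ => zero_le_one) ω

lemma edgeCount_nonneg (T : Set ℝ≥0) (Q : Finset ι) (F : ι → Finset (ℕ × ℕ)) (ω : Sample) :
    0 ≤ edgeCount T Q F ω :=
  Finset.sum_nonneg fun _ _ => edgeInd_nonneg _ _ _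

lemma edgeCount_mul (T : Set ℝ≥0) (Q : Finset ι) (S : Finset κ) (F : ι → Finset (ℕ × ℕ))
    (G : κ → Finset (ℕ × ℕ)) :
    edgeCount T Q F * edgeCount T S G = edgeCount T (Q ×ˢ S) fun q => F q.1 ∪ G q.2 := by
  funext ω
  simp only [edgeCount, Pi.mul_apply, Finset.sum_mul_sum, edgeInd_mul, Finset.sum_product]

lemma edgeCount_product (T : Set ℝ≥0) (Q : Finset ι) (S : Finset κ)
    (F : ι × κ → Finset (ℕ × ℕ)) (ω : Sample) :
    edgeCount T (Q ×ˢ S) F ω = ∑ s ∈ S, edgeCount T Q (fun q => F (q, s)) ω :=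
  Finset.sum_product_right _ _ _

lemma integrable_adjInd_mul {P : Measure Sample} {Z : Sample → ℝ} (hZ : Integrable Z P) (s t : ℕ) :
    Integrable (fun ω => adjInd s t ω * Z ω) P := by
  simpa only [adjInd, ← Set.indicator_mul_left, Pi.one_apply, one_mul]
    using hZ.indicator (measurableSet_adjEvent s t)

variable {P : Measure Sample} [IsFiniteMeasure P]

lemma integrable_adjInd (s t : ℕ) : Integrable (adjInd s t) P :=
  (integrable_const 1).indicator (measurableSet_adjEvent s t)

lemma integrable_edgeCount (hT : MeasurableSet T) (Q : Finset ι) (F : ι → Finset (ℕ × ℕ)) :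
    Integrable (edgeCount T Q F) P :=
  integrable_finsetSum _ fun _ _ =>
    (integrable_const 1).indicator (measurableSet_cylinder hT _)

lemma integral_edgeCount (hT : MeasurableSet T) (Q : Finset ι) (F : ι → Finset (ℕ × ℕ)) :
    ∫ ω, edgeCount T Q F ω ∂P = ∑ q ∈ Q, P.real (cylinder T (F q)) := by
  refine (integral_finsetSum _ fun _ _ =>
    (integrable_const 1).indicator (measurableSet_cylinder hT _)).trans ?_
  exact Finset.sum_congr rfl fun q _ => integral_indicator_one (measurableSet_cylinder hT _)

end Counts

section Bonferroni

lemma sum_mul_sum_eq_diag_add_offDiag (R : Finset ℕ) (f g : ℕ → ℝ) :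
    (∑ i ∈ R, f i) * ∑ i ∈ R, g i = ∑ i ∈ R, f i * g i + ∑ r ∈ R.offDiag, f r.1 * g r.2 := by
  rw [sum_offDiag_eq_sum_sdiff, Finset.sum_mul_sum, ← Finset.sum_add_distrib]
  exact Finset.sum_congr rfl fun i hi => sum_eq_add_sum_sdiff hi fun j => f i * g j

lemma sum_sub_sum_offDiag_le {R : Finset ℕ} {x : ℕ → ℝ} (hx : ∀ i, x i = 0 ∨ x i = 1) {y : ℝ}
    (hy : 0 ≤ y) (h : ∀ i ∈ R, x i = 1 → 1 ≤ y) :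
    ∑ i ∈ R, x i - ∑ r ∈ R.offDiag, x r.1 * x r.2 ≤ y := by
  have hsq : ∀ i, x i * x i = x i := fun i => by rcases hx i with hi | hi <;> simp [hi]
  have hsum := sum_mul_sum_eq_diag_add_offDiag R x x
  simp only [hsq] at hsum
  by_cases hone : ∃ i ∈ R, x i = 1
  · obtain ⟨i, hi, hxi⟩ := hone
    nlinarith [h i hi hxi, sq_nonneg (∑ i ∈ R, x i - 1)]
  · push Not at hone
    have hzero : ∑ i ∈ R, x i = 0 :=
      Finset.sum_eq_zero fun i hi => (hx i).resolve_right (hone i hi)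
    rw [hzero] at hsum ⊢
    linarith

lemma mul_sub_le_mul {x y A B A₂ B₂ : ℝ} (hx : 0 ≤ x) (hy : 0 ≤ y) (hA : 0 ≤ A) (hB : 0 ≤ B)
    (hA₂ : 0 ≤ A₂) (hB₂ : 0 ≤ B₂) (hAx : A - A₂ ≤ x) (hBy : B - B₂ ≤ y) :
    A * B - (A₂ * B + A * B₂) ≤ x * y := by
  have hxA : A - A₂ ≤ min x A := le_min hAx (by linarith)
  have hyB : B - B₂ ≤ min y B := le_min hBy (by linarith)
  have hmin : min x A * min y B ≤ x * y :=
    mul_le_mul (min_le_left _ _) (min_le_left _ _) (le_min hy hB) hx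
  have hleft : (A - min x A) * B ≤ A₂ * B := mul_le_mul_of_nonneg_right (by linarith) hB
  have hright : min x A * (B - min y B) ≤ A * B₂ :=
    mul_le_mul (min_le_right _ _) (by linarith) (by linarith [min_le_right y B]) hA
  nlinarith

lemma sum_offDiag_mul_le {R : Finset ℕ} {f g : ℕ → ℝ} (hf : ∀ i, 0 ≤ f i) (hg : ∀ i, 0 ≤ g i) :
    ∑ r ∈ R.offDiag, f r.1 * g r.2 ≤ (∑ i ∈ R, f i) * ∑ i ∈ R, g i := by
  rw [sum_mul_sum_eq_diag_add_offDiag]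
  exact le_add_of_nonneg_left (Finset.sum_nonneg fun i _ => mul_nonneg (hf i) (hg i))

end Bonferroni

section PathCounts

/-- The number of paths of length two between the actors `s` and `t` through the items of `R`. -/
def pathCount (T : Set ℝ≥0) (R : Finset ℕ) (s t : ℕ) : Sample → ℝ :=
  edgeCount T R fun i => path i s t

/-- The number of ordered pairs of distinct items of `R`, the first of them joining `s` and `u` and
the second one joining `t` and `u`. -/
def pathPairCount (T : Set ℝ≥0) (R : Finset ℕ) (s t u : ℕ) : Sample → ℝ :=
  edgeCount T R.offDiag fun r => path r.1 s u ∪ path r.2 t u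

variable {T : Set ℝ≥0} {R U : Finset ℕ} {s t u : ℕ} {ω : Sample}

lemma pathCount_nonneg (T : Set ℝ≥0) (R : Finset ℕ) (s t : ℕ) (ω : Sample) :
    0 ≤ pathCount T R s t ω := edgeCount_nonneg _ _ _ _

lemma pathPairCount_nonneg (T : Set ℝ≥0) (R : Finset ℕ) (s t u : ℕ) (ω : Sample) :
    0 ≤ pathPairCount T R s t u ω := edgeCount_nonneg _ _ _ _

lemma adjInd_eq_one_of_mem_cylinder {i : ℕ} (hst : s ≠ t) (h : ω ∈ cylinder T (path i s t)) :
    adjInd s t ω = 1 := by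
  have hmem : ω ∈ adjEvent s t :=
    ⟨hst, i, (h (i, s) (by simp [path])).1, (h (i, t) (by simp [path])).1⟩
  simp [adjInd, hmem]

lemma pathCount_sub_le_adjInd (T : Set ℝ≥0) (R : Finset ℕ) (hst : s ≠ t) (ω : Sample) :
    pathCount T R s t ω - pathPairCount T R s s t ω ≤ adjInd s t ω := by
  have h := sum_sub_sum_offDiag_le (R := R) (fun i => edgeInd_eq_zero_or_one T (path i s t) ω)
    (adjInd_nonneg s t ω)
    fun i _ hi => (adjInd_eq_one_of_mem_cylinder hst (edgeInd_eq_one_iff.1 hi)).ge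
  simpa only [edgeInd_mul, pathCount, pathPairCount, edgeCount] using h

lemma adjInd_le_pathCount (h : ∀ i, ω.2 (i, s) = true → i ∈ R) :
    adjInd s t ω ≤ pathCount Set.univ R s t ω := by
  by_cases hadj : ω ∈ adjEvent s t
  · obtain ⟨-, i, hs, ht⟩ := hadj
    have hpath : edgeInd Set.univ (path i s t) ω = 1 :=
      edgeInd_eq_one_iff.2 (by simp [cylinder, path, hs, ht])
    calc adjInd s t ω ≤ edgeInd Set.univ (path i s t) ω := (adjInd_le_one s t ω).trans hpath.ge
      _ ≤ pathCount Set.univ R s t ω :=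
          Finset.single_le_sum (f := fun i => edgeInd Set.univ (path i s t) ω)
            (fun _ _ => edgeInd_nonneg _ _ _) (h i hs)
  · rw [adjInd, Set.indicator_of_notMem hadj]
    exact pathCount_nonneg _ _ _ _ _

lemma sum_sub_sum_le_sum_adjInd (hU : ∀ u ∈ U, u ≠ s) :
    ∑ u ∈ U, pathCount T R s u ω - ∑ u ∈ U, pathPairCount T R s s u ω ≤ ∑ u ∈ U, adjInd s u ω := by
  rw [← Finset.sum_sub_distrib]
  exact Finset.sum_le_sum fun u hu => pathCount_sub_le_adjInd T R (hU u hu).symm ω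

lemma sum_offDiag_sub_le_sum_offDiag_adjInd (hs : ∀ u ∈ U, u ≠ s) (ht : ∀ u ∈ U, u ≠ t) :
    ∑ r ∈ U.offDiag, pathCount T R s r.1 ω * pathCount T R t r.2 ω -
        ((∑ u ∈ U, pathPairCount T R s s u ω) * ∑ u ∈ U, pathCount T R t u ω +
          (∑ u ∈ U, pathPairCount T R t t u ω) * ∑ u ∈ U, pathCount T R s u ω) ≤
      ∑ r ∈ U.offDiag, adjInd s r.1 ω * adjInd t r.2 ω := by
  have hpoint : ∑ r ∈ U.offDiag, (pathCount T R s r.1 ω * pathCount T R t r.2 ω -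
      (pathPairCount T R s s r.1 ω * pathCount T R t r.2 ω +
        pathCount T R s r.1 ω * pathPairCount T R t t r.2 ω)) ≤
      ∑ r ∈ U.offDiag, adjInd s r.1 ω * adjInd t r.2 ω := by
    refine Finset.sum_le_sum fun r hr => ?_
    obtain ⟨h₁, h₂, -⟩ := Finset.mem_offDiag.1 hr
    exact mul_sub_le_mul (adjInd_nonneg _ _ _) (adjInd_nonneg _ _ _) (pathCount_nonneg _ _ _ _ _)
      (pathCount_nonneg _ _ _ _ _) (pathPairCount_nonneg _ _ _ _ _ _)
      (pathPairCount_nonneg _ _ _ _ _ _) (pathCount_sub_le_adjInd T R (hs _ h₁).symm ω)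
      (pathCount_sub_le_adjInd T R (ht _ h₂).symm ω)
  rw [Finset.sum_sub_distrib, Finset.sum_add_distrib] at hpoint
  have hfst := sum_offDiag_mul_le (R := U) (fun u => pathPairCount_nonneg T R s s u ω)
    fun u => pathCount_nonneg T R t u ω
  have hsnd := sum_offDiag_mul_le (R := U) (fun u => pathCount_nonneg T R s u ω)
    fun u => pathPairCount_nonneg T R t t u ω
  linarith

end PathCounts

section StarCounts

/-- The number of items of `R` adjacent to all the actors `s`, `t` and `u`. -/
def starCount (T : Set ℝ≥0) (R : Finset ℕ) (s t u : ℕ) : Sample → ℝ :=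
  edgeCount T R fun i => path i s t ∪ path i s u

variable {T : Set ℝ≥0} {R U : Finset ℕ} {s t u : ℕ} {ω : Sample}

lemma path_union_path_comm (i s t u : ℕ) : path i s u ∪ path i t u = path i s t ∪ path i s u := by
  ext e
  simp only [path, Finset.mem_union, Finset.mem_insert, Finset.mem_singleton]
  tauto

lemma adjInd_mul_pathCount_mul_le (h : adjInd s t ω ≤ pathCount T R s t ω) :
    adjInd s t ω * (pathCount T R s u ω * pathCount T R t u ω) ≤
      starCount T R s t u ω + pathCount T R s t ω * pathPairCount T R s t u ω := by
  have hsum : pathCount T R s u ω * pathCount T R t u ω =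
      starCount T R s t u ω + pathPairCount T R s t u ω := by
    refine (sum_mul_sum_eq_diag_add_offDiag R _ _).trans ?_
    simp only [edgeInd_mul, path_union_path_comm]
    rfl
  rw [hsum, mul_add]
  exact add_le_add
    (mul_le_of_le_one_left (edgeCount_nonneg _ _ _ _) (adjInd_le_one s t ω))
    (mul_le_mul_of_nonneg_right h (pathPairCount_nonneg _ _ _ _ _ _))

lemma one_le_adjInd_mul_of_star {i : ℕ} (hst : s ≠ t) (hsu : s ≠ u) (htu : t ≠ u)
    (h : edgeInd T (path i s t ∪ path i s u) ω = 1) :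
    1 ≤ adjInd s t ω * (adjInd s u ω * adjInd t u ω) := by
  have hcyl := edgeInd_eq_one_iff.1 h
  have hpath : path i t u ⊆ path i s t ∪ path i s u := by
    rw [← path_union_path_comm]
    exact Finset.subset_union_right
  have hsub : ∀ {F}, F ⊆ path i s t ∪ path i s u → ω ∈ cylinder T F := fun hF e he => hcyl e (hF he)
  rw [adjInd_eq_one_of_mem_cylinder hst (hsub Finset.subset_union_left),
    adjInd_eq_one_of_mem_cylinder hsu (hsub Finset.subset_union_right),
    adjInd_eq_one_of_mem_cylinder htu (hsub hpath), one_mul, one_mul]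

lemma starCount_sub_le_adjInd_mul (hst : s ≠ t) (hsu : s ≠ u) (htu : t ≠ u) :
    starCount T R s t u ω - pathPairCount T R s s t ω * pathCount T R s u ω ≤
      adjInd s t ω * (adjInd s u ω * adjInd t u ω) := by
  have hbonf := sum_sub_sum_offDiag_le (R := R)
    (fun i => edgeInd_eq_zero_or_one T (path i s t ∪ path i s u) ω)
    (mul_nonneg (adjInd_nonneg s t ω) (mul_nonneg (adjInd_nonneg s u ω) (adjInd_nonneg t u ω)))
    fun i _ => one_le_adjInd_mul_of_star hst hsu htu
  have herr : ∑ r ∈ R.offDiag, edgeInd T (path r.1 s t ∪ path r.1 s u) ω *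
      edgeInd T (path r.2 s t ∪ path r.2 s u) ω ≤
      pathPairCount T R s s t ω * pathCount T R s u ω := by
    rw [pathPairCount, edgeCount, Finset.sum_mul]
    refine Finset.sum_le_sum fun r hr => ?_
    have hmem := (Finset.mem_offDiag.1 hr).1
    calc _ ≤ edgeInd T (path r.1 s t ∪ path r.1 s u) ω * edgeInd T (path r.2 s t) ω :=
          mul_le_mul_of_nonneg_left (edgeInd_anti Finset.subset_union_left ω) (edgeInd_nonneg _ _ _)
      _ = edgeInd T (path r.1 s t ∪ path r.2 s t) ω * edgeInd T (path r.1 s u) ω := by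
          rw [edgeInd_mul, edgeInd_mul, Finset.union_right_comm]
      _ ≤ _ := mul_le_mul_of_nonneg_left (Finset.single_le_sum
          (f := fun i => edgeInd T (path i s u) ω) (fun _ _ => edgeInd_nonneg _ _ _) hmem)
          (edgeInd_nonneg _ _ _)
  exact (sub_le_sub_left herr _).trans hbonf

end StarCounts

section Negligibility

open scoped Finset

/-- The law of the weights and of the bipartite graph for `τ(t) = t`. -/
abbrev linearLaw (a b : ℝ) (μX μY : Measure ℝ≥0) [IsProbabilityMeasure μX]
    [IsProbabilityMeasure μY] : Measure Sample :=
  law a b (fun t : ℕ => (t : ℝ)) μX μY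

/-- Families of configurations, indexed by `p`, for which the total kernel product is negligible
compared with `pairNorm`, whatever the constant multiplying the kernel. -/
def IsSparse (a b : ℝ) (l : Filter (ℕ × ℕ)) {ι : Type*} (Q : ℕ × ℕ → Finset ι)
    (F : ℕ × ℕ → ι → Finset (ℕ × ℕ)) : Prop :=
  ∀ c, 0 ≤ c → Tendsto (fun p => (∑ q ∈ Q p, kernProd a b c (F p q)) / pairNorm a b p) l (𝓝 0)

/-- Integrable random variables, indexed by `p`, with expectations negligible compared with
`pairNorm`. -/
structure IsNegligible (P : Measure Sample) (a b : ℝ) (l : Filter (ℕ × ℕ))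
    (E : ℕ × ℕ → Sample → ℝ) : Prop where
  integrable : ∀ p, Integrable (E p) P
  tendsto : Tendsto (fun p => (∫ ω, E p ω ∂P) / pairNorm a b p) l (𝓝 0)

/-- Configurations with at most three items and four actors in which each item is adjacent to one of
the actors `p.1`, `p.2`. -/
structure IsAnchored (p : ℕ × ℕ) (F : Finset (ℕ × ℕ)) : Prop where
  card_items : #(F.image Prod.fst) ≤ 3
  card_actors : #(F.image Prod.snd) ≤ 4
  joined : ∀ e ∈ F, (e.1, p.1) ∈ F ∨ (e.1, p.2) ∈ F

variable {a b : ℝ} {l : Filter (ℕ × ℕ)} {ι : Type*} {Q : ℕ × ℕ → Finset ι}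
  {F : ℕ × ℕ → ι → Finset (ℕ × ℕ)}

lemma isSparse_of_le {ε : ℝ → ℕ × ℕ → ℝ} (hl : IsPairFilter a b l)
    (hε : ∀ c, Tendsto (ε c) l (𝓝 0))
    (h : ∀ c, 0 ≤ c → ∀ᶠ p in l, ∑ q ∈ Q p, kernProd a b c (F p q) ≤ ε c p * pairNorm a b p) :
    IsSparse a b l Q F := by
  intro c hc
  refine squeeze_zero' (Eventually.of_forall fun p => div_nonneg
    (Finset.sum_nonneg fun _ _ => kernProd_nonneg hc _) (pairNorm_nonneg a b p)) ?_ (hε c)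
  filter_upwards [hl.pos, h c hc] with p hp hle
  exact (div_le_iff₀ hp).2 hle

lemma sum_kernProd_path_eq {p : ℕ × ℕ} (hp : p.1 ≠ p.2) (c : ℝ) :
    ∑ i ∈ reach a b p, kernProd a b c (path i p.1 p.2) = c ^ 2 * pairNorm a b p := by
  rw [pairNorm, Finset.mul_sum]
  exact Finset.sum_congr rfl fun i _ => kernProd_path hp

lemma tendsto_mul_div_end (hl : IsPairFilter a b l) {α : ℕ × ℕ → ℕ}
    (hα : α = Prod.fst ∨ α = Prod.snd) (C D : ℝ) :
    Tendsto (fun p => C * (D / α p)) l (𝓝 0) := by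
  simpa using (tendsto_const_nhds.div_atTop
    (tendsto_natCast_atTop_atTop.comp (hl.tendsto_end hα))).const_mul C

lemma isSparse_pathPair (ha : 0 < a) (hb : 0 ≤ b) (hl : IsPairFilter a b l) :
    IsSparse a b l (fun p => (reach a b p).offDiag)
      fun p r => path r.1 p.1 p.2 ∪ path r.2 p.1 p.2 := by
  refine isSparse_of_le hl (ε := fun c p => c ^ 2 * (c ^ 2 * kernBound a b) * ((√a)⁻¹ / p.2))
    (fun c => tendsto_mul_div_end hl (Or.inr rfl) _ _) fun c hc => ?_
  filter_upwards [hl.ne] with p hp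
  refine (sum_kernProd_path_union_path_le ha hb hc hp _).trans_eq ?_
  rw [sum_kernProd_path_eq hp]
  ring

lemma isSparse_path_cycle (ha : 0 < a) (hb : 0 < b) (hl : IsPairFilter a b l) {α β : ℕ × ℕ → ℕ}
    (hα : α = Prod.fst ∨ α = Prod.snd) (hβ : β = Prod.fst ∨ β = Prod.snd) :
    IsSparse a b l (fun p => reach a b p ×ˢ ((reach a b p).offDiag ×ˢ others a b p))
      fun p q => path q.1 p.1 p.2 ∪
        (path q.2.1.1 (α p) q.2.2 ∪ path q.2.1.2 (β p) q.2.2) := by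
  refine isSparse_of_le hl (ε := fun c p => c ^ 2 * (2 + 1 + c * kernBound a b) ^ 2 *
    (c ^ 2 * kernBound a b) * (√b / a / β p))
    (fun c => tendsto_mul_div_end hl hβ _ _) fun c hc => ?_
  filter_upwards [hl.ne] with p hp
  simp only [Finset.sum_product (reach a b p), Finset.sum_product _ (others a b p)]
  have hothers : ∀ i, ∀ u ∈ others a b p,
      u ≠ α p ∧ u ≠ β p ∧ ∀ e ∈ path i p.1 p.2, e.2 ≠ u := fun i u hu => by
    obtain ⟨-, h₁, h₂⟩ := mem_others.1 hu
    refine ⟨?_, ?_, by simp [path, h₁.symm, h₂.symm]⟩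
    · rcases end_eq_or_eq hα p with h | h <;> rwa [h]
    · rcases end_eq_or_eq hβ p with h | h <;> rwa [h]
  refine (Finset.sum_le_sum fun i _ => sum_kernProd_union_cycle_le ha hb hc (card_path_le i p.1 p.2)
    (reach a b p) (hothers i)).trans_eq ?_
  rw [← Finset.mul_sum, ← Finset.mul_sum, sum_kernProd_path_eq hp, div_div]
  push_cast
  ring

lemma IsSparse.union_path (hF : IsSparse a b l Q F) (ha : 0 < a) (hb : 0 < b) {m : ℕ}
    (hm : ∀ p q, #(F p q) ≤ m) (α : ℕ × ℕ → ℕ) :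
    IsSparse a b l (fun p => Q p ×ˢ (reach a b p ×ˢ others a b p))
      fun p q => F p q.1 ∪ path q.2.1 (α p) q.2.2 := by
  intro c hc
  refine squeeze_zero (fun p => div_nonneg (Finset.sum_nonneg fun _ _ => kernProd_nonneg hc _)
    (pairNorm_nonneg a b p)) (fun p => ?_)
    (by simpa using (hF c hc).const_mul ((m + 1 + c * kernBound a b) ^ 2))
  rw [← mul_div_assoc, Finset.mul_sum, Finset.sum_product]
  refine div_le_div_of_nonneg_right (Finset.sum_le_sum fun q _ => ?_) (pairNorm_nonneg a b p)
  rw [Finset.sum_product]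
  exact sum_kernProd_union_path_le ha hb hc (hm p q) (α p) _ _

lemma IsNegligible.add {P : Measure Sample} {E E' : ℕ × ℕ → Sample → ℝ}
    (h : IsNegligible P a b l E) (h' : IsNegligible P a b l E') :
    IsNegligible P a b l fun p => E p + E' p where
  integrable p := (h.integrable p).add (h'.integrable p)
  tendsto := by
    simpa only [integral_add' (h.integrable _) (h'.integrable _), add_div, add_zero]
      using h.tendsto.add h'.tendsto

lemma itemDeg_le_card_actors (F : Finset (ℕ × ℕ)) (i : ℕ) :
    itemDeg F i ≤ #(F.image Prod.snd) := by
  refine Finset.card_le_card_of_injOn Prod.snd (fun e he => ?_) fun e he e' he' hee => ?_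
  · exact Finset.mem_image_of_mem _ (Finset.mem_filter.1 he).1
  · exact Prod.ext ((Finset.mem_filter.1 he).2.trans (Finset.mem_filter.1 he').2.symm) hee

lemma actorDeg_le_card_items (F : Finset (ℕ × ℕ)) (j : ℕ) :
    actorDeg F j ≤ #(F.image Prod.fst) := by
  refine Finset.card_le_card_of_injOn Prod.fst (fun e he => ?_) fun e he e' he' hee => ?_
  · exact Finset.mem_image_of_mem _ (Finset.mem_filter.1 he).1
  · exact Prod.ext hee ((Finset.mem_filter.1 he).2.trans (Finset.mem_filter.1 he').2.symm)

lemma isAnchored_path_union_path_union_path {p : ℕ × ℕ} {s t : ℕ} (hs : s = p.1 ∨ s = p.2)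
    (ht : t = p.1 ∨ t = p.2) (i j k u v : ℕ) :
    IsAnchored p (path i p.1 p.2 ∪ (path j s u ∪ path k t v)) where
  card_items := by
    have himage : (path i p.1 p.2 ∪ (path j s u ∪ path k t v)).image Prod.fst ⊆ {i, j, k} := by
      simp only [path, Finset.image_union, Finset.image_insert, Finset.image_singleton]
      grind
    exact (Finset.card_le_card himage).trans Finset.card_le_three
  card_actors := by
    have himage :
        (path i p.1 p.2 ∪ (path j s u ∪ path k t v)).image Prod.snd ⊆ {p.1, p.2, u, v} := by
      simp only [path, Finset.image_union, Finset.image_insert, Finset.image_singleton]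
      grind
    exact (Finset.card_le_card himage).trans Finset.card_le_four
  joined e := by
    simp only [path, Finset.mem_union, Finset.mem_insert, Finset.mem_singleton]
    rintro ((rfl | rfl) | (rfl | rfl) | rfl | rfl) <;> grind

lemma isAnchored_path_union_path {p : ℕ × ℕ} {s : ℕ} (hs : s = p.1 ∨ s = p.2) (i j u : ℕ) :
    IsAnchored p (path i p.1 p.2 ∪ path j s u) := by
  simpa using isAnchored_path_union_path_union_path hs hs i j j u u

lemma isAnchored_path (p : ℕ × ℕ) (i : ℕ) : IsAnchored p (path i p.1 p.2) := by
  simpa using isAnchored_path_union_path (p := p) (Or.inl rfl) i i p.2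

end Negligibility

section Expectations

open scoped Finset

variable {a b : ℝ} {μX μY : Measure ℝ≥0} [IsProbabilityMeasure μX] [IsProbabilityMeasure μY]
  {l : Filter (ℕ × ℕ)} {ι : Type*} {Q : ℕ × ℕ → Finset ι} {F : ℕ × ℕ → ι → Finset (ℕ × ℕ)}

lemma integrable_pow_of_le {μ : Measure ℝ≥0} [IsFiniteMeasure μ] {n k : ℕ}
    (h : Integrable (fun x : ℝ≥0 => (x : ℝ) ^ n) μ) (hk : k ≤ n) :
    Integrable (fun x : ℝ≥0 => (x : ℝ) ^ k) μ := by
  refine ((integrable_const (1 : ℝ)).add h).mono' (by fun_prop) (ae_of_all _ fun x => ?_)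
  rw [Real.norm_of_nonneg (by positivity), Pi.add_apply]
  rcases le_total (x : ℝ) 1 with hx | hx
  · exact (pow_le_one₀ x.2 hx).trans (le_add_of_nonneg_right (by positivity))
  · exact (pow_le_pow_right₀ hx hk).trans (le_add_of_nonneg_left zero_le_one)

lemma wmoment_nonneg (μ : Measure ℝ≥0) (k : ℕ) : 0 ≤ wmoment μ k :=
  integral_nonneg fun x => by positivity

lemma exists_wmoment_le_pow (μ : Measure ℝ≥0) [IsProbabilityMeasure μ] (n : ℕ) :
    ∃ B : ℝ, 0 ≤ B ∧ ∀ k ≤ n, wmoment μ k ≤ B ^ k := by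
  have hsum : 0 ≤ ∑ k ∈ Finset.range (n + 1), wmoment μ k :=
    Finset.sum_nonneg fun k _ => wmoment_nonneg μ k
  refine ⟨1 + ∑ k ∈ Finset.range (n + 1), wmoment μ k, by positivity, fun k hk => ?_⟩
  rcases eq_or_ne k 0 with rfl | hk0
  · simp [wmoment]
  · calc wmoment μ k ≤ ∑ k ∈ Finset.range (n + 1), wmoment μ k :=
          Finset.single_le_sum (fun k _ => wmoment_nonneg μ k)
            (Finset.mem_range.2 (Nat.lt_succ_of_le hk))
      _ ≤ 1 + ∑ k ∈ Finset.range (n + 1), wmoment μ k := le_add_of_nonneg_left zero_le_one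
      _ ≤ _ := le_self_pow₀ (le_add_of_nonneg_right hsum) hk0

lemma IsAnchored.law_real_le_edgeWeight {p : ℕ × ℕ} {F : Finset (ℕ × ℕ)} (hF : IsAnchored p F)
    (hX : Integrable (fun x : ℝ≥0 => (x : ℝ) ^ 4) μX)
    (hY : Integrable (fun y : ℝ≥0 => (y : ℝ) ^ 3) μY) :
    (linearLaw a b μX μY).real (cylinder Set.univ F) ≤
      edgeWeight (kern a b) (wmoment μX) (wmoment μY) F := by
  rw [← funext (truncMoment_univ μX), ← funext (truncMoment_univ μY)]
  refine law_real_cylinder_le MeasurableSet.univ F (fun i => ?_) fun j => ?_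
  · simpa using integrable_pow_of_le hX ((itemDeg_le_card_actors F i).trans hF.card_actors)
  · simpa using integrable_pow_of_le hY ((actorDeg_le_card_items F j).trans hF.card_items)

lemma IsAnchored.edgeWeight_le_law_real {p : ℕ × ℕ} {F : Finset (ℕ × ℕ)}
    (hF : IsAnchored p F) (ha : 0 < a) (hb : 0 < b) {M : ℝ≥0}
    (hM : ∀ s : ℕ, s = p.1 ∨ s = p.2 → (M : ℝ) ^ 4 ≤ a ^ 2 / b * s ^ 2) :
    edgeWeight (kern a b) (truncMoment (Set.Iic M) μX) (truncMoment (Set.Iic M) μY) F ≤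
      (linearLaw a b μX μY).real (cylinder (Set.Iic M) F) := by
  by_cases hkern : ∃ e ∈ F, kern a b e.1 e.2 = 0
  · obtain ⟨e, he, h0⟩ := hkern
    rw [edgeWeight, Finset.prod_eq_zero he h0, zero_mul, zero_mul]
    exact measureReal_nonneg
  push Not at hkern
  refine edgeWeight_le_law_real_cylinder_Iic F fun e he => ?_
  obtain ⟨s, hs, hsF⟩ : ∃ s, (s = p.1 ∨ s = p.2) ∧ (e.1, s) ∈ F := by
    rcases hF.joined e he with h | h
    exacts [⟨_, Or.inl rfl, h⟩, ⟨_, Or.inr rfl, h⟩]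
  have hitem : a * s ≤ e.1 := (bounds_of_kern_ne_zero (hkern _ hsF)).1
  have hactor : (e.1 : ℝ) ≤ b * e.2 := (bounds_of_kern_ne_zero (hkern _ he)).2.1
  calc (M : ℝ) ^ 4 ≤ a ^ 2 / b * s ^ 2 := hM s hs
    _ = a * s * (a * s / b) := by ring
    _ ≤ e.1 * e.2 := by
      have : a * s / b ≤ e.2 := (div_le_iff₀' hb).2 (hitem.trans hactor)
      gcongr

lemma IsPairFilter.eventually_le_mul_sq (hl : IsPairFilter a b l) {c : ℝ} (hc : 0 < c) (C : ℝ) :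
    ∀ᶠ p in l, ∀ s : ℕ, s = p.1 ∨ s = p.2 → C ≤ c * s ^ 2 := by
  have hlarge : ∀ᶠ n : ℕ in atTop, C ≤ c * (n : ℝ) ^ 2 :=
    (((tendsto_pow_atTop two_ne_zero).comp tendsto_natCast_atTop_atTop).const_mul_atTop
      hc).eventually_ge_atTop C
  filter_upwards [hl.fst.eventually hlarge, hl.snd.eventually hlarge] with p h₁ h₂ s hs
  rcases hs with rfl | rfl <;> assumption

lemma isNegligible_zero {P : Measure Sample} : IsNegligible P a b l fun _ _ => 0 where
  integrable _ := integrable_zero _ _ _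
  tendsto := by simp [tendsto_const_nhds]

lemma IsSparse.isNegligible_of_le (hF : IsSparse a b l Q F) {P : Measure Sample}
    [IsFiniteMeasure P] {T : Set ℝ≥0} (hT : MeasurableSet T) {c : ℝ} (hc : 0 ≤ c)
    (h : ∀ p q, P.real (cylinder T (F p q)) ≤ kernProd a b c (F p q)) :
    IsNegligible P a b l fun p => edgeCount T (Q p) (F p) where
  integrable p := integrable_edgeCount hT _ _
  tendsto := by
    simp only [integral_edgeCount hT]
    exact squeeze_zero (fun p => div_nonneg (Finset.sum_nonneg fun _ _ => measureReal_nonneg)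
      (pairNorm_nonneg a b p)) (fun p => div_le_div_of_nonneg_right
        (Finset.sum_le_sum fun q _ => h p q) (pairNorm_nonneg a b p)) (hF c hc)

lemma IsSparse.isNegligible_Iic (hF : IsSparse a b l Q F) (M : ℝ≥0) :
    IsNegligible (linearLaw a b μX μY) a b l fun p => edgeCount (Set.Iic M) (Q p) (F p) :=
  hF.isNegligible_of_le measurableSet_Iic (c := (M : ℝ) ^ 2) (by positivity) fun _ _ =>
    law_real_cylinder_Iic_le M _

lemma IsSparse.isNegligible_univ (hF : IsSparse a b l Q F) (hanch : ∀ p q, IsAnchored p (F p q))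
    (hX : Integrable (fun x : ℝ≥0 => (x : ℝ) ^ 4) μX)
    (hY : Integrable (fun y : ℝ≥0 => (y : ℝ) ^ 3) μY) :
    IsNegligible (linearLaw a b μX μY) a b l fun p => edgeCount Set.univ (Q p) (F p) := by
  obtain ⟨B, hB, hXB⟩ := exists_wmoment_le_pow μX 4
  obtain ⟨C, -, hYC⟩ := exists_wmoment_le_pow μY 3
  have hC : 0 ≤ C := by simpa using (wmoment_nonneg μY 1).trans (hYC 1 (by norm_num))
  refine hF.isNegligible_of_le MeasurableSet.univ (c := max B C ^ 2) (by positivity) fun p q => ?_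
  refine ((hanch p q).law_real_le_edgeWeight hX hY).trans
    (edgeWeight_le_prod (kern_nonneg a b) (wmoment_nonneg μX) (wmoment_nonneg μY) _
      (fun i => ?_) fun j => ?_)
  · exact (hXB _ ((itemDeg_le_card_actors _ i).trans (hanch p q).card_actors)).trans
      (pow_le_pow_left₀ hB (le_max_left B C) _)
  · exact (hYC _ ((actorDeg_le_card_items _ j).trans (hanch p q).card_items)).trans
      (pow_le_pow_left₀ hC (le_max_right B C) _)

lemma tendsto_truncMoment_Iic {μ : Measure ℝ≥0} [IsFiniteMeasure μ] {k : ℕ}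
    (h : Integrable (fun x : ℝ≥0 => (x : ℝ) ^ k) μ) :
    Tendsto (fun M : ℕ => truncMoment (Set.Iic (M : ℝ≥0)) μ k) atTop (𝓝 (wmoment μ k)) := by
  refine tendsto_integral_of_dominated_convergence (fun x : ℝ≥0 => (x : ℝ) ^ k)
    (fun M => ?_) h (fun M => ae_of_all _ fun x => ?_) (ae_of_all _ fun x => ?_)
  · exact (integrable_indicator_Iic_pow μ _ k).aestronglyMeasurable
  · rw [Real.norm_of_nonneg (by positivity)]
    refine pow_le_pow_left₀ (by positivity) ?_ _
    exact_mod_cast Set.indicator_le_self' (f := id) (fun _ _ => zero_le) x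
  · obtain ⟨N, hN⟩ := exists_nat_ge x
    refine tendsto_const_nhds.congr' ?_
    filter_upwards [eventually_ge_atTop N] with M hM
    have hx : x ∈ Set.Iic (M : ℝ≥0) := hN.trans (by exact_mod_cast hM)
    rw [Set.indicator_of_mem hx]
    rfl

lemma tendsto_of_lower_bounds {X : Type*} {l : Filter X} {E U : X → ℝ} {L : ℕ → X → ℝ}
    {c : ℕ → ℝ} {C : ℝ} (hU : Tendsto U l (𝓝 C)) (hEU : ∀ x, E x ≤ U x)
    (hL : ∀ M, Tendsto (L M) l (𝓝 (c M))) (hLE : ∀ M, ∀ᶠ x in l, L M x ≤ E x)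
    (hc : Tendsto c atTop (𝓝 C)) : Tendsto E l (𝓝 C) := by
  refine tendsto_order.2 ⟨fun y hy => ?_, fun y hy => ?_⟩
  · obtain ⟨M, hM⟩ := (hc.eventually_const_lt hy).exists
    filter_upwards [(hL M).eventually_const_lt hM, hLE M] with x h₁ h₂ using h₁.trans_le h₂
  · filter_upwards [hU.eventually_lt_const hy] with x hx using (hEU x).trans_lt hx

/-- The upper bound uses the full weights; the lower bounds use the weights truncated at `M`, for
which the edge probabilities are eventually not capped, and `M → ∞` afterwards. -/
lemma tendsto_integral_of_edgeCount_bounds (ha : 0 < a) (hb : 0 < b)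
    (hX : Integrable (fun x : ℝ≥0 => (x : ℝ) ^ 4) μX)
    (hY : Integrable (fun y : ℝ≥0 => (y : ℝ) ^ 3) μY) (hl : IsPairFilter a b l)
    (hF : ∀ p q, IsAnchored p (F p q)) {φ : (ℕ → ℝ) → (ℕ → ℝ) → ℝ}
    (hlim : ∀ mX mY, Tendsto (fun p => (∑ q ∈ Q p, edgeWeight (kern a b) mX mY (F p q)) /
      pairNorm a b p) l (𝓝 (φ mX mY)))
    (hφ : Tendsto (fun M : ℕ => φ (truncMoment (Set.Iic (M : ℝ≥0)) μX)
      (truncMoment (Set.Iic (M : ℝ≥0)) μY)) atTop (𝓝 (φ (wmoment μX) (wmoment μY))))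
    {Z U : ℕ × ℕ → Sample → ℝ} (hZ : ∀ p, Integrable (Z p) (linearLaw a b μX μY))
    (hU : IsNegligible (linearLaw a b μX μY) a b l U)
    (hZU : ∀ p, ∀ᵐ ω ∂linearLaw a b μX μY, Z p ω ≤ edgeCount Set.univ (Q p) (F p) ω + U p ω)
    {L : ℝ≥0 → ℕ × ℕ → Sample → ℝ} (hL : ∀ M, IsNegligible (linearLaw a b μX μY) a b l (L M))
    (hLZ : ∀ M, ∀ᶠ p in l, ∀ ω, edgeCount (Set.Iic M) (Q p) (F p) ω - L M p ω ≤ Z p ω) :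
    Tendsto (fun p => (∫ ω, Z p ω ∂linearLaw a b μX μY) / pairNorm a b p) l
      (𝓝 (φ (wmoment μX) (wmoment μY))) := by
  have hint {T} (hT : MeasurableSet T) (p) :
      Integrable (edgeCount T (Q p) (F p)) (linearLaw a b μX μY) := integrable_edgeCount hT _ _
  refine tendsto_of_lower_bounds (by simpa using (hlim (wmoment μX) (wmoment μY)).add hU.tendsto)
    (fun p => ?_) (fun M : ℕ => (hlim _ _).sub (hL M).tendsto) (fun M => ?_) (by simpa using hφ)
  · rw [← add_div]
    refine div_le_div_of_nonneg_right ?_ (pairNorm_nonneg a b p)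
    calc ∫ ω, Z p ω ∂linearLaw a b μX μY
        ≤ ∫ ω, edgeCount Set.univ (Q p) (F p) ω + U p ω ∂linearLaw a b μX μY :=
          integral_mono_ae (hZ p) ((hint .univ p).add (hU.integrable p)) (hZU p)
      _ = ∑ q ∈ Q p, (linearLaw a b μX μY).real (cylinder Set.univ (F p q)) +
          ∫ ω, U p ω ∂linearLaw a b μX μY := by
        rw [integral_add (hint .univ p) (hU.integrable p), integral_edgeCount .univ]
      _ ≤ _ := by
        gcongr with q
        exact (hF p q).law_real_le_edgeWeight hX hY
  · filter_upwards [hLZ M, hl.eventually_le_mul_sq (c := a ^ 2 / b) (by positivity)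
      (((M : ℝ≥0) : ℝ) ^ 4)] with p hp hM
    rw [← sub_div]
    refine div_le_div_of_nonneg_right ?_ (pairNorm_nonneg a b p)
    calc _ ≤ ∑ q ∈ Q p, (linearLaw a b μX μY).real (cylinder (Set.Iic (M : ℝ≥0)) (F p q)) -
          ∫ ω, L M p ω ∂linearLaw a b μX μY := by
          gcongr with q
          exact (hF p q).edgeWeight_le_law_real ha hb hM
      _ = ∫ ω, edgeCount (Set.Iic (M : ℝ≥0)) (Q p) (F p) ω - L M p ω ∂linearLaw a b μX μY := by
        rw [integral_sub (hint measurableSet_Iic p) ((hL M).integrable p),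
          integral_edgeCount measurableSet_Iic]
      _ ≤ _ := integral_mono ((hint measurableSet_Iic p).sub ((hL M).integrable p)) (hZ p) hp

end Expectations

section AdjacencyMoments

open scoped Finset

/-- The number of actors of `others a b p` adjacent to `v_s`. -/
def otherDeg (a b : ℝ) (p : ℕ × ℕ) (s : ℕ) (ω : Sample) : ℝ := ∑ u ∈ others a b p, adjInd s u ω

/-- The number of paths of length two from the actor `s` to `others a b p`. -/
def stepCount (T : Set ℝ≥0) (a b : ℝ) (p : ℕ × ℕ) (s : ℕ) : Sample → ℝ :=
  edgeCount T (reach a b p ×ˢ others a b p) fun q => path q.1 s q.2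

/-- The number of pairs of paths of length two through distinct items from the actors `s` and `t` to
a common actor of `others a b p`. -/
def cycleCount (T : Set ℝ≥0) (a b : ℝ) (p : ℕ × ℕ) (s t : ℕ) : Sample → ℝ :=
  edgeCount T ((reach a b p).offDiag ×ˢ others a b p) fun q => path q.1.1 s q.2 ∪ path q.1.2 t q.2

/-- The number of pairs of paths of length two, from the actor `s` and from the actor `t` to two
distinct actors of `others a b p`. -/
def stepPairCount (T : Set ℝ≥0) (a b : ℝ) (p : ℕ × ℕ) (s t : ℕ) : Sample → ℝ :=
  edgeCount T ((reach a b p ×ˢ reach a b p) ×ˢ (others a b p).offDiag)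
    fun q => path q.1.1 s q.2.1 ∪ path q.1.2 t q.2.2

/-- The number of actors of `others a b p` adjacent to both `v_s` and `v_t`. -/
def commonDeg (a b : ℝ) (p : ℕ × ℕ) (s t : ℕ) (ω : Sample) : ℝ :=
  ∑ u ∈ others a b p, adjInd s u ω * adjInd t u ω

/-- The number of pairs of distinct actors of `others a b p`, the first of them adjacent to `v_s`
and the second one adjacent to `v_t`. -/
def distinctDeg (a b : ℝ) (p : ℕ × ℕ) (s t : ℕ) (ω : Sample) : ℝ :=
  ∑ r ∈ (others a b p).offDiag, adjInd s r.1 ω * adjInd t r.2 ω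

variable {a b : ℝ} {μX μY : Measure ℝ≥0} [IsProbabilityMeasure μX] [IsProbabilityMeasure μY]
  {l : Filter (ℕ × ℕ)} {T : Set ℝ≥0} {p : ℕ × ℕ} {s t : ℕ} {ω : Sample} {α β : ℕ × ℕ → ℕ}

lemma stepCount_nonneg (T : Set ℝ≥0) (a b : ℝ) (p : ℕ × ℕ) (s : ℕ) (ω : Sample) :
    0 ≤ stepCount T a b p s ω := edgeCount_nonneg _ _ _ _

lemma cycleCount_nonneg (T : Set ℝ≥0) (a b : ℝ) (p : ℕ × ℕ) (s t : ℕ) (ω : Sample) :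
    0 ≤ cycleCount T a b p s t ω := edgeCount_nonneg _ _ _ _

lemma stepPairCount_nonneg (T : Set ℝ≥0) (a b : ℝ) (p : ℕ × ℕ) (s t : ℕ) (ω : Sample) :
    0 ≤ stepPairCount T a b p s t ω := edgeCount_nonneg _ _ _ _

lemma stepPairCount_eq_sum (T : Set ℝ≥0) (a b : ℝ) (p : ℕ × ℕ) (s t : ℕ) (ω : Sample) :
    stepPairCount T a b p s t ω = ∑ r ∈ (others a b p).offDiag,
      pathCount T (reach a b p) s r.1 ω * pathCount T (reach a b p) t r.2 ω := by
  refine (edgeCount_product _ _ _ _ _).trans (Finset.sum_congr rfl fun r _ => ?_)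
  rw [pathCount, pathCount, ← Pi.mul_apply, edgeCount_mul]

lemma stepCount_eq_sum (T : Set ℝ≥0) (a b : ℝ) (p : ℕ × ℕ) (s : ℕ) (ω : Sample) :
    stepCount T a b p s ω = ∑ u ∈ others a b p, pathCount T (reach a b p) s u ω :=
  edgeCount_product _ _ _ _ _

lemma cycleCount_eq_sum (T : Set ℝ≥0) (a b : ℝ) (p : ℕ × ℕ) (s t : ℕ) (ω : Sample) :
    cycleCount T a b p s t ω = ∑ u ∈ others a b p, pathPairCount T (reach a b p) s t u ω :=
  edgeCount_product _ _ _ _ _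

lemma ne_of_mem_others {u : ℕ} (hu : u ∈ others a b p) (hs : s = p.1 ∨ s = p.2) : u ≠ s := by
  obtain ⟨-, h₁, h₂⟩ := mem_others.1 hu
  rcases hs with rfl | rfl <;> assumption

lemma otherDeg_nonneg (a b : ℝ) (p : ℕ × ℕ) (s : ℕ) (ω : Sample) : 0 ≤ otherDeg a b p s ω :=
  Finset.sum_nonneg fun _ _ => adjInd_nonneg _ _ _

lemma stepCount_sub_cycleCount_le (T : Set ℝ≥0) (hs : s = p.1 ∨ s = p.2) (ω : Sample) :
    stepCount T a b p s ω - cycleCount T a b p s s ω ≤ otherDeg a b p s ω := by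
  rw [stepCount_eq_sum, cycleCount_eq_sum]
  exact sum_sub_sum_le_sum_adjInd fun u hu => ne_of_mem_others hu hs

lemma ae_adjInd_le_pathCount (ha : 0 < a) (hab : a < b) (p : ℕ × ℕ) :
    ∀ᵐ ω ∂linearLaw a b μX μY, ∀ s u, s = p.1 ∨ s = p.2 →
      adjInd s u ω ≤ pathCount Set.univ (reach a b p) s u ω := by
  filter_upwards [ae_edgeKernel_ne_zero] with ω hω s u hs
  exact adjInd_le_pathCount fun i hi => item_mem_reach ha hab hs (hω (i, s) hi)

lemma isNegligible_pathPairCount (ha : 0 < a) (hb : 0 ≤ b) (hl : IsPairFilter a b l) (M : ℝ≥0) :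
    IsNegligible (linearLaw a b μX μY) a b l fun p =>
      pathPairCount (Set.Iic M) (reach a b p) p.1 p.1 p.2 :=
  (isSparse_pathPair ha hb hl).isNegligible_Iic M

lemma card_path_union_path_le (i j s t u v : ℕ) : #(path i s t ∪ path j u v) ≤ 4 :=
  (Finset.card_union_le _ _).trans (add_le_add (card_path_le i s t) (card_path_le j u v))

lemma isNegligible_pathPairCount_mul_stepCount (ha : 0 < a) (hb : 0 < b) (hl : IsPairFilter a b l)
    (α : ℕ × ℕ → ℕ) (M : ℝ≥0) :
    IsNegligible (linearLaw a b μX μY) a b l fun p =>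
      pathPairCount (Set.Iic M) (reach a b p) p.1 p.1 p.2 *
        stepCount (Set.Iic M) a b p (α p) := by
  have hsparse := (isSparse_pathPair ha hb.le hl).union_path ha hb
    (fun p r => card_path_union_path_le r.1 r.2 p.1 p.2 p.1 p.2) α
  convert hsparse.isNegligible_Iic M using 3
  exact edgeCount_mul _ _ _ _ _

lemma isNegligible_pathPairCount_mul_stepCount_mul_stepCount (ha : 0 < a) (hb : 0 < b)
    (hl : IsPairFilter a b l) (α β : ℕ × ℕ → ℕ) (M : ℝ≥0) :
    IsNegligible (linearLaw a b μX μY) a b l fun p =>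
      pathPairCount (Set.Iic M) (reach a b p) p.1 p.1 p.2 *
        stepCount (Set.Iic M) a b p (α p) * stepCount (Set.Iic M) a b p (β p) := by
  have hsparse := ((isSparse_pathPair ha hb.le hl).union_path ha hb
    (fun p r => card_path_union_path_le r.1 r.2 p.1 p.2 p.1 p.2) α).union_path ha hb
    (fun p q => (Finset.card_union_le _ _).trans
      (add_le_add (card_path_union_path_le _ _ _ _ _ _) (card_path_le _ _ _))) β
  convert hsparse.isNegligible_Iic M using 3
  simp only [pathPairCount, stepCount, edgeCount_mul]

lemma isNegligible_pathCount_mul_cycleCount (ha : 0 < a) (hb : 0 < b) (hl : IsPairFilter a b l)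
    (hα : α = Prod.fst ∨ α = Prod.snd) (M : ℝ≥0) :
    IsNegligible (linearLaw a b μX μY) a b l fun p =>
      pathCount (Set.Iic M) (reach a b p) p.1 p.2 * cycleCount (Set.Iic M) a b p (α p) (α p) := by
  convert (isSparse_path_cycle ha hb hl hα hα).isNegligible_Iic M using 3
  exact edgeCount_mul _ _ _ _ _

lemma isNegligible_pathCount_mul_cycleCount_mul_stepCount (ha : 0 < a) (hb : 0 < b)
    (hl : IsPairFilter a b l) (hα : α = Prod.fst ∨ α = Prod.snd) (β : ℕ × ℕ → ℕ) (M : ℝ≥0) :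
    IsNegligible (linearLaw a b μX μY) a b l fun p =>
      pathCount (Set.Iic M) (reach a b p) p.1 p.2 * cycleCount (Set.Iic M) a b p (α p) (α p) *
        stepCount (Set.Iic M) a b p (β p) := by
  have hsparse := (isSparse_path_cycle ha hb hl hα hα).union_path ha hb
    (fun p q => (Finset.card_union_le _ _).trans
      (add_le_add (card_path_le _ _ _) (card_path_union_path_le _ _ _ _ _ _))) β
  convert hsparse.isNegligible_Iic M using 3
  simp only [pathCount, cycleCount, stepCount, edgeCount_mul]

lemma isNegligible_pathCount_mul_cycleCount_univ (ha : 0 < a) (hb : 0 < b)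
    (hX : Integrable (fun x : ℝ≥0 => (x : ℝ) ^ 4) μX)
    (hY : Integrable (fun y : ℝ≥0 => (y : ℝ) ^ 3) μY) (hl : IsPairFilter a b l) :
    IsNegligible (linearLaw a b μX μY) a b l fun p =>
      pathCount Set.univ (reach a b p) p.1 p.2 * cycleCount Set.univ a b p p.1 p.2 := by
  convert (isSparse_path_cycle ha hb hl (Or.inl rfl) (Or.inr rfl)).isNegligible_univ
    (fun p q => isAnchored_path_union_path_union_path (Or.inl rfl) (Or.inr rfl) _ _ _ _ _)
    hX hY using 3
  exact edgeCount_mul _ _ _ _ _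

lemma tendsto_truncMoment_of_le {μ : Measure ℝ≥0} [IsFiniteMeasure μ] {n k : ℕ}
    (h : Integrable (fun x : ℝ≥0 => (x : ℝ) ^ n) μ) (hk : k ≤ n) :
    Tendsto (fun M : ℕ => truncMoment (Set.Iic (M : ℝ≥0)) μ k) atTop (𝓝 (wmoment μ k)) :=
  tendsto_truncMoment_Iic (integrable_pow_of_le h hk)

lemma tendsto_integral_adjInd (ha : 0 < a) (hab : a < b)
    (hX : Integrable (fun x : ℝ≥0 => (x : ℝ) ^ 4) μX)
    (hY : Integrable (fun y : ℝ≥0 => (y : ℝ) ^ 3) μY) (hl : IsPairFilter a b l) :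
    Tendsto (fun p => (∫ ω, adjInd p.1 p.2 ω ∂linearLaw a b μX μY) / pairNorm a b p) l
      (𝓝 (h₁ μX μY)) := by
  have hb := ha.trans hab
  refine tendsto_integral_of_edgeCount_bounds (Q := reach a b) ha hb hX hY hl isAnchored_path
    (φ := fun mX mY => mX 2 * mY 1 ^ 2) (fun mX mY => tendsto_pathSum mX mY hl)
    ((tendsto_truncMoment_of_le hX (by norm_num)).mul
      ((tendsto_truncMoment_of_le hY (by norm_num)).pow 2))
    (fun p => integrable_adjInd _ _) isNegligible_zero (fun p => ?_)
    (isNegligible_pathPairCount ha hb.le hl) fun M => ?_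
  · filter_upwards [ae_adjInd_le_pathCount ha hab p] with ω hω
    exact (hω _ _ (Or.inl rfl)).trans_eq (add_zero _).symm
  · filter_upwards [hl.ne] with p hp ω using pathCount_sub_le_adjInd _ _ hp ω

lemma pathCount_mul_stepCount (T : Set ℝ≥0) (a b : ℝ) (p : ℕ × ℕ) (s : ℕ) :
    pathCount T (reach a b p) p.1 p.2 * stepCount T a b p s =
      edgeCount T (reach a b p ×ˢ (reach a b p ×ˢ others a b p))
        fun q => path q.1 p.1 p.2 ∪ path q.2.1 s q.2.2 := by
  rw [pathCount, stepCount, edgeCount_mul]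

lemma adjInd_mul_otherDeg_le (h : ∀ s u, s = p.1 ∨ s = p.2 →
      adjInd s u ω ≤ pathCount T (reach a b p) s u ω) (hs : s = p.1 ∨ s = p.2) :
    adjInd p.1 p.2 ω * otherDeg a b p s ω ≤
      pathCount T (reach a b p) p.1 p.2 ω * stepCount T a b p s ω := by
  rw [stepCount_eq_sum]
  exact mul_le_mul (h _ _ (Or.inl rfl)) (Finset.sum_le_sum fun u _ => h _ _ hs)
    (otherDeg_nonneg _ _ _ _ _) (pathCount_nonneg _ _ _ _ _)

lemma integrable_otherDeg {P : Measure Sample} [IsFiniteMeasure P] (s : ℕ) :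
    Integrable (otherDeg a b p s) P :=
  integrable_finsetSum _ fun _ _ => integrable_adjInd _ _

lemma tendsto_integral_adjInd_mul_otherDeg (ha : 0 < a) (hab : a < b)
    (hX : Integrable (fun x : ℝ≥0 => (x : ℝ) ^ 4) μX)
    (hY : Integrable (fun y : ℝ≥0 => (y : ℝ) ^ 3) μY) (hl : IsPairFilter a b l) :
    Tendsto (fun p => (∫ ω, adjInd p.1 p.2 ω * otherDeg a b p p.1 ω ∂linearLaw a b μX μY) /
      pairNorm a b p) l (𝓝 (h₂ a b μX μY + 2 * h₃ a b μX μY)) := by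
  have hb := ha.trans hab
  have hval : h₂ a b μX μY + 2 * h₃ a b μX μY =
      wmoment μX 3 * wmoment μY 1 ^ 3 * gam a b + 2 * (√b - √a) *
        (wmoment μX 2 ^ 2 * wmoment μY 1 ^ 2 * wmoment μY 2 * gam a b) := by
    rw [h₂, h₃]
    ring
  rw [hval]
  refine tendsto_integral_of_edgeCount_bounds ha hb hX hY hl
    (φ := fun mX mY => mX 3 * mY 1 ^ 3 * gam a b +
      2 * (√b - √a) * (mX 2 ^ 2 * mY 1 ^ 2 * mY 2 * gam a b))
    (fun p q => isAnchored_path_union_path (Or.inl rfl) q.1 q.2.1 q.2.2)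
    (Q := fun p => reach a b p ×ˢ (reach a b p ×ˢ others a b p))
    (fun mX mY => ?_) ?_ (fun p => integrable_adjInd_mul (integrable_otherDeg _) _ _)
    isNegligible_zero (fun p => ?_)
    (fun M => (isNegligible_pathPairCount_mul_stepCount ha hb hl Prod.fst M).add
      (isNegligible_pathCount_mul_cycleCount ha hb hl (Or.inl rfl) M)) fun M => ?_
  · simpa only [Finset.sum_product, twoPathSum] using tendsto_twoPathSum mX mY ha hab hl
  · exact (((tendsto_truncMoment_of_le hX (by norm_num)).mul
      ((tendsto_truncMoment_of_le hY (by norm_num)).pow 3)).mul_const _).add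
        ((((((tendsto_truncMoment_of_le hX (by norm_num)).pow 2).mul
          ((tendsto_truncMoment_of_le hY (by norm_num)).pow 2)).mul
            (tendsto_truncMoment_of_le hY (by norm_num))).mul_const _).const_mul _)
  · filter_upwards [ae_adjInd_le_pathCount ha hab p] with ω hω
    rw [← pathCount_mul_stepCount, add_zero]
    exact adjInd_mul_otherDeg_le hω (Or.inl rfl)
  · filter_upwards [hl.ne] with p hp ω
    rw [← pathCount_mul_stepCount]
    exact mul_sub_le_mul (adjInd_nonneg _ _ _) (otherDeg_nonneg _ _ _ _ _)
      (pathCount_nonneg _ _ _ _ _) (stepCount_nonneg _ _ _ _ _ _)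
      (pathPairCount_nonneg _ _ _ _ _ _) (cycleCount_nonneg _ _ _ _ _ _ _)
      (pathCount_sub_le_adjInd _ _ hp ω) (stepCount_sub_cycleCount_le _ (Or.inl rfl) ω)

lemma distinctDeg_nonneg (a b : ℝ) (p : ℕ × ℕ) (s t : ℕ) (ω : Sample) :
    0 ≤ distinctDeg a b p s t ω :=
  Finset.sum_nonneg fun _ _ => mul_nonneg (adjInd_nonneg _ _ _) (adjInd_nonneg _ _ _)

lemma otherDeg_mul_otherDeg (a b : ℝ) (p : ℕ × ℕ) (s t : ℕ) (ω : Sample) :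
    otherDeg a b p s ω * otherDeg a b p t ω = commonDeg a b p s t ω + distinctDeg a b p s t ω :=
  sum_mul_sum_eq_diag_add_offDiag _ _ _

lemma integrable_adjInd_mul_adjInd {P : Measure Sample} [IsFiniteMeasure P] (s t u v : ℕ) :
    Integrable (fun ω => adjInd s t ω * adjInd u v ω) P :=
  integrable_adjInd_mul (integrable_adjInd _ _) _ _

lemma integrable_commonDeg {P : Measure Sample} [IsFiniteMeasure P] (s t : ℕ) :
    Integrable (commonDeg a b p s t) P :=
  integrable_finsetSum _ fun _ _ => integrable_adjInd_mul_adjInd _ _ _ _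

lemma integrable_distinctDeg {P : Measure Sample} [IsFiniteMeasure P] (s t : ℕ) :
    Integrable (distinctDeg a b p s t) P :=
  integrable_finsetSum _ fun _ _ => integrable_adjInd_mul_adjInd _ _ _ _

lemma pathCount_mul_stepPairCount (T : Set ℝ≥0) (a b : ℝ) (p : ℕ × ℕ) (s t : ℕ) :
    pathCount T (reach a b p) p.1 p.2 * stepPairCount T a b p s t =
      edgeCount T (reach a b p ×ˢ ((reach a b p ×ˢ reach a b p) ×ˢ (others a b p).offDiag))
        fun q => path q.1 p.1 p.2 ∪ (path q.2.1.1 s q.2.2.1 ∪ path q.2.1.2 t q.2.2.2) := by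
  rw [pathCount, stepPairCount, edgeCount_mul]

lemma adjInd_mul_distinctDeg_le (h : ∀ s u, s = p.1 ∨ s = p.2 →
      adjInd s u ω ≤ pathCount T (reach a b p) s u ω) (hs : s = p.1 ∨ s = p.2)
    (ht : t = p.1 ∨ t = p.2) :
    adjInd p.1 p.2 ω * distinctDeg a b p s t ω ≤
      pathCount T (reach a b p) p.1 p.2 ω * stepPairCount T a b p s t ω := by
  rw [stepPairCount_eq_sum]
  exact mul_le_mul (h _ _ (Or.inl rfl)) (Finset.sum_le_sum fun r _ => mul_le_mul (h _ _ hs)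
    (h _ _ ht) (adjInd_nonneg _ _ _) (pathCount_nonneg _ _ _ _ _)) (distinctDeg_nonneg _ _ _ _ _ _)
    (pathCount_nonneg _ _ _ _ _)

lemma pathCount_mul_stepPairCount_sub_le (T : Set ℝ≥0) (hp : p.1 ≠ p.2) (hs : s = p.1 ∨ s = p.2)
    (ht : t = p.1 ∨ t = p.2) (ω : Sample) :
    pathCount T (reach a b p) p.1 p.2 ω * stepPairCount T a b p s t ω -
        (pathPairCount T (reach a b p) p.1 p.1 p.2 ω * stepCount T a b p s ω *
            stepCount T a b p t ω +
          (pathCount T (reach a b p) p.1 p.2 ω * cycleCount T a b p s s ω * stepCount T a b p t ω +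
            pathCount T (reach a b p) p.1 p.2 ω * cycleCount T a b p t t ω *
              stepCount T a b p s ω)) ≤
      adjInd p.1 p.2 ω * distinctDeg a b p s t ω := by
  have hpairs : stepPairCount T a b p s t ω ≤ stepCount T a b p s ω * stepCount T a b p t ω := by
    rw [stepPairCount_eq_sum, stepCount_eq_sum, stepCount_eq_sum]
    exact sum_offDiag_mul_le (fun u => pathCount_nonneg T (reach a b p) s u ω)
      fun u => pathCount_nonneg T (reach a b p) t u ω
  have hdistinct : stepPairCount T a b p s t ω - (cycleCount T a b p s s ω * stepCount T a b p t ω +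
      cycleCount T a b p t t ω * stepCount T a b p s ω) ≤ distinctDeg a b p s t ω := by
    simp only [stepPairCount_eq_sum, cycleCount_eq_sum, stepCount_eq_sum]
    exact sum_offDiag_sub_le_sum_offDiag_adjInd (fun u hu => ne_of_mem_others hu hs)
      fun u hu => ne_of_mem_others hu ht
  have hnonneg : ∀ s t, 0 ≤ cycleCount T a b p s s ω * stepCount T a b p t ω := fun s t =>
    mul_nonneg (cycleCount_nonneg _ _ _ _ _ _ _) (stepCount_nonneg _ _ _ _ _ _)
  have hmul := mul_sub_le_mul (adjInd_nonneg p.1 p.2 ω) (distinctDeg_nonneg a b p s t ω)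
    (pathCount_nonneg T (reach a b p) p.1 p.2 ω) (stepPairCount_nonneg T a b p s t ω)
    (pathPairCount_nonneg T (reach a b p) p.1 p.1 p.2 ω) (add_nonneg (hnonneg s t) (hnonneg t s))
    (pathCount_sub_le_adjInd T (reach a b p) hp ω) hdistinct
  have herr := mul_le_mul_of_nonneg_left hpairs
    (pathPairCount_nonneg T (reach a b p) p.1 p.1 p.2 ω)
  linarith

lemma tendsto_integral_adjInd_mul_distinctDeg (ha : 0 < a) (hab : a < b)
    (hX : Integrable (fun x : ℝ≥0 => (x : ℝ) ^ 4) μX)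
    (hY : Integrable (fun y : ℝ≥0 => (y : ℝ) ^ 3) μY) (hl : IsPairFilter a b l)
    (hα : α = Prod.fst ∨ α = Prod.snd) (hβ : β = Prod.fst ∨ β = Prod.snd)
    {φ : (ℕ → ℝ) → (ℕ → ℝ) → ℝ}
    (hlim : ∀ mX mY, Tendsto (fun p => threePathSum a b mX mY p (α p) (β p) / pairNorm a b p) l
      (𝓝 (φ mX mY)))
    (hφ : Tendsto (fun M : ℕ => φ (truncMoment (Set.Iic (M : ℝ≥0)) μX)
      (truncMoment (Set.Iic (M : ℝ≥0)) μY)) atTop (𝓝 (φ (wmoment μX) (wmoment μY)))) :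
    Tendsto (fun p => (∫ ω, adjInd p.1 p.2 ω * distinctDeg a b p (α p) (β p) ω
      ∂linearLaw a b μX μY) / pairNorm a b p) l (𝓝 (φ (wmoment μX) (wmoment μY))) := by
  have hb := ha.trans hab
  have hαp := fun p => end_eq_or_eq hα p
  have hβp := fun p => end_eq_or_eq hβ p
  refine tendsto_integral_of_edgeCount_bounds ha hb hX hY hl
    (fun p q => isAnchored_path_union_path_union_path (hαp p) (hβp p) q.1 q.2.1.1 q.2.1.2 q.2.2.1
      q.2.2.2)
    (Q := fun p => reach a b p ×ˢ ((reach a b p ×ˢ reach a b p) ×ˢ (others a b p).offDiag))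
    (fun mX mY => ?_) hφ (fun p => integrable_adjInd_mul (integrable_distinctDeg _ _) _ _)
    isNegligible_zero (fun p => ?_)
    (fun M => (isNegligible_pathPairCount_mul_stepCount_mul_stepCount ha hb hl α β M).add
      ((isNegligible_pathCount_mul_cycleCount_mul_stepCount ha hb hl hα β M).add
        (isNegligible_pathCount_mul_cycleCount_mul_stepCount ha hb hl hβ α M))) fun M => ?_
  · simpa only [Finset.sum_product, threePathSum, threePathWeight] using hlim mX mY
  · filter_upwards [ae_adjInd_le_pathCount ha hab p] with ω hω
    rw [← pathCount_mul_stepPairCount, add_zero]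
    exact adjInd_mul_distinctDeg_le hω (hαp p) (hβp p)
  · filter_upwards [hl.ne] with p hp ω
    rw [← pathCount_mul_stepPairCount]
    exact pathCount_mul_stepPairCount_sub_le _ hp (hαp p) (hβp p) ω

lemma tendsto_integral_adjInd_mul_distinctDeg_fst_fst (ha : 0 < a) (hab : a < b)
    (hX : Integrable (fun x : ℝ≥0 => (x : ℝ) ^ 4) μX)
    (hY : Integrable (fun y : ℝ≥0 => (y : ℝ) ^ 3) μY) (hl : IsPairFilter a b l) :
    Tendsto (fun p => (∫ ω, adjInd p.1 p.2 ω * distinctDeg a b p p.1 p.1 ω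
      ∂linearLaw a b μX μY) / pairNorm a b p) l
      (𝓝 (h₄ a b μX μY + 6 * h₅ a b μX μY + 4 * h₆ a b μX μY)) := by
  refine tendsto_integral_adjInd_mul_distinctDeg ha hab hX hY hl (Or.inl rfl) (Or.inl rfl)
    (φ := fun mX mY => mX 4 * mY 1 ^ 4 * gam a b ^ 2 +
      6 * (mX 2 * mX 3 * mY 1 ^ 3 * mY 2 * gam a b ^ 2 * (√b - √a)) +
      4 * (mX 2 ^ 3 * mY 1 ^ 3 * mY 3 * gam a b ^ 2 * (√b - √a) ^ 2))
    (fun mX mY => tendsto_threePathSum_fst_fst mX mY ha hab hl) ?_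
  have hX₂ := tendsto_truncMoment_of_le hX (k := 2) (by norm_num)
  have hX₃ := tendsto_truncMoment_of_le hX (k := 3) (by norm_num)
  have hX₄ := tendsto_truncMoment_of_le hX le_rfl
  have hY₁ := tendsto_truncMoment_of_le hY (k := 1) (by norm_num)
  have hY₂ := tendsto_truncMoment_of_le hY (k := 2) (by norm_num)
  have hY₃ := tendsto_truncMoment_of_le hY le_rfl
  exact (((hX₄.mul (hY₁.pow 4)).mul_const _).add
    (((((hX₂.mul hX₃).mul (hY₁.pow 3)).mul hY₂).mul_const _).mul_const _ |>.const_mul 6)).add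
      (((((hX₂.pow 3).mul (hY₁.pow 3)).mul hY₃).mul_const _).mul_const _ |>.const_mul 4)

lemma tendsto_integral_adjInd_mul_distinctDeg_fst_snd (ha : 0 < a) (hab : a < b)
    (hX : Integrable (fun x : ℝ≥0 => (x : ℝ) ^ 4) μX)
    (hY : Integrable (fun y : ℝ≥0 => (y : ℝ) ^ 3) μY) (hl : IsPairFilter a b l) :
    Tendsto (fun p => (∫ ω, adjInd p.1 p.2 ω * distinctDeg a b p p.1 p.2 ω
      ∂linearLaw a b μX μY) / pairNorm a b p) l
      (𝓝 (h₄ a b μX μY + 4 * h₅ a b μX μY + 4 * h₇ a b μX μY)) := by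
  refine tendsto_integral_adjInd_mul_distinctDeg ha hab hX hY hl (Or.inl rfl) (Or.inr rfl)
    (φ := fun mX mY => mX 4 * mY 1 ^ 4 * gam a b ^ 2 +
      4 * (mX 2 * mX 3 * mY 1 ^ 3 * mY 2 * gam a b ^ 2 * (√b - √a)) +
      4 * (mX 2 ^ 3 * mY 1 ^ 2 * mY 2 ^ 2 * gam a b ^ 2 * (√b - √a) ^ 2))
    (fun mX mY => tendsto_threePathSum_fst_snd mX mY ha hab hl) ?_
  have hX₂ := tendsto_truncMoment_of_le hX (k := 2) (by norm_num)
  have hX₃ := tendsto_truncMoment_of_le hX (k := 3) (by norm_num)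
  have hX₄ := tendsto_truncMoment_of_le hX le_rfl
  have hY₁ := tendsto_truncMoment_of_le hY (k := 1) (by norm_num)
  have hY₂ := tendsto_truncMoment_of_le hY (k := 2) (by norm_num)
  exact (((hX₄.mul (hY₁.pow 4)).mul_const _).add
    (((((hX₂.mul hX₃).mul (hY₁.pow 3)).mul hY₂).mul_const _).mul_const _ |>.const_mul 4)).add
      (((((hX₂.pow 3).mul (hY₁.pow 2)).mul (hY₂.pow 2)).mul_const _).mul_const _ |>.const_mul 4)

lemma edgeCount_reach_product_others (T : Set ℝ≥0) (a b : ℝ) (p : ℕ × ℕ) (ω : Sample) :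
    edgeCount T (reach a b p ×ˢ others a b p)
      (fun q => path q.1 p.1 p.2 ∪ path q.1 p.1 q.2) ω =
        ∑ u ∈ others a b p, starCount T (reach a b p) p.1 p.2 u ω :=
  edgeCount_product _ _ _ _ _

lemma adjInd_mul_commonDeg_le (h : ∀ s u, s = p.1 ∨ s = p.2 →
      adjInd s u ω ≤ pathCount T (reach a b p) s u ω) :
    adjInd p.1 p.2 ω * commonDeg a b p p.1 p.2 ω ≤
      ∑ u ∈ others a b p, starCount T (reach a b p) p.1 p.2 u ω +
        pathCount T (reach a b p) p.1 p.2 ω * cycleCount T a b p p.1 p.2 ω := by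
  rw [commonDeg, cycleCount_eq_sum, Finset.mul_sum, Finset.mul_sum, ← Finset.sum_add_distrib]
  refine Finset.sum_le_sum fun u _ => ?_
  have hcommon : adjInd p.1 u ω * adjInd p.2 u ω ≤
      pathCount T (reach a b p) p.1 u ω * pathCount T (reach a b p) p.2 u ω :=
    mul_le_mul (h _ _ (Or.inl rfl)) (h _ _ (Or.inr rfl)) (adjInd_nonneg _ _ _)
      (pathCount_nonneg _ _ _ _ _)
  exact (mul_le_mul_of_nonneg_left hcommon (adjInd_nonneg _ _ _)).trans
    (adjInd_mul_pathCount_mul_le (h _ _ (Or.inl rfl)))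

lemma sum_starCount_sub_le (T : Set ℝ≥0) (hp : p.1 ≠ p.2) (ω : Sample) :
    ∑ u ∈ others a b p, starCount T (reach a b p) p.1 p.2 u ω -
        pathPairCount T (reach a b p) p.1 p.1 p.2 ω * stepCount T a b p p.1 ω ≤
      adjInd p.1 p.2 ω * commonDeg a b p p.1 p.2 ω := by
  rw [commonDeg, stepCount_eq_sum, Finset.mul_sum, Finset.mul_sum, ← Finset.sum_sub_distrib]
  exact Finset.sum_le_sum fun u hu => starCount_sub_le_adjInd_mul hp
    (ne_of_mem_others hu (Or.inl rfl)).symm (ne_of_mem_others hu (Or.inr rfl)).symm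

lemma tendsto_integral_adjInd_mul_commonDeg (ha : 0 < a) (hab : a < b)
    (hX : Integrable (fun x : ℝ≥0 => (x : ℝ) ^ 4) μX)
    (hY : Integrable (fun y : ℝ≥0 => (y : ℝ) ^ 3) μY) (hl : IsPairFilter a b l) :
    Tendsto (fun p => (∫ ω, adjInd p.1 p.2 ω * commonDeg a b p p.1 p.2 ω
      ∂linearLaw a b μX μY) / pairNorm a b p) l (𝓝 (h₂ a b μX μY)) := by
  have hb := ha.trans hab
  refine tendsto_integral_of_edgeCount_bounds ha hb hX hY hl
    (φ := fun mX mY => mX 3 * mY 1 ^ 3 * gam a b)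
    (fun p q => isAnchored_path_union_path (Or.inl rfl) q.1 q.1 q.2)
    (Q := fun p => reach a b p ×ˢ others a b p) (fun mX mY => ?_)
    (((tendsto_truncMoment_of_le hX (by norm_num)).mul
      ((tendsto_truncMoment_of_le hY (by norm_num)).pow 3)).mul_const _)
    (fun p => integrable_adjInd_mul (integrable_commonDeg _ _) _ _)
    (isNegligible_pathCount_mul_cycleCount_univ ha hb hX hY hl) (fun p => ?_)
    (isNegligible_pathPairCount_mul_stepCount ha hb hl Prod.fst) fun M => ?_
  · simpa only [Finset.sum_product, starSum] using tendsto_starSum mX mY ha hab hl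
  · filter_upwards [ae_adjInd_le_pathCount ha hab p] with ω hω
    rw [edgeCount_reach_product_others]
    exact adjInd_mul_commonDeg_le hω
  · filter_upwards [hl.ne] with p hp ω
    rw [edgeCount_reach_product_others]
    exact sum_starCount_sub_le _ hp ω

end AdjacencyMoments

section PairLimit

variable {a b : ℝ}

lemma pairNorm_pos (ha : 0 < a) (hab : a < b) {p : ℕ × ℕ} {i : ℕ}
    (hfst : 0 < kern a b i p.1) (hsnd : 0 < kern a b i p.2) : 0 < pairNorm a b p :=
  Finset.sum_pos' (fun _ _ => mul_nonneg (kern_nonneg _ _ _ _) (kern_nonneg _ _ _ _))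
    ⟨i, item_mem_reach ha hab (Or.inl rfl) hfst.ne', mul_pos hfst hsnd⟩

lemma exists_kern_pos_of_one_le_sub (ha : 0 < a) {s t : ℕ} (hs : 0 < s) (hst : s ≤ t)
    (h : 1 ≤ b * s - a * t) : ∃ i, 0 < kern a b i s ∧ 0 < kern a b i t := by
  have hs' : (0 : ℝ) < s := by exact_mod_cast hs
  have hst' : (s : ℝ) ≤ t := by exact_mod_cast hst
  have hat : 0 < a * t := mul_pos ha (hs'.trans_le hst')
  have hle := Nat.le_ceil (a * (t : ℝ))
  have hlt := Nat.ceil_lt_add_one hat.le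
  have has : a * s ≤ a * t := mul_le_mul_of_nonneg_left hst' ha.le
  have hb : 0 ≤ b := (pos_of_mul_pos_left (by linarith : 0 < b * s) hs'.le).le
  have hbs : b * s ≤ b * t := mul_le_mul_of_nonneg_left hst' hb
  have hi := hat.trans_le hle
  refine ⟨⌈a * (t : ℝ)⌉₊, ?_, ?_⟩
  · rw [kern, edgeKernel, if_pos ⟨has.trans hle, by linarith⟩]
    exact one_div_pos.2 (Real.sqrt_pos.2 (mul_pos hi hs'))
  · rw [kern, edgeKernel, if_pos ⟨hle, by linarith⟩]
    exact one_div_pos.2 (Real.sqrt_pos.2 (mul_pos hi (hs'.trans_le hst')))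

lemma isPairFilter_pairLimit (ha : 0 < a) (hab : a < b) : IsPairFilter a b (pairLimit a b) := by
  have hlt : ∀ᶠ p : ℕ × ℕ in pairLimit a b, p.1 < p.2 :=
    (eventually_principal.2 fun _ h => h).filter_mono inf_le_right
  have hfst : Tendsto Prod.fst (pairLimit a b) atTop :=
    tendsto_comap.mono_left (inf_le_left.trans (inf_le_left.trans inf_le_left))
  have hsnd : Tendsto Prod.snd (pairLimit a b) atTop :=
    tendsto_comap.mono_left (inf_le_left.trans (inf_le_left.trans inf_le_right))
  have hdiff : Tendsto (fun p : ℕ × ℕ => b * (p.1 : ℝ) - a * (p.2 : ℝ)) (pairLimit a b) atTop :=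
    tendsto_comap.mono_left (inf_le_left.trans inf_le_right)
  refine ⟨hfst, hsnd, hlt.mono fun p hp => hp.ne, ?_⟩
  filter_upwards [hlt, hfst.eventually_gt_atTop 0, hdiff.eventually_ge_atTop 1] with p hp hp₁ hp₂
  obtain ⟨i, hi₁, hi₂⟩ := exists_kern_pos_of_one_le_sub ha hp₁ hp.le hp₂
  exact pairNorm_pos ha hab hi₁ hi₂

end PairLimit

section Degrees

variable {a b : ℝ} {μX μY : Measure ℝ≥0} [IsProbabilityMeasure μX] [IsProbabilityMeasure μY]
  {p : ℕ × ℕ} {s t : ℕ} {ω : Sample}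

lemma neighborSet_subset (ha : 0 < a) (hab : a < b)
    (hω : ∀ e : ℕ × ℕ, ω.2 e = true → edgeKernel a b (fun t : ℕ => (t : ℝ)) e.1 e.2 ≠ 0)
    (p : ℕ × ℕ) :
    (graph ω).neighborSet p.1 ⊆ (insert p.2 (others a b p) : Finset ℕ) := by
  rintro u ⟨hne, i, hs, hu⟩
  rw [Finset.mem_coe, Finset.mem_insert, mem_others]
  by_cases hut : u = p.2
  · exact Or.inl hut
  · have hreach := actor_mem_reach ha hab (Or.inl rfl) (hω (i, p.1) hs) (hω (i, u) hu)
    exact Or.inr ⟨hreach, hne.symm, hut⟩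

lemma deg_eq_sum_adjInd {U : Finset ℕ} (hU : (graph ω).neighborSet s ⊆ U) :
    deg s ω = ∑ u ∈ U, adjInd s u ω := by
  classical
  have hset : (graph ω).neighborSet s = (U.filter fun u => ω ∈ adjEvent s u : Finset ℕ) := by
    ext u
    rw [Finset.mem_coe, Finset.mem_filter]
    exact ⟨fun h => ⟨hU h, h⟩, fun h => h.2⟩
  rw [deg, hset, Set.ncard_coe_finset, Finset.card_filter, Nat.cast_sum]
  refine Finset.sum_congr rfl fun u _ => ?_
  by_cases h : ω ∈ adjEvent s u <;> simp [adjInd, h]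

lemma ae_deg_eq (ha : 0 < a) (hab : a < b) (p : ℕ × ℕ) :
    ∀ᵐ ω ∂linearLaw a b μX μY, ∀ s, s = p.1 ∨ s = p.2 →
      deg s ω = adjInd p.1 p.2 ω + otherDeg a b p s ω := by
  filter_upwards [ae_edgeKernel_ne_zero] with ω hω
  have hdeg : ∀ q : ℕ × ℕ, deg q.1 ω = adjInd q.1 q.2 ω + otherDeg a b q q.1 ω := fun q => by
    rw [deg_eq_sum_adjInd (neighborSet_subset ha hab hω q), otherDeg,
      Finset.sum_insert fun h => (mem_others.1 h).2.2 rfl]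
  rintro s (rfl | rfl)
  · exact hdeg p
  · rw [adjInd_comm]
    simpa only [otherDeg, others_swap, Prod.fst_swap, Prod.snd_swap] using hdeg p.swap

lemma ae_adjInd_mul_deg_eq (ha : 0 < a) (hab : a < b) (p : ℕ × ℕ) :
    ∀ᵐ ω ∂linearLaw a b μX μY, ∀ s, s = p.1 ∨ s = p.2 →
      adjInd p.1 p.2 ω * deg s ω = adjInd p.1 p.2 ω * (1 + otherDeg a b p s ω) := by
  filter_upwards [ae_deg_eq ha hab p] with ω hω s hs
  rw [hω s hs, mul_add, adjInd_mul_self, mul_one_add]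

lemma ae_adjInd_mul_deg_mul_deg_eq (ha : 0 < a) (hab : a < b) (p : ℕ × ℕ) :
    ∀ᵐ ω ∂linearLaw a b μX μY, ∀ s t, (s = p.1 ∨ s = p.2) → (t = p.1 ∨ t = p.2) →
      adjInd p.1 p.2 ω * (deg s ω * deg t ω) = adjInd p.1 p.2 ω *
        (1 + (otherDeg a b p s ω + otherDeg a b p t ω +
          (commonDeg a b p s t ω + distinctDeg a b p s t ω))) := by
  filter_upwards [ae_adjInd_mul_deg_eq ha hab p] with ω hω s t hs ht
  rw [← otherDeg_mul_otherDeg, ← mul_assoc, hω s hs, mul_right_comm, hω t ht]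
  ring

lemma condE_comm (P : Measure Sample) (s t : ℕ) (Z : Sample → ℝ) :
    condE P s t Z = condE P t s Z := by
  rw [condE, condE, condLaw, condLaw, adjEvent_comm]

lemma integral_adjInd (P : Measure Sample) (s t : ℕ) :
    ∫ ω, adjInd s t ω ∂P = P.real (adjEvent s t) :=
  integral_indicator_one (measurableSet_adjEvent s t)

lemma condE_eq_div (P : Measure Sample) (s t : ℕ) (Z : Sample → ℝ) :
    condE P s t Z = (∫ ω, adjInd s t ω * Z ω ∂P) / ∫ ω, adjInd s t ω ∂P := by
  rw [condE, condLaw, ProbabilityTheory.cond, integral_smul_measure,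
    ← integral_indicator (measurableSet_adjEvent s t), ENNReal.toReal_inv, smul_eq_mul,
    div_eq_inv_mul, integral_adjInd]
  congr 1
  refine integral_congr_ae (ae_of_all _ fun ω => ?_)
  by_cases h : ω ∈ adjEvent s t <;> simp [adjInd, h]

lemma memLp_deg (ha : 0 < a) (hab : a < b) (hs : s = p.1 ∨ s = p.2) :
    MemLp (deg s) 2 (condLaw (linearLaw a b μX μY) p.1 p.2) := by
  have hdeg : ∀ᵐ ω ∂condLaw (linearLaw a b μX μY) p.1 p.2,
      deg s ω = adjInd p.1 p.2 ω + otherDeg a b p s ω :=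
    cond_absolutelyContinuous.ae_le ((ae_deg_eq ha hab p).mono fun ω hω => hω s hs)
  have : IsFiniteMeasure (condLaw (linearLaw a b μX μY) p.1 p.2) := by
    unfold condLaw
    infer_instance
  refine MemLp.of_bound (((integrable_adjInd _ _).add
    (integrable_otherDeg s)).aestronglyMeasurable.congr (EventuallyEq.symm hdeg))
    (1 + (others a b p).card) (hdeg.mono fun ω hω => ?_)
  rw [hω, Real.norm_of_nonneg (add_nonneg (adjInd_nonneg _ _ _) (otherDeg_nonneg _ _ _ _ _))]
  refine add_le_add (adjInd_le_one _ _ _) ?_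
  exact (Finset.sum_le_card_nsmul _ _ 1 fun _ _ => adjInd_le_one _ _ _).trans (by simp)

end Degrees

section Constants

variable {a b : ℝ} {μX μY : Measure ℝ≥0}

lemma wmoment_pos {μ : Measure ℝ≥0} {k : ℕ} (h : Integrable (fun x : ℝ≥0 => (x : ℝ) ^ k) μ)
    (hpos : 0 < μ (Set.Ioi 0)) : 0 < wmoment μ k := by
  rw [wmoment, integral_pos_iff_support_of_nonneg (fun x => by positivity) h]
  refine hpos.trans_le (measure_mono fun x hx => ?_)
  have hx' : (0 : ℝ) < x := hx
  exact (pow_pos hx' k).ne'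

lemma sq_wmoment_le {μ : Measure ℝ≥0} [IsFiniteMeasure μ] {k : ℕ}
    (h : Integrable (fun x : ℝ≥0 => (x : ℝ) ^ (k + 2)) μ) :
    wmoment μ (k + 1) ^ 2 ≤ wmoment μ k * wmoment μ (k + 2) := by
  have hk := integrable_pow_of_le h (show k ≤ k + 2 by omega)
  have hk₁ := integrable_pow_of_le h (show k + 1 ≤ k + 2 by omega)
  have hquad : ∀ c : ℝ,
      0 ≤ wmoment μ k * (c * c) + -2 * wmoment μ (k + 1) * c + wmoment μ (k + 2) := fun c => by
    have hnonneg : 0 ≤ ∫ x : ℝ≥0, (x : ℝ) ^ k * (x - c) ^ 2 ∂μ :=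
      integral_nonneg fun x => by positivity
    have hexpand : ∀ x : ℝ≥0, (x : ℝ) ^ k * (x - c) ^ 2 =
        c * c * (x : ℝ) ^ k + -2 * c * (x : ℝ) ^ (k + 1) + (x : ℝ) ^ (k + 2) := fun x => by ring
    simp only [hexpand] at hnonneg
    rw [integral_add (f := fun x : ℝ≥0 => c * c * (x : ℝ) ^ k + -2 * c * (x : ℝ) ^ (k + 1))
        ((hk.const_mul _).add (hk₁.const_mul _)) h,
      integral_add (hk.const_mul _) (hk₁.const_mul _), integral_const_mul,
      integral_const_mul] at hnonneg
    exact hnonneg.trans_eq (by rw [wmoment, wmoment, wmoment]; ring)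
  have hdiscrim := discrim_le_zero hquad
  rw [discrim] at hdiscrim
  linarith

lemma gam_pos (ha : 0 < a) (hab : a < b) : 0 < gam a b :=
  mul_pos two_pos (sub_pos.2 (inv_strictAnti₀ (Real.sqrt_pos.2 ha) (Real.sqrt_lt_sqrt ha.le hab)))

lemma h₁_pos [IsFiniteMeasure μX] [IsFiniteMeasure μY]
    (hX : Integrable (fun x : ℝ≥0 => (x : ℝ) ^ 4) μX)
    (hY : Integrable (fun y : ℝ≥0 => (y : ℝ) ^ 3) μY)
    (hX0 : 0 < μX (Set.Ioi 0)) (hY0 : 0 < μY (Set.Ioi 0)) : 0 < h₁ μX μY :=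
  mul_pos (wmoment_pos (integrable_pow_of_le hX (by norm_num)) hX0)
    (pow_pos (wmoment_pos (integrable_pow_of_le hY (by norm_num)) hY0) 2)

lemma h₂_pos [IsFiniteMeasure μX] [IsFiniteMeasure μY] (ha : 0 < a) (hab : a < b)
    (hX : Integrable (fun x : ℝ≥0 => (x : ℝ) ^ 4) μX)
    (hY : Integrable (fun y : ℝ≥0 => (y : ℝ) ^ 3) μY)
    (hX0 : 0 < μX (Set.Ioi 0)) (hY0 : 0 < μY (Set.Ioi 0)) : 0 < h₂ a b μX μY :=
  mul_pos (mul_pos (wmoment_pos (integrable_pow_of_le hX (by norm_num)) hX0)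
    (pow_pos (wmoment_pos (integrable_pow_of_le hY (by norm_num)) hY0) 3)) (gam_pos ha hab)

lemma h₃_nonneg (ha : 0 < a) (hab : a < b) (μX μY : Measure ℝ≥0) : 0 ≤ h₃ a b μX μY :=
  mul_nonneg (mul_nonneg (mul_nonneg (mul_nonneg (sq_nonneg _) (sq_nonneg _))
    (wmoment_nonneg μY 2)) (gam_pos ha hab).le) (sub_nonneg.2 (Real.sqrt_le_sqrt hab.le))

lemma h₂_mul_h₃ (a b : ℝ) (μX μY : Measure ℝ≥0) :
    h₂ a b μX μY * h₃ a b μX μY = h₁ μX μY * h₅ a b μX μY := by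
  rw [h₁, h₂, h₃, h₅]
  ring

lemma sq_h₂_le [IsFiniteMeasure μX] (a b : ℝ) (μY : Measure ℝ≥0)
    (hX : Integrable (fun x : ℝ≥0 => (x : ℝ) ^ 4) μX) :
    h₂ a b μX μY ^ 2 ≤ h₁ μX μY * h₄ a b μX μY := by
  have h := mul_le_mul_of_nonneg_right (sq_wmoment_le hX)
    (sq_nonneg (wmoment μY 1 ^ 3 * gam a b))
  rw [h₁, h₂, h₄]
  linarith

lemma sq_h₃_le [IsFiniteMeasure μY] (a b : ℝ) (μX : Measure ℝ≥0)
    (hY : Integrable (fun y : ℝ≥0 => (y : ℝ) ^ 3) μY) :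
    h₃ a b μX μY ^ 2 ≤ h₁ μX μY * h₆ a b μX μY := by
  have h := mul_le_mul_of_nonneg_right (sq_wmoment_le hY)
    (sq_nonneg (wmoment μX 2 ^ 2 * wmoment μY 1 ^ 2 * gam a b * (√b - √a)))
  rw [h₁, h₃, h₆]
  linarith

lemma δ₂_sub_sq_δ₁ (a b : ℝ) (hpos : h₁ μX μY ≠ 0) :
    δ₂ a b μX μY - δ₁ a b μX μY ^ 2 =
      (h₁ μX μY * (h₂ a b μX μY + 2 * h₃ a b μX μY) + 2 * (h₂ a b μX μY * h₃ a b μX μY) +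
        (h₁ μX μY * h₄ a b μX μY - h₂ a b μX μY ^ 2) +
        4 * (h₁ μX μY * h₆ a b μX μY - h₃ a b μX μY ^ 2)) / h₁ μX μY ^ 2 := by
  have h₅_eq : h₅ a b μX μY = h₂ a b μX μY * h₃ a b μX μY / h₁ μX μY := by
    rw [h₂_mul_h₃, mul_div_cancel_left₀ _ hpos]
  rw [δ₂, δ₁, h₅_eq]
  field_simp
  ring

lemma δ₂_sub_sq_δ₁_pos [IsFiniteMeasure μX] [IsFiniteMeasure μY] (ha : 0 < a) (hab : a < b)
    (hX : Integrable (fun x : ℝ≥0 => (x : ℝ) ^ 4) μX)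
    (hY : Integrable (fun y : ℝ≥0 => (y : ℝ) ^ 3) μY)
    (hX0 : 0 < μX (Set.Ioi 0)) (hY0 : 0 < μY (Set.Ioi 0)) :
    0 < δ₂ a b μX μY - δ₁ a b μX μY ^ 2 := by
  have hh₁ := h₁_pos hX hY hX0 hY0
  have hh₂ := h₂_pos ha hab hX hY hX0 hY0
  have hh₃ := h₃_nonneg ha hab μX μY
  rw [δ₂_sub_sq_δ₁ a b hh₁.ne']
  refine div_pos ?_ (pow_pos hh₁ 2)
  have hmain : 0 < h₁ μX μY * (h₂ a b μX μY + 2 * h₃ a b μX μY) := by positivity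
  have hcross := mul_nonneg hh₂.le hh₃
  have hX_cauchy := sq_h₂_le a b μY hX
  have hY_cauchy := sq_h₃_le a b μX hY
  linarith

end Constants

section ConditionalMoments

variable {a b : ℝ} {μX μY : Measure ℝ≥0} [IsProbabilityMeasure μX] [IsProbabilityMeasure μY]
  {l : Filter (ℕ × ℕ)}

lemma tendsto_condE (ha : 0 < a) (hab : a < b)
    (hX : Integrable (fun x : ℝ≥0 => (x : ℝ) ^ 4) μX)
    (hY : Integrable (fun y : ℝ≥0 => (y : ℝ) ^ 3) μY)
    (hX0 : 0 < μX (Set.Ioi 0)) (hY0 : 0 < μY (Set.Ioi 0)) (hl : IsPairFilter a b l)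
    {Z E : ℕ × ℕ → Sample → ℝ} {C : ℝ} (hE : ∀ p, Integrable (E p) (linearLaw a b μX μY))
    (hlim : Tendsto (fun p => (∫ ω, adjInd p.1 p.2 ω * E p ω ∂linearLaw a b μX μY) /
      pairNorm a b p) l (𝓝 C))
    (hZ : ∀ p, ∀ᵐ ω ∂linearLaw a b μX μY,
      adjInd p.1 p.2 ω * Z p ω = adjInd p.1 p.2 ω * (1 + E p ω)) :
    Tendsto (fun p => condE (linearLaw a b μX μY) p.1 p.2 (Z p)) l
      (𝓝 (1 + (h₁ μX μY)⁻¹ * C)) := by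
  have hadj := tendsto_integral_adjInd ha hab hX hY hl
  have hne := (h₁_pos hX hY hX0 hY0).ne'
  have hquot := (hadj.add hlim).div hadj hne
  rw [add_div, div_self hne, div_eq_inv_mul C] at hquot
  refine hquot.congr' ?_
  filter_upwards [hl.pos] with p hp
  rw [Pi.div_apply, ← add_div, div_div_div_cancel_right₀ hp.ne', condE_eq_div,
    integral_congr_ae (hZ p)]
  simp only [mul_add, mul_one]
  rw [integral_add (integrable_adjInd _ _) (integrable_adjInd_mul (hE p) _ _)]

lemma tendsto_integral_adjInd_mul_add {P : Measure Sample} {E E' : ℕ × ℕ → Sample → ℝ} {C C' : ℝ}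
    (hE : ∀ p, Integrable (E p) P) (hE' : ∀ p, Integrable (E' p) P)
    (h : Tendsto (fun p => (∫ ω, adjInd p.1 p.2 ω * E p ω ∂P) / pairNorm a b p) l (𝓝 C))
    (h' : Tendsto (fun p => (∫ ω, adjInd p.1 p.2 ω * E' p ω ∂P) / pairNorm a b p) l (𝓝 C')) :
    Tendsto (fun p => (∫ ω, adjInd p.1 p.2 ω * (E p ω + E' p ω) ∂P) / pairNorm a b p) l
      (𝓝 (C + C')) := by
  refine (h.add h').congr fun p => ?_
  simp only [mul_add]
  rw [integral_add (integrable_adjInd_mul (hE p) _ _) (integrable_adjInd_mul (hE' p) _ _), add_div]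

lemma tendsto_condE_deg_mul_deg (ha : 0 < a) (hab : a < b)
    (hX : Integrable (fun x : ℝ≥0 => (x : ℝ) ^ 4) μX)
    (hY : Integrable (fun y : ℝ≥0 => (y : ℝ) ^ 3) μY)
    (hX0 : 0 < μX (Set.Ioi 0)) (hY0 : 0 < μY (Set.Ioi 0)) (hl : IsPairFilter a b l)
    {α β : ℕ × ℕ → ℕ} (hα : α = Prod.fst ∨ α = Prod.snd) (hβ : β = Prod.fst ∨ β = Prod.snd)
    {Cα Cβ Cc Cd : ℝ}
    (hOα : Tendsto (fun p => (∫ ω, adjInd p.1 p.2 ω * otherDeg a b p (α p) ω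
      ∂linearLaw a b μX μY) / pairNorm a b p) l (𝓝 Cα))
    (hOβ : Tendsto (fun p => (∫ ω, adjInd p.1 p.2 ω * otherDeg a b p (β p) ω
      ∂linearLaw a b μX μY) / pairNorm a b p) l (𝓝 Cβ))
    (hc : Tendsto (fun p => (∫ ω, adjInd p.1 p.2 ω * commonDeg a b p (α p) (β p) ω
      ∂linearLaw a b μX μY) / pairNorm a b p) l (𝓝 Cc))
    (hd : Tendsto (fun p => (∫ ω, adjInd p.1 p.2 ω * distinctDeg a b p (α p) (β p) ω
      ∂linearLaw a b μX μY) / pairNorm a b p) l (𝓝 Cd)) :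
    Tendsto (fun p => condE (linearLaw a b μX μY) p.1 p.2 fun ω => deg (α p) ω * deg (β p) ω) l
      (𝓝 (1 + (h₁ μX μY)⁻¹ * (Cα + Cβ + (Cc + Cd)))) := by
  have hO : ∀ (γ : ℕ × ℕ → ℕ) p, Integrable (otherDeg a b p (γ p)) (linearLaw a b μX μY) :=
    fun _ _ => integrable_otherDeg _
  have hC : ∀ p, Integrable (commonDeg a b p (α p) (β p)) (linearLaw a b μX μY) :=
    fun _ => integrable_commonDeg _ _
  have hD : ∀ p, Integrable (distinctDeg a b p (α p) (β p)) (linearLaw a b μX μY) :=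
    fun _ => integrable_distinctDeg _ _
  refine tendsto_condE ha hab hX hY hX0 hY0 hl
    (fun p => ((hO α p).add (hO β p)).add ((hC p).add (hD p)))
    (tendsto_integral_adjInd_mul_add (fun p => (hO α p).add (hO β p))
      (fun p => (hC p).add (hD p)) (tendsto_integral_adjInd_mul_add (hO α) (hO β) hOα hOβ)
      (tendsto_integral_adjInd_mul_add hC hD hc hd)) fun p => ?_
  filter_upwards [ae_adjInd_mul_deg_mul_deg_eq ha hab p] with ω hω
  exact hω _ _ (end_eq_or_eq hα p) (end_eq_or_eq hβ p)

lemma tendsto_condE_deg_fst (ha : 0 < a) (hab : a < b)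
    (hX : Integrable (fun x : ℝ≥0 => (x : ℝ) ^ 4) μX)
    (hY : Integrable (fun y : ℝ≥0 => (y : ℝ) ^ 3) μY)
    (hX0 : 0 < μX (Set.Ioi 0)) (hY0 : 0 < μY (Set.Ioi 0)) (hl : IsPairFilter a b l) :
    Tendsto (fun p => condE (linearLaw a b μX μY) p.1 p.2 (deg p.1)) l (𝓝 (δ₁ a b μX μY)) :=
  tendsto_condE ha hab hX hY hX0 hY0 hl (fun _ => integrable_otherDeg _)
    (tendsto_integral_adjInd_mul_otherDeg ha hab hX hY hl)
    fun p => (ae_adjInd_mul_deg_eq ha hab p).mono fun _ hω => hω _ (Or.inl rfl)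

lemma tendsto_condE_sq_deg_fst (ha : 0 < a) (hab : a < b)
    (hX : Integrable (fun x : ℝ≥0 => (x : ℝ) ^ 4) μX)
    (hY : Integrable (fun y : ℝ≥0 => (y : ℝ) ^ 3) μY)
    (hX0 : 0 < μX (Set.Ioi 0)) (hY0 : 0 < μY (Set.Ioi 0)) (hl : IsPairFilter a b l) :
    Tendsto (fun p => condE (linearLaw a b μX μY) p.1 p.2 fun ω => deg p.1 ω ^ 2) l
      (𝓝 (δ₂ a b μX μY)) := by
  have hother := tendsto_integral_adjInd_mul_otherDeg ha hab hX hY hl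
  have hcommon : ∀ (p : ℕ × ℕ) ω, commonDeg a b p p.1 p.1 ω = otherDeg a b p p.1 ω := fun p ω =>
    Finset.sum_congr rfl fun u _ => adjInd_mul_self _ _ _
  have h := tendsto_condE_deg_mul_deg ha hab hX hY hX0 hY0 hl (Or.inl rfl) (Or.inl rfl) hother
    hother (by simpa only [hcommon] using hother)
    (tendsto_integral_adjInd_mul_distinctDeg_fst_fst ha hab hX hY hl)
  simp only [sq]
  convert h using 2
  rw [δ₂]
  ring

lemma tendsto_condE_deg_snd (ha : 0 < a) (hab : a < b)
    (hX : Integrable (fun x : ℝ≥0 => (x : ℝ) ^ 4) μX)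
    (hY : Integrable (fun y : ℝ≥0 => (y : ℝ) ^ 3) μY)
    (hX0 : 0 < μX (Set.Ioi 0)) (hY0 : 0 < μY (Set.Ioi 0)) (hl : IsPairFilter a b l) :
    Tendsto (fun p => condE (linearLaw a b μX μY) p.1 p.2 (deg p.2)) l (𝓝 (δ₁ a b μX μY)) :=
  (tendsto_map'_iff.1 (tendsto_condE_deg_fst ha hab hX hY hX0 hY0 hl.swap)).congr fun _ =>
    condE_comm _ _ _ _

lemma tendsto_condE_sq_deg_snd (ha : 0 < a) (hab : a < b)
    (hX : Integrable (fun x : ℝ≥0 => (x : ℝ) ^ 4) μX)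
    (hY : Integrable (fun y : ℝ≥0 => (y : ℝ) ^ 3) μY)
    (hX0 : 0 < μX (Set.Ioi 0)) (hY0 : 0 < μY (Set.Ioi 0)) (hl : IsPairFilter a b l) :
    Tendsto (fun p => condE (linearLaw a b μX μY) p.1 p.2 fun ω => deg p.2 ω ^ 2) l
      (𝓝 (δ₂ a b μX μY)) :=
  (tendsto_map'_iff.1 (tendsto_condE_sq_deg_fst ha hab hX hY hX0 hY0 hl.swap)).congr fun _ =>
    condE_comm _ _ _ _

lemma tendsto_condE_deg_fst_mul_deg_snd (ha : 0 < a) (hab : a < b)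
    (hX : Integrable (fun x : ℝ≥0 => (x : ℝ) ^ 4) μX)
    (hY : Integrable (fun y : ℝ≥0 => (y : ℝ) ^ 3) μY)
    (hX0 : 0 < μX (Set.Ioi 0)) (hY0 : 0 < μY (Set.Ioi 0)) (hl : IsPairFilter a b l) :
    Tendsto (fun p => condE (linearLaw a b μX μY) p.1 p.2 fun ω => deg p.1 ω * deg p.2 ω) l
      (𝓝 (δ₂ a b μX μY - bigDelta a b μX μY)) := by
  have hsnd : Tendsto (fun p => (∫ ω, adjInd p.1 p.2 ω * otherDeg a b p p.2 ω
      ∂linearLaw a b μX μY) / pairNorm a b p) l (𝓝 (h₂ a b μX μY + 2 * h₃ a b μX μY)) :=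
    (tendsto_map'_iff.1 (tendsto_integral_adjInd_mul_otherDeg ha hab hX hY hl.swap)).congr
      fun p => by
        simp only [Function.comp, pairNorm_swap, otherDeg, others_swap, Prod.fst_swap,
          Prod.snd_swap, adjInd_comm p.2 p.1]
  have h := tendsto_condE_deg_mul_deg ha hab hX hY hX0 hY0 hl (Or.inl rfl) (Or.inr rfl)
    (tendsto_integral_adjInd_mul_otherDeg ha hab hX hY hl) hsnd
    (tendsto_integral_adjInd_mul_commonDeg ha hab hX hY hl)
    (tendsto_integral_adjInd_mul_distinctDeg_fst_snd ha hab hX hY hl)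
  convert h using 2
  rw [δ₂, bigDelta]
  ring

lemma eventually_adjEvent_pos (ha : 0 < a) (hab : a < b)
    (hX : Integrable (fun x : ℝ≥0 => (x : ℝ) ^ 4) μX)
    (hY : Integrable (fun y : ℝ≥0 => (y : ℝ) ^ 3) μY)
    (hX0 : 0 < μX (Set.Ioi 0)) (hY0 : 0 < μY (Set.Ioi 0)) (hl : IsPairFilter a b l) :
    ∀ᶠ p in l, 0 < linearLaw a b μX μY (adjEvent p.1 p.2) := by
  filter_upwards [hl.pos, (tendsto_integral_adjInd ha hab hX hY hl).eventually_const_lt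
    (h₁_pos hX hY hX0 hY0)] with p hp h
  rw [div_pos_iff_of_pos_right hp, integral_adjInd] at h
  exact (ENNReal.toReal_pos_iff.1 h).1

lemma tendsto_assortativity {P : Measure Sample} {d₁ d₂ D : ℝ} (hvar : 0 < d₂ - d₁ ^ 2)
    (hfst : Tendsto (fun p => condE P p.1 p.2 (deg p.1)) l (𝓝 d₁))
    (hsnd : Tendsto (fun p => condE P p.1 p.2 (deg p.2)) l (𝓝 d₁))
    (hfst_sq : Tendsto (fun p => condE P p.1 p.2 fun ω => deg p.1 ω ^ 2) l (𝓝 d₂))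
    (hsnd_sq : Tendsto (fun p => condE P p.1 p.2 fun ω => deg p.2 ω ^ 2) l (𝓝 d₂))
    (hmul : Tendsto (fun p => condE P p.1 p.2 fun ω => deg p.1 ω * deg p.2 ω) l (𝓝 (d₂ - D))) :
    Tendsto (fun p => assortativity P p.1 p.2) l (𝓝 (1 - D / (d₂ - d₁ ^ 2))) := by
  have hsqrt : √((d₂ - d₁ ^ 2) * (d₂ - d₁ ^ 2)) = d₂ - d₁ ^ 2 := Real.sqrt_mul_self hvar.le
  have hlimit : (d₂ - D - d₁ * d₁) / √((d₂ - d₁ ^ 2) * (d₂ - d₁ ^ 2)) =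
      1 - D / (d₂ - d₁ ^ 2) := by
    rw [hsqrt, one_sub_div hvar.ne']
    ring
  rw [← hlimit]
  exact (hmul.sub (hfst.mul hsnd)).div
    ((hfst_sq.sub (hfst.pow 2)).mul (hsnd_sq.sub (hsnd.pow 2))).sqrt (hsqrt.trans_ne hvar.ne')

end ConditionalMoments

end RandomIntersection

end

theorem mainTheorem4 (a b : ℝ) (ha : 0 < a) (hab : a < b)
    (μX μY : Measure ℝ≥0) [IsProbabilityMeasure μX] [IsProbabilityMeasure μY]
    (hX : Integrable (fun x : ℝ≥0 => (x : ℝ) ^ 4) μX)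
    (hY : Integrable (fun y : ℝ≥0 => (y : ℝ) ^ 3) μY)
    (hX0 : 0 < μX (Set.Ioi 0)) (hY0 : 0 < μY (Set.Ioi 0))
    (P : Measure Sample)
    (hP : P = law a b (fun t : ℕ => (t : ℝ)) μX μY) :
    (∀ᶠ p in pairLimit a b,
      0 < P (adjEvent p.1 p.2) ∧
      MemLp (deg p.1) 2 (condLaw P p.1 p.2) ∧
      MemLp (deg p.2) 2 (condLaw P p.1 p.2)) ∧
    Tendsto (fun p : ℕ × ℕ => condE P p.1 p.2 (deg p.1))
      (pairLimit a b) (𝓝 (δ₁ a b μX μY)) ∧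
    Tendsto (fun p : ℕ × ℕ => condE P p.1 p.2 (deg p.2))
      (pairLimit a b) (𝓝 (δ₁ a b μX μY)) ∧
    Tendsto (fun p : ℕ × ℕ =>
        condE P p.1 p.2 (fun ω => deg p.1 ω ^ 2))
      (pairLimit a b) (𝓝 (δ₂ a b μX μY)) ∧
    Tendsto (fun p : ℕ × ℕ =>
        condE P p.1 p.2 (fun ω => deg p.2 ω ^ 2))
      (pairLimit a b) (𝓝 (δ₂ a b μX μY)) ∧
    Tendsto (fun p : ℕ × ℕ => condE P p.1 p.2
        (fun ω => deg p.1 ω * deg p.2 ω))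
      (pairLimit a b)
      (𝓝 (δ₂ a b μX μY - bigDelta a b μX μY)) ∧
    0 < δ₂ a b μX μY - δ₁ a b μX μY ^ 2 ∧
    Tendsto (fun p : ℕ × ℕ => assortativity P p.1 p.2)
      (pairLimit a b)
      (𝓝 (1 - bigDelta a b μX μY /
        (δ₂ a b μX μY - δ₁ a b μX μY ^ 2))) := by
  subst hP
  have hl := isPairFilter_pairLimit ha hab
  have hfst := tendsto_condE_deg_fst ha hab hX hY hX0 hY0 hl
  have hsnd := tendsto_condE_deg_snd ha hab hX hY hX0 hY0 hl
  have hfst_sq := tendsto_condE_sq_deg_fst ha hab hX hY hX0 hY0 hl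
  have hsnd_sq := tendsto_condE_sq_deg_snd ha hab hX hY hX0 hY0 hl
  have hmul := tendsto_condE_deg_fst_mul_deg_snd ha hab hX hY hX0 hY0 hl
  have hvar := δ₂_sub_sq_δ₁_pos ha hab hX hY hX0 hY0
  refine ⟨?_, hfst, hsnd, hfst_sq, hsnd_sq, hmul, hvar,
    tendsto_assortativity hvar hfst hsnd hfst_sq hsnd_sq hmul⟩
  filter_upwards [eventually_adjEvent_pos ha hab hX hY hX0 hY0 hl] with p hp
  exact ⟨hp, memLp_deg ha hab (Or.inl rfl), memLp_deg ha hab (Or.inr rfl)⟩
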